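/- Let $k$ be an algebraically closed field, let $\Sigma$ be a nonsingular complete fan in $N=\mathbb{Z}^5$, and let $X=X_\Sigma$ be the associated smooth complete toric variety over $k$. Write $\mathrm{G}(\Sigma)\subset N$ for the set of primitive generators of the one-dimensional cones of $\Sigma$. A subset $P\subset \mathrm{G}(\Sigma)$ is called a primitive collection if $P$ does not generate a cone of $\Sigma$ while every proper subset of $P$ does. In that case there are a unique cone of $\Sigma$, with set of primitive generators $\{y_1,\dots,y_n\}$, and unique positive integers $b_1,\dots,b_n$ such that $\sum_{x\in P}x=b_1y_1+\dots+b_ny_n$ (the primitive relation of $P$). This relation defines a class $r(P)$ in $$A_1(X)\simeq\Big\{(b_x)_{x\in \mathrm{G}(\Sigma)}\in\mathbb{Z}^{\mathrm{G}(\Sigma)}\ \Big|\ \sum_{x} b_x x=0\Big\},$$ where the class of a curve $C\subset X$ corresponds to the tuple of its intersection numbers $(D_x\cdot C)_x$ with the torus-invariant prime divisors $D_x$. The collection $P$ and its primitive relation are called extremal if $r(P)$ is contained in an extremal ray of the Mori cone $\mathrm{NE}(X)\subset A_1(X)\otimes\mathbb{R}$, the cone spanned by the classes of curves in $X$. Suppose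 that $X$ is Fano, i.e. that $-K_X$ is ample, and that $X$ has index $2$, i.e. that $2$ is the largest integer $m\ge 1$ such that $-K_X= mH$ in $\mathrm{Pic}(X)$ for some Cartier divisor $H$. Suppose moreover that there is an extremal primitive collection $\{x_1,x_2,x_3,x_4\}\subset \mathrm{G}(\Sigma)$ with four elements whose primitive relation is $x_1+x_2+x_3+x_4=0$. Then $X$ is isomorphic over $k$ to $$\mathbb{P}^1\times\mathbb{P}^1\times\mathbb{P}^3\qquad\text{or to}\qquad \mathbb{P}_{\mathbb{P}^2}\big(\mathcal{O}\oplus\mathcal{O}\oplus\mathcal{O}\oplus\mathcal{O}(1)\big),$$ where $\mathbb{P}(E)=\mathrm{Proj}(\mathrm{Sym}\,E)$. -/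

import Mathlib

open CategoryTheory CategoryTheory.Limits AlgebraicGeometry

universe u

namespace ToricFano

/-- The cone in `N ⊗ ℝ = ℝᵈ` spanned by a finite set of lattice vectors. -/
def realCone {d : ℕ} (c : Finset (Fin d → ℤ)) : PointedCone ℝ (Fin d → ℝ) :=
  PointedCone.hull ℝ ((fun v i => (v i : ℝ)) '' (c : Set (Fin d → ℤ)))

/-- A nonsingular complete fan in `N = ℤᵈ`. A nonsingular cone is spanned by part of a `ℤ`-basis
of `N`, and it is recorded by the finite set of its primitive generators; its faces are the cones
spanned by the subsets of that set. -/
structure SmoothCompleteFan (d : ℕ) where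
  /-- the generating sets of the cones of the fan -/
  cones : Finset (Finset (Fin d → ℤ))
  nonsingular : ∀ c ∈ cones, ∃ b : Module.Basis (Fin d) ℤ (Fin d → ℤ), ↑c ⊆ Set.range b
  face_mem : ∀ c ∈ cones, ∀ c' ⊆ c, c' ∈ cones
  inter_eq : ∀ c ∈ cones, ∀ c' ∈ cones, realCone c ⊓ realCone c' = realCone (c ∩ c')
  complete : ∀ x : Fin d → ℝ, ∃ c ∈ cones, x ∈ realCone c

/-- The monoid `σ^∨ ∩ M`, where `M = Hom(N, ℤ)` and `σ` is the cone spanned by `c`. -/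
def dualMonoid {d : ℕ} (c : Finset (Fin d → ℤ)) : AddSubmonoid (Module.Dual ℤ (Fin d → ℤ)) where
  carrier := {u | ∀ v ∈ c, 0 ≤ u v}
  zero_mem' := by simp
  add_mem' := fun {a b} ha hb v hv => by
    simpa using add_nonneg (ha v hv) (hb v hv)

lemma mem_dualMonoid {d : ℕ} {c : Finset (Fin d → ℤ)} {u : Module.Dual ℤ (Fin d → ℤ)} :
    u ∈ dualMonoid c ↔ ∀ v ∈ c, 0 ≤ u v := Iff.rfl

lemma dualMonoid_anti {d : ℕ} {a c : Finset (Fin d → ℤ)} (h : a ⊆ c) :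
    dualMonoid c ≤ dualMonoid a := fun _ hu v hv => hu v (h hv)

section Chart

variable (k : Type u) [Field k] {d : ℕ}

/-- The semigroup algebra `k[σ^∨ ∩ M]`. -/
abbrev ChartRing (c : Finset (Fin d → ℤ)) : Type u := AddMonoidAlgebra k (dualMonoid c)

/-- The inclusion `k[σ^∨ ∩ M] → k[τ^∨ ∩ M]` for a face `τ` of `σ`. -/
noncomputable def chartMap {a c : Finset (Fin d → ℤ)} (h : a ⊆ c) :
    ChartRing k c →ₐ[k] ChartRing k a :=
  AddMonoidAlgebra.mapDomainAlgHom k k (AddSubmonoid.inclusion (dualMonoid_anti h))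

instance (c : Finset (Fin d → ℤ)) : UniqueSums (dualMonoid c) :=
  UniqueSums.of_injective_addHom (H := dualMonoid c) (G := Fin d → ℤ)
    { toFun := fun u i => u.1 (Pi.single i 1), map_add' := fun _ _ => rfl }
    (fun u w h => Subtype.ext <| (Pi.basisFun ℤ (Fin d)).ext fun i => by
      simpa using congrFun h i) inferInstance

lemma exists_separating {a c : Finset (Fin d → ℤ)} (h : a ⊆ c)
    (hc : ∃ b : Module.Basis (Fin d) ℤ (Fin d → ℤ), ↑c ⊆ Set.range b) :
    ∃ u : Module.Dual ℤ (Fin d → ℤ), (∀ v ∈ a, u v = 0) ∧ ∀ v ∈ c, v ∉ a → u v = 1 := by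
  classical
  obtain ⟨b, hb⟩ := hc
  refine ⟨b.constr ℤ (fun i => if b i ∈ a then 0 else 1), fun v hv => ?_, fun v hv hva => ?_⟩
  · obtain ⟨i, rfl⟩ := hb (h hv)
    rw [Module.Basis.constr_basis, if_pos hv]
  · obtain ⟨i, rfl⟩ := hb hv
    rw [Module.Basis.constr_basis, if_neg hva]

lemma chartMap_single {a c : Finset (Fin d → ℤ)} (h : a ⊆ c) (m : dualMonoid c) (r : k) :
    chartMap k h (AddMonoidAlgebra.single m r) =
      AddMonoidAlgebra.single ⟨m.1, dualMonoid_anti h m.2⟩ r := by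
  simp [chartMap]; rfl

lemma chartMap_refl {c : Finset (Fin d → ℤ)} (h : c ⊆ c) : chartMap k h = AlgHom.id k _ :=
  AlgHom.ext fun x => by
    induction x using AddMonoidAlgebra.induction_on with
    | of w => exact chartMap_single k h _ 1
    | add x y hx hy => rw [map_add, map_add, hx, hy]
    | smul r x hx => rw [map_smul, map_smul, hx]

lemma chartMap_comp {a b c : Finset (Fin d → ℤ)} (h : a ⊆ b) (h' : b ⊆ c) :
    (chartMap k h).comp (chartMap k h') = chartMap k (h.trans h') :=
  AlgHom.ext fun x => by
    induction x using AddMonoidAlgebra.induction_on with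
    | of w =>
      rw [AddMonoidAlgebra.of_apply, AlgHom.comp_apply, chartMap_single, chartMap_single,
        chartMap_single]
    | add x y hx hy => rw [map_add, map_add, hx, hy]
    | smul r x hx => rw [map_smul, map_smul, hx]

lemma chartMap_injective {a c : Finset (Fin d → ℤ)} (h : a ⊆ c) :
    Function.Injective (chartMap k h) := by
  apply AddMonoidAlgebra.mapDomain_injective
  exact AddSubmonoid.inclusion_injective _

/-- Passing to a face inverts one character. -/
lemma isLocalization_chartMap {a c : Finset (Fin d → ℤ)} (h : a ⊆ c)
    (u : dualMonoid c) (hu0 : ∀ v ∈ a, u.1 v = 0) (hu1 : ∀ v ∈ c, v ∉ a → 1 ≤ u.1 v) :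
    letI := (chartMap k h).toRingHom.toAlgebra
    IsLocalization.Away (AddMonoidAlgebra.single u (1 : k) : ChartRing k c) (ChartRing k a) := by
  letI := (chartMap k h).toRingHom.toAlgebra
  have halg : ∀ x, algebraMap (ChartRing k c) (ChartRing k a) x = chartMap k h x := fun _ => rfl
  have hpow : ∀ n : ℕ, (AddMonoidAlgebra.single u (1 : k) : ChartRing k c) ^ n =
      AddMonoidAlgebra.single (n • u) 1 := fun n => by
    rw [AddMonoidAlgebra.single_pow, one_pow]
  refine IsLocalization.Away.mk _ ?_ (fun s => ?_) fun x y hxy => ⟨0, ?_⟩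
  · rw [halg, chartMap_single]
    refine IsUnit.of_mul_eq_one
      (AddMonoidAlgebra.single ⟨-u.1, fun v hv => by simp [hu0 v hv]⟩ 1) ?_
    rw [AddMonoidAlgebra.single_mul_single, AddMonoidAlgebra.one_def, mul_one]
    congr 1
    exact Subtype.ext (add_neg_cancel u.1)
  · have hmon : ∀ w : dualMonoid a, ∃ n : ℕ, w.1 + n • u.1 ∈ dualMonoid c := fun w => by
      refine ⟨∑ v ∈ c, (w.1 v).natAbs, fun v hv => ?_⟩
      rw [LinearMap.add_apply, LinearMap.smul_apply]
      by_cases hva : v ∈ a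
      · rw [hu0 v hva, smul_zero, add_zero]
        exact w.2 v hva
      · rw [nsmul_eq_mul]
        have h1 := mul_le_mul_of_nonneg_left (hu1 v hv hva)
          (Int.natCast_nonneg (∑ v ∈ c, (w.1 v).natAbs))
        have := Finset.single_le_sum (f := fun v => (w.1 v).natAbs) (fun _ _ => Nat.zero_le _) hv
        omega
    induction s using AddMonoidAlgebra.induction_on with
    | of w =>
      obtain ⟨n, hn⟩ := hmon (Multiplicative.toAdd w)
      refine ⟨n, AddMonoidAlgebra.single ⟨_, hn⟩ 1, ?_⟩
      rw [← map_pow, hpow, halg, halg, chartMap_single, chartMap_single, AddMonoidAlgebra.of_apply,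
        AddMonoidAlgebra.single_mul_single, one_mul]
      rfl
    | add x y hx hy =>
      obtain ⟨n, p, hp⟩ := hx
      obtain ⟨m, q, hq⟩ := hy
      refine ⟨n + m, p * AddMonoidAlgebra.single u 1 ^ m + q * AddMonoidAlgebra.single u 1 ^ n, ?_⟩
      rw [map_add, map_mul, map_mul, ← hp, ← hq, map_pow, map_pow]
      ring
    | smul r x hx =>
      obtain ⟨n, p, hp⟩ := hx
      refine ⟨n, r • p, ?_⟩
      rw [smul_mul_assoc, hp, halg, halg, map_smul]
  · rw [pow_zero, one_mul, one_mul]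
    exact chartMap_injective k h hxy

lemma dualMonoid_fg {c : Finset (Fin d → ℤ)}
    (hc : ∃ b : Module.Basis (Fin d) ℤ (Fin d → ℤ), ↑c ⊆ Set.range b) :
    (dualMonoid c).FG := by
  classical
  obtain ⟨b, hb⟩ := hc
  refine (AddSubmonoid.fg_iff _).2 ⟨Set.range (fun i => b.coord i) ∪
    (fun i => -b.coord i) '' {i | b i ∉ c}, le_antisymm ?_ fun u hu => ?_,
    (Set.finite_range _).union (Set.toFinite _)⟩
  · rw [AddSubmonoid.closure_le]
    rintro _ (⟨i, rfl⟩ | ⟨i, hi, rfl⟩) v hv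
    · obtain ⟨j, rfl⟩ := hb hv
      simp only [Module.Basis.coord_apply, Module.Basis.repr_self, Finsupp.single_apply]
      split_ifs <;> simp
    · obtain ⟨j, rfl⟩ := hb hv
      have hij : j ≠ i := fun h => hi (h ▸ hv)
      simp [hij]
  · have hsum : u = ∑ i, u (b i) • b.coord i := by
      refine b.ext fun j => ?_
      simp
    rw [hsum]
    refine sum_mem fun i _ => ?_
    by_cases hi : 0 ≤ u (b i)
    · obtain ⟨n, hn⟩ := Int.eq_ofNat_of_zero_le hi
      rw [hn, natCast_zsmul]
      exact nsmul_mem (AddSubmonoid.subset_closure (Set.mem_union_left _ (Set.mem_range_self i))) n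
    · have hic : b i ∉ c := fun h => hi (hu _ h)
      obtain ⟨n, hn⟩ := Int.eq_ofNat_of_zero_le (neg_nonneg.2 (not_le.1 hi).le)
      have : u (b i) • b.coord i = n • (-b.coord i) := by
        rw [show u (b i) = -(n : ℤ) by omega, neg_smul, natCast_zsmul, smul_neg]
      rw [this]
      exact nsmul_mem (AddSubmonoid.subset_closure (Set.mem_union_right _ (Set.mem_image_of_mem _ hic))) n

lemma isNoetherianRing_chartRing {c : Finset (Fin d → ℤ)}
    (hc : ∃ b : Module.Basis (Fin d) ℤ (Fin d → ℤ), ↑c ⊆ Set.range b) :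
    IsNoetherianRing (ChartRing k c) := by
  have : AddMonoid.FG (dualMonoid c) :=
    (AddMonoid.fg_iff_addSubmonoid_fg _).2 (dualMonoid_fg hc)
  exact Algebra.FiniteType.isNoetherianRing k _

end Chart

namespace SmoothCompleteFan

variable {d : ℕ} (F : SmoothCompleteFan d) (k : Type u) [Field k]

/-- The diagram of the affine charts `U_σ = Spec k[σ^∨ ∩ M]`, for the cones `σ` of the fan ordered
by inclusion of faces. -/
noncomputable def chartFunctor : F.cones ⥤ Scheme.{u} where
  obj c := Spec (.of (ChartRing k c.1))
  map f := Spec.map (CommRingCat.ofHom (chartMap k (leOfHom f)).toRingHom)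
  map_id c := by
    rw [chartMap_refl]
    exact Spec.map_id _
  map_comp f g := by
    rw [← Spec.map_comp, ← chartMap_comp k (leOfHom f) (leOfHom g)]
    rfl

lemma exists_separating' {a c : F.cones} (h : a ≤ c) :
    ∃ u : dualMonoid c.1, (∀ v ∈ a.1, u.1 v = 0) ∧ ∀ v ∈ c.1, v ∉ a.1 → 1 ≤ u.1 v := by
  obtain ⟨u, hu0, hu1⟩ := exists_separating h (F.nonsingular _ c.2)
  refine ⟨⟨u, fun v hv => ?_⟩, hu0, fun v hv hva => (hu1 v hv hva).ge⟩
  by_cases hva : v ∈ a.1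
  · exact (hu0 v hva).ge
  · simp [hu1 v hv hva]

instance {a c : F.cones} (f : a ⟶ c) : IsOpenImmersion ((F.chartFunctor k).map f) := by
  obtain ⟨u, hu0, hu1⟩ := F.exists_separating' (leOfHom f)
  let := (chartMap k (leOfHom f)).toRingHom.toAlgebra
  have := isLocalization_chartMap k (leOfHom f) u hu0 hu1
  exact IsOpenImmersion.of_isLocalization (AddMonoidAlgebra.single u (1 : k) : ChartRing k c.1)

lemma range_chartFunctor_map {a c : F.cones} (f : a ⟶ c) (u : dualMonoid c.1)
    (hu0 : ∀ v ∈ a.1, u.1 v = 0) (hu1 : ∀ v ∈ c.1, v ∉ a.1 → 1 ≤ u.1 v) :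
    Set.range ((F.chartFunctor k).map f) =
      (PrimeSpectrum.basicOpen (AddMonoidAlgebra.single u (1 : k) : ChartRing k c.1) :
        Set (PrimeSpectrum (ChartRing k c.1))) := by
  let := (chartMap k (leOfHom f)).toRingHom.toAlgebra
  have := isLocalization_chartMap k (leOfHom f) u hu0 hu1
  exact PrimeSpectrum.localization_away_comap_range (ChartRing k a.1) _

instance : (F.chartFunctor k ⋙ Scheme.forget).IsLocallyDirected where
  cond {a b c} f g x y hxy := by
    classical
    change (F.chartFunctor k).map f x = (F.chartFunctor k).map g y at hxy
    obtain ⟨u, hu0, hu1⟩ := F.exists_separating' (leOfHom f)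
    obtain ⟨w, hw0, hw1⟩ := F.exists_separating' (leOfHom g)
    let l : F.cones := ⟨a.1 ∩ b.1, F.face_mem _ a.2 _ Finset.inter_subset_left⟩
    let fa : l ⟶ a := homOfLE (show a.1 ∩ b.1 ⊆ a.1 from Finset.inter_subset_left)
    let fb : l ⟶ b := homOfLE (show a.1 ∩ b.1 ⊆ b.1 from Finset.inter_subset_right)
    have hr := F.range_chartFunctor_map k (fa ≫ f) (u + w)
      (fun v hv => by
        have h1 := hu0 v (Finset.mem_inter.1 hv).1
        have h2 := hw0 v (Finset.mem_inter.1 hv).2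
        simp [h1, h2])
      (fun v hv hvl => by
        have h1 := u.2 v hv
        have h2 := w.2 v hv
        have h3 : v ∉ a.1 ∨ v ∉ b.1 := by
          by_contra! h
          exact hvl (Finset.mem_inter.2 h)
        change 1 ≤ u.1 v + w.1 v
        rcases h3 with h3 | h3
        · have := hu1 v hv h3
          omega
        · have := hw1 v hv h3
          omega)
    have hx : (F.chartFunctor k).map f x ∈ Set.range ((F.chartFunctor k).map (fa ≫ f)) := by
      have h1 : (F.chartFunctor k).map f x ∈ Set.range ((F.chartFunctor k).map f) := ⟨x, rfl⟩
      have h2 : (F.chartFunctor k).map f x ∈ Set.range ((F.chartFunctor k).map g) :=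
        ⟨y, hxy.symm⟩
      rw [F.range_chartFunctor_map k f u hu0 hu1] at h1
      rw [F.range_chartFunctor_map k g w hw0 hw1] at h2
      have h3 : (AddMonoidAlgebra.single (u + w) (1 : k) : ChartRing k c.1) =
          AddMonoidAlgebra.single u 1 * AddMonoidAlgebra.single w 1 := by
        rw [AddMonoidAlgebra.single_mul_single, one_mul]
      rw [hr, h3, PrimeSpectrum.basicOpen_mul]
      exact ⟨h1, h2⟩
    obtain ⟨z, hz⟩ := hx
    refine ⟨l, fa, fb, z, ?_, ?_⟩
    · apply ((F.chartFunctor k).map f).injective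
      change ((F.chartFunctor k).map fa ≫ (F.chartFunctor k).map f) z = _
      rw [← Functor.map_comp, hz]
    · apply ((F.chartFunctor k).map g).injective
      change ((F.chartFunctor k).map fb ≫ (F.chartFunctor k).map g) z = _
      rw [← Functor.map_comp, Subsingleton.elim (fb ≫ g) (fa ≫ f), hz, hxy]

/-- The toric variety `X_Σ` over `k`, glued from the affine charts `U_σ` along the open immersions
`U_τ ⊆ U_σ` for the faces `τ` of `σ`. -/
noncomputable def toricVariety : Scheme.{u} := colimit (F.chartFunctor k)

/-- The inclusion of the chart `U_σ`. -/
noncomputable def chartι (c : F.cones) : Spec (.of (ChartRing k c.1)) ⟶ F.toricVariety k :=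
  colimit.ι (F.chartFunctor k) c

/-- The structure morphism `X_Σ → Spec k`. -/
noncomputable def structureMap : F.toricVariety k ⟶ Spec (.of k) :=
  colimit.desc (F.chartFunctor k)
    { pt := Spec (.of k)
      ι :=
        { app := fun c => Spec.map (CommRingCat.ofHom (algebraMap k (ChartRing k c.1)))
          naturality := fun a c f => by
            refine (Spec.map_comp _ _).symm.trans ?_
            refine Eq.trans ?_ (Category.comp_id _).symm
            congr 1
            exact CommRingCat.hom_ext (chartMap k (leOfHom f)).comp_algebraMap } }

lemma empty_mem_cones : ∅ ∈ F.cones := by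
  obtain ⟨c, hc, -⟩ := F.complete 0
  exact F.face_mem c hc ∅ (Finset.empty_subset c)

/-- The affine open cover of `X_Σ` by the charts. -/
noncomputable def chartCover : (F.toricVariety k).OpenCover :=
  Scheme.IsLocallyDirected.openCover (F.chartFunctor k)

instance (c : (F.chartCover k).I₀) : IsAffine ((F.chartCover k).X c) :=
  inferInstanceAs (IsAffine (Spec (.of (ChartRing k (c : F.cones).1))))

instance (c : (F.chartCover k).I₀) : AlgebraicGeometry.IsIntegral ((F.chartCover k).X c) :=
  inferInstanceAs (AlgebraicGeometry.IsIntegral (Spec (.of (ChartRing k (c : F.cones).1))))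

instance : IsLocallyNoetherian (F.toricVariety k) := by
  rw [isLocallyNoetherian_iff_of_affine_openCover (F.chartCover k)]
  intro c
  have := isNoetherianRing_chartRing k (F.nonsingular _ (c : F.cones).2)
  exact isNoetherianRing_of_ringEquiv (ChartRing k (c : F.cones).1)
    (Scheme.ΓSpecIso (.of (ChartRing k (c : F.cones).1))).symm.commRingCatIsoToRingEquiv

instance (c : F.cones) : IrreducibleSpace ((F.chartFunctor k).obj c) :=
  inferInstanceAs (IrreducibleSpace (Spec (.of (ChartRing k c.1))))

instance : IrreducibleSpace (F.toricVariety k) := by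
  let o : F.cones := ⟨∅, F.empty_mem_cones⟩
  let ι (c : F.cones) := colimit.ι (F.chartFunctor k) c
  have hT : IsIrreducible (Set.range (ι o)) := by
    rw [← Set.image_univ]
    exact (IrreducibleSpace.isIrreducible_univ _).image _ (ι o).continuous.continuousOn
  have hd : closure (Set.range (ι o)) = Set.univ := by
    refine Set.eq_univ_of_forall fun x => ?_
    obtain ⟨c, y, rfl⟩ : ∃ c y, ι c y = x :=
      Scheme.IsLocallyDirected.ι_jointly_surjective (F.chartFunctor k) x
    let f : o ⟶ c := homOfLE (Finset.empty_subset c.1)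
    have hf : (F.chartFunctor k).map f ≫ ι c = ι o := colimit.w (F.chartFunctor k) f
    have hden : Dense (Set.range ((F.chartFunctor k).map f)) :=
      (((F.chartFunctor k).map f).isOpenEmbedding.isOpen_range).dense (Set.range_nonempty _)
    have hy := image_closure_subset_closure_image (ι c).continuous ⟨y, hden y, rfl⟩
    refine closure_mono ?_ hy
    rintro _ ⟨_, ⟨z, rfl⟩, rfl⟩
    exact ⟨z, by rw [← hf]; rfl⟩
  have := hT.closure
  rw [hd] at this
  exact (irreducibleSpace_def _).2 this

instance : AlgebraicGeometry.IsIntegral (F.toricVariety k) :=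
  have : AlgebraicGeometry.IsReduced (F.toricVariety k) := .of_openCover _ (F.chartCover k)
  isIntegral_of_irreducibleSpace_of_isReduced _

end SmoothCompleteFan

/-! ### Divisors on an integral, locally noetherian scheme

Points of a scheme are ordered by specialization, so that `Order.coheight y = 1` means that the
closure of `y` is a prime divisor and `Order.height y = 1` that this closure is a curve. A divisor
is given by its multiplicities: `D y` is the multiplicity of the closure of `y`. The order of
vanishing `X.ord f y` of a rational function is `0` unless the closure of `y` is a prime divisor. -/

section Divisor

variable {X : Scheme.{u}} [AlgebraicGeometry.IsIntegral X] [IsLocallyNoetherian X]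

/-- `D` is a Cartier divisor: locally the divisor of a nonzero rational function. (On a normal
scheme Cartier divisors are the same thing as locally principal Weil divisors.) -/
def IsCartier (D : X → ℤ) : Prop :=
  ∀ x : X, ∃ U : X.Opens, x ∈ U ∧ ∃ f : X.functionField, f ≠ 0 ∧ ∀ y ∈ U, D y = X.ord f y

/-- Linear equivalence of divisors. -/
def LinEquiv (D E : X → ℤ) : Prop :=
  ∃ f : X.functionField, f ≠ 0 ∧ ∀ y, D y - E y = X.ord f y

/-- Ampleness of the Cartier divisor `D` on a normal scheme: every point has an affine open
neighbourhood that is the locus where some section `f` of some `𝒪(nD)`, `n ≥ 1`, generates `𝒪(nD)`,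
in other words the complement of the support of the effective divisor `nD + div f`. -/
def IsAmple (D : X → ℤ) : Prop :=
  CompactSpace X ∧ ∀ x : X, ∃ n : ℕ, 1 ≤ n ∧ ∃ f : X.functionField, f ≠ 0 ∧
    (∀ y, 0 ≤ n * D y + X.ord f y) ∧
    ∃ U : X.Opens, IsAffineOpen U ∧ x ∈ U ∧ ∀ z, z ∈ U ↔ ∀ y, y ⤳ z → n * D y + X.ord f y = 0

/-- The local ring of `X` at `x`, as a subring of the function field. -/
noncomputable def localSubring (x : X) : Subring X.functionField :=
  (algebraMap (X.presheaf.stalk x) X.functionField).range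

/-- The function field of a scheme over `k`, as a `k`-algebra. -/
noncomputable abbrev functionFieldAlgebra {k : Type u} [Field k] (s : X ⟶ Spec (.of k)) :
    Algebra k X.functionField :=
  ((Scheme.ΓSpecIso (.of k)).inv ≫ s.appTop ≫ X.presheaf.germ ⊤ (genericPoint X) trivial).hom.toAlgebra

open scoped KaehlerDifferential in
/-- `D` is the divisor of a nonzero rational differential form `ω` of degree `d` on `X`. At a prime
divisor with generic point `x`, the forms that are regular there are the `𝒪ₓ`-span of the
`da₁ ∧ ⋯ ∧ da_d` with `aᵢ ∈ 𝒪ₓ`, and `D x` is the order of `ω` with respect to this lattice. (Meant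
for `X` smooth over `k` of dimension `d`.) -/
def IsCanonicalDivisor {k : Type u} [Field k] (s : X ⟶ Spec (.of k)) (d : ℕ) (D : X → ℤ) : Prop :=
  letI := functionFieldAlgebra s
  (∀ x, Order.coheight x ≠ 1 → D x = 0) ∧
  ∃ ω : ⋀[X.functionField]^d Ω[X.functionField⁄k], ω ≠ 0 ∧
    ∀ x, Order.coheight x = 1 → ∃ g : X.functionField, g ≠ 0 ∧ X.ord g x = D x ∧
      Submodule.span (localSubring x) {ω} =
        Submodule.span (localSubring x)
          {η | ∃ a : Fin d → X.functionField, (∀ i, a i ∈ localSubring x) ∧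
            η = g • exteriorPower.ιMulti X.functionField d
              fun i => KaehlerDifferential.D k X.functionField (a i)}

/-- `X` is a smooth Fano variety of dimension `d` over `k`: it is proper and smooth of relative
dimension `d`, and its anticanonical divisor is ample. -/
def IsSmoothFano {k : Type u} [Field k] (s : X ⟶ Spec (.of k)) (d : ℕ) : Prop :=
  IsProper s ∧ SmoothOfRelativeDimension d s ∧
    ∃ K : X → ℤ, IsCanonicalDivisor s d K ∧ IsCartier K ∧ IsAmple (-K)

/-- `m` is the index of `X`: the largest integer `m ≥ 1` such that `-K_X = mH` in the Picard group
for some Cartier divisor `H`. -/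
def IsIndex {k : Type u} [Field k] (s : X ⟶ Spec (.of k)) (d m : ℕ) : Prop :=
  IsGreatest {m : ℕ | 1 ≤ m ∧ ∃ K H : X → ℤ,
    IsCanonicalDivisor s d K ∧ IsCartier H ∧ LinEquiv (-K) (m • H)} m

/-- The prime ideal of `𝒪_{X,p}` that defines the closure of `η` near its point `p`. -/
noncomputable def idealAt {η p : X} (h : η ⤳ p) : Ideal (X.presheaf.stalk p) :=
  (IsLocalRing.maximalIdeal (X.presheaf.stalk η)).comap (X.presheaf.stalkSpecializes h).hom

/-- The order of vanishing at `p` of the restriction of `a ∈ 𝒪_{X,p}` to the curve `C` with generic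
point `η`, that is, the length of `𝒪_{C,p} / (a)`. -/
noncomputable def ordOnCurve {η p : X} (h : η ⤳ p) (a : X.presheaf.stalk p) : ℤ :=
  (Module.length (X.presheaf.stalk p)
    (X.presheaf.stalk p ⧸ (idealAt h ⊔ Ideal.span {a}))).toNat

/-- `n` is the intersection number `(D · C)` of the Cartier divisor `D` with the complete curve `C`
that has the generic point `η`, over an algebraically closed field: replace `D` by the linearly
equivalent divisor `D + div g`, chosen such that `C` is not contained in its support, restrict local
equations `a p / b p` of it to `C`, and add up their orders of vanishing at the closed points `p` of
`C`. -/
def IsIntersectionNumber (D : X → ℤ) (η : X) (n : ℤ) : Prop :=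
  ∃ (g : X.functionField) (a b : ∀ p : {p : X // η ⤳ p ∧ p ≠ η}, X.presheaf.stalk p.1),
    g ≠ 0 ∧
    (∀ p, a p ∉ idealAt p.2.1 ∧ b p ∉ idealAt p.2.1 ∧
      ∀ y, y ⤳ p.1 → D y + X.ord g y =
        X.ord (algebraMap _ X.functionField (a p)) y -
          X.ord (algebraMap _ X.functionField (b p)) y) ∧
    n = ∑ᶠ p, (ordOnCurve p.2.1 (a p) - ordOnCurve p.2.1 (b p))

end Divisor

/-- `r` spans an extremal ray of the convex cone `K`. -/
def SpansExtremalRay {V : Type*} [AddCommGroup V] [Module ℝ V] (K : PointedCone ℝ V) (r : V) :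
    Prop :=
  r ∈ K ∧ r ≠ 0 ∧ ∀ a ∈ K, ∀ b ∈ K, ∀ t : ℝ, 0 ≤ t → a + b = t • r →
    ∃ t' : ℝ, 0 ≤ t' ∧ a = t' • r

namespace SmoothCompleteFan

variable {d : ℕ} (F : SmoothCompleteFan d)

/-- The set `G(Σ)` of primitive generators of the one-dimensional cones. -/
def Gen : Set (Fin d → ℤ) := {v | {v} ∈ F.cones}

/-- A primitive collection: a subset of `G(Σ)` that does not generate a cone of the fan, while each
proper subset does. -/
def IsPrimitiveCollection (P : Finset (Fin d → ℤ)) : Prop :=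
  ↑P ⊆ F.Gen ∧ P ∉ F.cones ∧ ∀ Q ⊂ P, Q ∈ F.cones

/-- `∑_{x ∈ P} x = ∑_{y ∈ c} b(y) y` is the primitive relation of the primitive collection `P`: the
set `c` generates a cone of the fan and the coefficients `b(y)`, `y ∈ c`, are positive. -/
def IsPrimitiveRelation (P c : Finset (Fin d → ℤ)) (b : (Fin d → ℤ) → ℤ) : Prop :=
  F.IsPrimitiveCollection P ∧ c ∈ F.cones ∧ (∀ y ∈ c, 0 < b y) ∧ ∑ x ∈ P, x = ∑ y ∈ c, b y • y

open scoped Classical in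
/-- The class `r(P)` in `A₁(X) ⊗ ℝ ⊆ ℝ^{G(Σ)}` of the relation `∑_{x ∈ P} x = ∑_{y ∈ c} b(y) y`. -/
noncomputable def relationClass (P c : Finset (Fin d → ℤ)) (b : (Fin d → ℤ) → ℤ) : F.Gen → ℝ :=
  fun v => (if v.1 ∈ P then 1 else 0) - (if v.1 ∈ c then (b v.1 : ℝ) else 0)

variable (k : Type u) [Field k]

/-- `y` is the generic point of the torus-invariant prime divisor `D_v`, `v ∈ G(Σ)`: this divisor
meets the chart of the ray spanned by `v`, and its ideal in `k[σ^∨ ∩ M]` is generated there by the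
characters `χ^u` with `⟨u, v⟩ > 0`. -/
def IsGenericPointOfDivisor (v : F.Gen) (y : F.toricVariety k) : Prop :=
  ∃ z : Spec (.of (ChartRing k {v.1})), F.chartι k ⟨{v.1}, v.2⟩ z = y ∧
    z.asIdeal = Ideal.span
      ((fun u : dualMonoid {v.1} => AddMonoidAlgebra.single u (1 : k)) '' {u | 0 < u.1 v.1})

open scoped Classical in
/-- The torus-invariant prime divisor `D_v`. -/
noncomputable def toricDivisor (v : F.Gen) : F.toricVariety k → ℤ :=
  fun y => if F.IsGenericPointOfDivisor k v y then 1 else 0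

/-- The Mori cone `NE(X)`, spanned by the classes of the curves `C` in `X`. Under the identification
of `A₁(X)` with the group of relations among the elements of `G(Σ)`, the class of `C` is
`((D_v · C))_v`. -/
noncomputable def moriCone : PointedCone ℝ (F.Gen → ℝ) :=
  PointedCone.hull ℝ {z | ∃ η : F.toricVariety k, Order.height η = 1 ∧
    ∀ v : F.Gen, ∃ n : ℤ, IsIntersectionNumber (F.toricDivisor k v) η n ∧ z v = n}

/-- `P` is an extremal primitive collection: `r(P)` lies on an extremal ray of `NE(X)`. -/
def IsExtremal (P : Finset (Fin d → ℤ)) : Prop :=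
  ∃ c b, F.IsPrimitiveRelation P c b ∧ SpansExtremalRay (F.moriCone k) (F.relationClass P c b)

end SmoothCompleteFan

section ProjectiveSpace

variable (k : Type u) [Field k]

attribute [local instance] MvPolynomial.gradedAlgebra

/-- Projective space `ℙⁿ` over `k`. -/
noncomputable def ProjSpace (n : ℕ) : Scheme.{u} :=
  Proj (MvPolynomial.homogeneousSubmodule (Fin (n + 1)) k)

/-- The structure morphism `ℙⁿ → Spec k`. -/
noncomputable def projStr (n : ℕ) : ProjSpace k n ⟶ Spec (.of k) :=
  Proj.toSpecZero (MvPolynomial.homogeneousSubmodule (Fin (n + 1)) k) ≫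
    Spec.map (CommRingCat.ofHom
      (algebraMap k (MvPolynomial.homogeneousSubmodule (Fin (n + 1)) k 0)))

/-- The standard affine open subset `{x_i ≠ 0}` of `ℙⁿ`. -/
noncomputable def stdOpen (n : ℕ) (i : Fin (n + 1)) : (ProjSpace k n).Opens :=
  Proj.basicOpen (MvPolynomial.homogeneousSubmodule (Fin (n + 1)) k) (MvPolynomial.X i)

/-- The regular function `x_j / x_i` on `{x_i ≠ 0}`. -/
noncomputable def coordRatio (n : ℕ) (i j : Fin (n + 1)) : Γ(ProjSpace k n, stdOpen k n i) :=
  (Proj.awayToSection (MvPolynomial.homogeneousSubmodule (Fin (n + 1)) k)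
    (MvPolynomial.X i)).hom
    (HomogeneousLocalization.Away.mk (MvPolynomial.homogeneousSubmodule (Fin (n + 1)) k)
      (MvPolynomial.isHomogeneous_X k i) 1 (MvPolynomial.X j) (MvPolynomial.isHomogeneous_X k j))

/-- `π : X → ℙⁿ` is the projective bundle `ℙ(E) = Proj (Sym E)` of
`E = 𝒪(a₀) ⊕ ⋯ ⊕ 𝒪(a_r)` (so the points of `ℙ(E)` are the one-dimensional quotients of the fibres
of `E`). On `U_i = {x_i ≠ 0}` the summand `𝒪(a_l)` has the basis `x_i ^ a_l`; these bases identify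
`π⁻¹(U_i)` with `U_i × ℙʳ`, with second projection `φ i`, and over `U_i ∩ U_j` the homogeneous
coordinates `y_l` on `ℙʳ` for `j` and for `i` differ by the factor `(x_j / x_i) ^ a_l`. -/
def IsProjBundle {X : Scheme.{u}} {n r : ℕ} (a : Fin (r + 1) → ℕ) (π : X ⟶ ProjSpace k n) : Prop :=
  ∃ φ : ∀ i : Fin (n + 1), (π ⁻¹ᵁ stdOpen k n i).toScheme ⟶ ProjSpace k r,
    (∀ i, IsPullback (φ i) (π ∣_ stdOpen k n i) (projStr k r)
      ((stdOpen k n i).ι ≫ projStr k n)) ∧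
    ∀ i j : Fin (n + 1),
      let W : X.Opens := π ⁻¹ᵁ stdOpen k n i ⊓ π ⁻¹ᵁ stdOpen k n j
      let ρ : W.toScheme ⟶ ProjSpace k n := W.ι ≫ π
      let φi : W.toScheme ⟶ ProjSpace k r := X.homOfLE inf_le_left ≫ φ i
      let φj : W.toScheme ⟶ ProjSpace k r := X.homOfLE inf_le_right ≫ φ j
      ∀ l : Fin (r + 1), φi ⁻¹ᵁ stdOpen k r l = φj ⁻¹ᵁ stdOpen k r l ∧
        ∀ (V : W.toScheme.Opens) (h : V ≤ ρ ⁻¹ᵁ stdOpen k n i) (hi : V ≤ φi ⁻¹ᵁ stdOpen k r l)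
          (hj : V ≤ φj ⁻¹ᵁ stdOpen k r l) (m : Fin (r + 1)),
          (ρ.appLE _ V h).hom (coordRatio k n i j) ^ a l *
              (φj.appLE _ V hj).hom (coordRatio k r l m) =
            (ρ.appLE _ V h).hom (coordRatio k n i j) ^ a m *
              (φi.appLE _ V hi).hom (coordRatio k r l m)

end ProjectiveSpace

/-- Isomorphism of schemes over `S`. -/
def IsoOver {X Y S : Scheme.{u}} (f : X ⟶ S) (g : Y ⟶ S) : Prop :=
  ∃ e : X ≅ Y, e.hom ≫ g = f

/-- The fibre product of two schemes over `S`, with its structure morphism. -/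
noncomputable def prodStr {X Y S : Scheme.{u}} (f : X ⟶ S) (g : Y ⟶ S) : pullback f g ⟶ S :=
  pullback.fst f g ≫ f

end ToricFano

/-!
Let `F` be the fan. For a cone of full dimension, spanned by a lattice basis `b`, let `coordSum b` be
the functional that is `1` on `b`. The form `dlog χ₁ ∧ … ∧ dlog χ_d` shows that the anticanonical
divisor is linearly equivalent to the sum of the invariant prime divisors, so that its sections on
the chart of `b` are trivialized by the character `coordSum b` (`exists_canonical_function`). Two
consequences of the geometry of `F` translate the hypotheses into combinatorics:

* If `-K` is ample, then `coordSum b ≤ 1` on all generators of rays (`coordSum_le_one`), and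
  `coordSum b ≠ 1` at the generator across a wall, since otherwise `-K` would be trivial on the
  projective line attached to this wall (`coordSum_ne_one_of_wall`).
* If `-K` is linearly equivalent to `2H`, then `coordSum b` is odd on all generators
  (`odd_coordSum`).

Together they say that `coordSum b` is odd and at most `-1` on every generator outside the cone of
`b` (`IsFanoEven`, `isFanoEven`). This gap between `1` and `-1` is what makes the classification
short.

The primitive collection `x₀ + x₁ + x₂ + x₃ = 0` is completed to a basis `x₀, x₁, x₂, y, z` that
spans a cone (`exists_adapted`). Consider the generator on the other side of the wall opposite to
`x₀`. The inequalities leave, up to symmetry, the possibilities `x₃`, `-x₀ + y - z`, `-x₀ - x₁ + y`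
and `x₃ + y + z`. The last three are impossible: they bound the generators in the star of
`x₀, x₁, x₂`, which is a complete fan in the plane, so tightly that its cones overlap (`not_typeOne`,
`not_typeTwo`, `not_typeThree`). Hence every facet of the primitive collection is joined to `y, z`
(`exchange₀`), which means that the fan is a bundle of fans of `ℙ³` over the plane fan of that star.
The same inequalities show that this plane fan is the fan of `ℙ¹ × ℙ¹`, with the trivial bundle, or
the fan of `ℙ²` with `y + z + w = x₃` after renaming, where `w` is its third generator
(`Adapted.classification`).

It remains to identify the varieties. Characters are used as homogeneous coordinates of morphisms to
`ℙⁿ`, glued from the charts (`exists_isCharMap`). Each chart of full dimension is an affine space,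
with the characters dual to its generators as coordinates (`bijective_aeval_dual`), so that it is the
product of standard affine charts of the factors, respectively of the base and the fibre. This gives
an isomorphism with the product of projective spaces (`IsProductFan.isoOver`), and trivializations of
the bundle over the standard affine open subsets of the base whose transition functions are those of
the stated sum of line bundles (`IsBundleFan.exists_isProjBundle`).
-/

namespace ToricFano

/-! ### Functions on open affine pieces and their orders -/

section OpenImmersion

variable {X : Scheme.{u}} {R S : CommRingCat.{u}}

instance isPrime_asIdeal (z : Spec R) : z.asIdeal.IsPrime := z.2

/-- The functions on an open affine piece `Spec R` of `X`, as sections of the structure sheaf of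
`X`. -/
noncomputable def toSection (f : Spec R ⟶ X) [IsOpenImmersion f] : R ⟶ Γ(X, f ''ᵁ ⊤) :=
  (Scheme.ΓSpecIso R).inv ≫ (f.appIso ⊤).inv

lemma mem_image_top (f : Spec R ⟶ X) [IsOpenImmersion f] (z : Spec R) : f z ∈ f ''ᵁ ⊤ :=
  ⟨z, trivial, rfl⟩

lemma toSection_res (f : Spec R ⟶ X) [IsOpenImmersion f] (g : Spec S ⟶ X) [IsOpenImmersion g]
    (φ : R ⟶ S) (h : Spec.map φ ≫ f = g) (hle : g ''ᵁ ⊤ ≤ f ''ᵁ ⊤) :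
    φ ≫ toSection g = toSection f ≫ X.presheaf.map (homOfLE hle).op := by
  subst h
  rw [← cancel_mono ((Spec.map φ ≫ f).appIso ⊤).hom]
  simp only [toSection, Category.assoc, Iso.inv_hom_id, Category.comp_id]
  rw [Scheme.Hom.appIso_hom', Scheme.Hom.map_appLE, Scheme.ΓSpecIso_inv_naturality]
  congr 1
  rw [Iso.eq_inv_comp, Scheme.Hom.appIso_hom']
  simp only [Scheme.Hom.appTop, Scheme.Hom.app_eq_appLE]
  exact Scheme.Hom.appLE_comp_appLE _ _ _ _ _ _ _

lemma comp_toSection (f : Spec R ⟶ X) [IsOpenImmersion f] (s : X ⟶ Spec S) (φ : S ⟶ R)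
    (h : f ≫ s = Spec.map φ) :
    φ ≫ toSection f = (Scheme.ΓSpecIso S).inv ≫ s.appTop ≫
      X.presheaf.map (homOfLE (le_top : f ''ᵁ ⊤ ≤ ⊤)).op := by
  rw [← cancel_mono (f.appIso ⊤).hom]
  simp only [toSection, Category.assoc, Iso.inv_hom_id, Category.comp_id]
  rw [Scheme.Hom.appIso_hom', Scheme.Hom.map_appLE, Scheme.ΓSpecIso_inv_naturality, ← h]
  congr 1

/-- The functions on an open affine piece `Spec R` of `X`, as elements of the local ring of `X` at
one of its points. -/
noncomputable def toStalk (f : Spec R ⟶ X) [IsOpenImmersion f] (z : Spec R) :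
    R ⟶ X.presheaf.stalk (f z) :=
  toSection f ≫ X.presheaf.germ _ _ (mem_image_top f z)

lemma isLocalization_toStalk (f : Spec R ⟶ X) [IsOpenImmersion f] (z : Spec R) :
    letI := (toStalk f z).hom.toAlgebra
    IsLocalization.AtPrime (X.presheaf.stalk (f z)) z.asIdeal := by
  let := (toStalk f z).hom.toAlgebra
  let k : Algebra R ((Spec R).presheaf.stalk z) := StructureSheaf.stalkAlgebra R z
  have h1 : IsLocalization.AtPrime ((Spec R).presheaf.stalk z) z.asIdeal :=
    StructureSheaf.IsLocalization.to_stalk R z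
  have h2 : toStalk f z ≫ f.stalkMap z = CommRingCat.ofHom
      (algebraMap R ((Spec R).presheaf.stalk z)) := by
    simp only [toStalk, toSection, Category.assoc]
    rw [Scheme.Hom.germ_stalkMap]
    rw [Scheme.Hom.appIso_inv_app_assoc]
    congr 1
    exact TopCat.Presheaf.germ_res (Spec R).presheaf _ _ _
  let e : (X.presheaf.stalk (f z)) ≃+* ((Spec R).presheaf.stalk z) :=
    (asIso (f.stalkMap z)).commRingCatIsoToRingEquiv
  let e' : ((Spec R).presheaf.stalk z) ≃ₐ[R] (X.presheaf.stalk (f z)) :=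
    (AlgEquiv.ofRingEquiv (f := e) fun r => by
      exact congrArg (fun φ => φ.hom r) h2).symm
  exact IsLocalization.isLocalization_of_algEquiv _ e'

variable [AlgebraicGeometry.IsIntegral X]

instance (f : Spec R ⟶ X) [IsOpenImmersion f] [IsDomain R] : Nonempty (f ''ᵁ ⊤) :=
  ⟨⟨_, mem_image_top f (genericPoint _)⟩⟩

/-- The functions on a nonempty open affine piece `Spec R` of `X`, as rational functions on `X`. -/
noncomputable def toFunctionField (f : Spec R ⟶ X) [IsOpenImmersion f] [IsDomain R] :
    R →+* X.functionField :=
  (toSection f ≫ X.germToFunctionField _).hom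

variable [IsDomain R] [IsDomain S]

lemma algebraMap_toStalk (f : Spec R ⟶ X) [IsOpenImmersion f] (z : Spec R) (r : R) :
    algebraMap _ X.functionField ((toStalk f z).hom r) = toFunctionField f r :=
  Scheme.algebraMap_germ_eq_germToFunctionField (hx := mem_image_top f z)
    (f := (toSection f).hom r)

lemma toFunctionField_comp (f : Spec R ⟶ X) [IsOpenImmersion f] (g : Spec S ⟶ X)
    [IsOpenImmersion g] (φ : R ⟶ S) (h : Spec.map φ ≫ f = g) (r : R) :
    toFunctionField g (φ.hom r) = toFunctionField f r := by
  have hle : g ''ᵁ ⊤ ≤ f ''ᵁ ⊤ := by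
    rintro _ ⟨x, -, rfl⟩
    refine ⟨Spec.map φ x, trivial, ?_⟩
    rw [← h]; rfl
  have h1 := toSection_res f g φ h hle
  have : φ ≫ toSection g ≫ X.germToFunctionField _ = toSection f ≫ X.germToFunctionField _ := by
    rw [reassoc_of% h1, TopCat.Presheaf.germ_res]
  exact congrArg (fun ψ => ψ.hom r) this

omit [IsDomain S] in
lemma toFunctionField_structure (f : Spec R ⟶ X) [IsOpenImmersion f] (s : X ⟶ Spec S) (φ : S ⟶ R)
    (h : f ≫ s = Spec.map φ) (r : S) :
    toFunctionField f (φ.hom r) = ((Scheme.ΓSpecIso S).inv ≫ s.appTop ≫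
      X.presheaf.germ ⊤ (genericPoint X) trivial).hom r := by
  have : φ ≫ toSection f ≫ X.germToFunctionField _ = (Scheme.ΓSpecIso S).inv ≫ s.appTop ≫
      X.presheaf.germ ⊤ (genericPoint X) trivial := by
    rw [reassoc_of% (comp_toSection f s φ h), TopCat.Presheaf.germ_res]
  exact congrArg (fun ψ => ψ.hom r) this

lemma toFunctionField_injective (f : Spec R ⟶ X) [IsOpenImmersion f] :
    Function.Injective (toFunctionField f) := by
  have h : Function.Injective (toSection f).hom := (ConcreteCategory.bijective_of_isIso
    ((Scheme.ΓSpecIso R).inv ≫ (f.appIso ⊤).inv)).injective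
  intro a b hab
  exact h (X.germToFunctionField_injective _ hab)

/-- The local ring at a point `z` of an open piece `Spec R` consists of the fractions whose
denominators do not vanish at `z`. -/
lemma mem_localSubring_iff [IsLocallyNoetherian X] (f : Spec R ⟶ X) [IsOpenImmersion f]
    (z : Spec R) (a : X.functionField) :
    a ∈ localSubring (f z) ↔ ∃ p q : R, q ∉ z.asIdeal ∧
      a = toFunctionField f p / toFunctionField f q := by
  let := (toStalk f z).hom.toAlgebra
  have := isLocalization_toStalk f z
  have hne : ∀ q : R, q ∉ z.asIdeal → toFunctionField f q ≠ 0 := fun q hq h0 => hq <| by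
    rw [(map_eq_zero_iff _ (toFunctionField_injective f)).1 h0]
    exact zero_mem _
  constructor
  · rintro ⟨s, rfl⟩
    obtain ⟨p, q, rfl⟩ := IsLocalization.exists_mk'_eq z.asIdeal.primeCompl s
    refine ⟨p, q, q.2, ?_⟩
    rw [eq_div_iff (hne _ q.2), ← algebraMap_toStalk f z, ← algebraMap_toStalk f z, ← map_mul]
    congr 1
    exact IsLocalization.mk'_spec _ p q
  · rintro ⟨p, q, hq, rfl⟩
    refine ⟨IsLocalization.mk' _ p (⟨q, hq⟩ : z.asIdeal.primeCompl), ?_⟩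
    rw [eq_div_iff (hne _ hq), ← algebraMap_toStalk f z, ← algebraMap_toStalk f z, ← map_mul]
    congr 1
    exact IsLocalization.mk'_spec _ p (⟨q, hq⟩ : z.asIdeal.primeCompl)

lemma exists_eq_div (f : Spec R ⟶ X) [IsOpenImmersion f] (a : X.functionField) :
    ∃ p q : R, q ≠ 0 ∧ a = toFunctionField f p / toFunctionField f q := by
  let z : Spec R := genericPoint (Spec R)
  have hz : f z = genericPoint X := genericPoint_eq_of_isOpenImmersion f
  let := (toStalk f z).hom.toAlgebra
  have := isLocalization_toStalk f z
  have hfr : IsFractionRing (X.presheaf.stalk (f z)) X.functionField := inferInstance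
  have hzq : z.asIdeal = ⊥ := by
    change (genericPoint (Spec R)).asIdeal = ⊥
    rw [genericPoint_eq_bot_of_affine]; rfl
  obtain ⟨s, t, ht, rfl⟩ := IsFractionRing.div_surjective (A := X.presheaf.stalk (f z)) a
  obtain ⟨p, q, rfl⟩ := IsLocalization.exists_mk'_eq z.asIdeal.primeCompl s
  obtain ⟨p', q', rfl⟩ := IsLocalization.exists_mk'_eq z.asIdeal.primeCompl t
  have hinj := toFunctionField_injective f
  have hq : (q : R) ≠ 0 := fun h => q.2 (by rw [h]; exact zero_mem _)
  have hq' : (q' : R) ≠ 0 := fun h => q'.2 (by rw [h]; exact zero_mem _)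
  have key : ∀ (p : R) (q : z.asIdeal.primeCompl), algebraMap _ X.functionField
      (IsLocalization.mk' (X.presheaf.stalk (f z)) p q) =
      toFunctionField f p / toFunctionField f q := fun p q => by
    have hq : (q : R) ≠ 0 := fun h => q.2 (by rw [h]; exact zero_mem _)
    rw [eq_div_iff ((map_ne_zero_iff _ hinj).2 hq), ← algebraMap_toStalk f z,
      ← algebraMap_toStalk f z, ← map_mul]
    congr 1
    exact IsLocalization.mk'_spec _ p q
  have hp' : p' ≠ 0 := by
    rintro rfl
    rw [IsLocalization.mk'_zero] at ht
    exact zero_notMem_nonZeroDivisors ht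
  refine ⟨p * q', q * p', mul_ne_zero hq hp', ?_⟩
  rw [key, key, map_mul, map_mul, div_div_div_eq]

variable [IsLocallyNoetherian X]

lemma ord_eq_zero_of_notMem (f : Spec R ⟶ X) [IsOpenImmersion f] (z : Spec R) (q : R)
    (hq : q ∉ z.asIdeal) : X.ord (toFunctionField f q) (f z) = 0 := by
  by_cases h1 : Order.coheight (f z) = 1
  · let := (toStalk f z).hom.toAlgebra
    have := isLocalization_toStalk f z
    have hne : toFunctionField f q ≠ 0 := fun h0 => hq <| by
      rw [(map_eq_zero_iff _ (toFunctionField_injective f)).1 h0]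
      exact zero_mem _
    have hk : Ring.KrullDimLE 1 (X.presheaf.stalk (f z)) := krullDimLE_of_coheight_le h1.le
    rw [Scheme.ord_eq_iff h1 hne, Scheme.ordHom, ← algebraMap_toStalk f z,
      Ring.ordFrac_of_isUnit]
    · rfl
    · exact IsLocalization.map_units _ (⟨q, hq⟩ : z.asIdeal.primeCompl)
  · rw [Scheme.ord_eq_zero_of_coheight_neq_one h1]

lemma ord_nonneg (f : Spec R ⟶ X) [IsOpenImmersion f] (z : Spec R) (q : R) :
    0 ≤ X.ord (toFunctionField f q) (f z) := by
  by_cases h1 : Order.coheight (f z) = 1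
  · by_cases hq : q = 0
    · rw [hq, map_zero, Scheme.ord_zero]; rfl
    have hne : toFunctionField f q ≠ 0 := (map_ne_zero_iff _ (toFunctionField_injective f)).2 hq
    have hk : Ring.KrullDimLE 1 (X.presheaf.stalk (f z)) := krullDimLE_of_coheight_le h1.le
    rw [Scheme.le_ord_iff h1 hne, Scheme.ordHom, ← algebraMap_toStalk f z]
    refine Ring.ordFrac_ge_one_of_ne_zero fun h => hne ?_
    rw [← algebraMap_toStalk f z, h, map_zero]
  · rw [Scheme.ord_eq_zero_of_coheight_neq_one h1]

lemma ord_eq_one (f : Spec R ⟶ X) [IsOpenImmersion f] (z : Spec R) (q : R)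
    (h1 : Order.coheight (f z) = 1) (hq0 : q ≠ 0) (hq : z.asIdeal = Ideal.span {q}) :
    X.ord (toFunctionField f q) (f z) = 1 := by
  let := (toStalk f z).hom.toAlgebra
  have hloc := isLocalization_toStalk f z
  have hne : toFunctionField f q ≠ 0 := (map_ne_zero_iff _ (toFunctionField_injective f)).2 hq0
  have hk : Ring.KrullDimLE 1 (X.presheaf.stalk (f z)) := krullDimLE_of_coheight_le h1.le
  have hmax : IsLocalRing.maximalIdeal (X.presheaf.stalk (f z)) =
      Ideal.span {(toStalk f z).hom q} := by
    rw [← IsLocalization.AtPrime.map_eq_maximalIdeal z.asIdeal, hq, Ideal.map_span,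
      Set.image_singleton]
    rfl
  have hq0' : (toStalk f z).hom q ≠ 0 := fun h => hne <| by
    rw [← algebraMap_toStalk f z, h, map_zero]
  have hpr : Prime ((toStalk f z).hom q) := by
    rw [← Ideal.span_singleton_prime hq0', ← hmax]
    infer_instance
  have hf : ¬ IsField (X.presheaf.stalk (f z)) := by
    rw [IsLocalRing.isField_iff_maximalIdeal_eq, hmax, Ideal.span_singleton_eq_bot]
    exact hq0'
  have hdvr : IsDiscreteValuationRing (X.presheaf.stalk (f z)) :=
    ((IsDiscreteValuationRing.TFAE _ hf).out 0 4).2 (by rw [hmax]; exact ⟨⟨_, rfl⟩⟩)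
  have ho := Ring.ord_of_irreducible hpr.irreducible
  rw [Scheme.ord_eq_iff h1 hne, Scheme.ordHom, ← algebraMap_toStalk f z,
    Ring.ordFrac_eq_ord _ hq0', Ring.ordMonoidWithZeroHom_eq_coe _ (by simpa using hq0') (n := 1)]
  · rfl
  · simpa using ho

omit [AlgebraicGeometry.IsIntegral X] [IsLocallyNoetherian X] in
/-- A prime element of `R` defines a prime divisor of the open piece `Spec R`. -/
lemma exists_point_of_prime (f : Spec R ⟶ X) [IsOpenImmersion f] [IsNoetherianRing R] {q : R}
    (hq : Prime q) :
    ∃ z : Spec R, z.asIdeal = Ideal.span {q} ∧ Order.coheight (f z) = 1 := by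
  have hp : (Ideal.span {q}).IsPrime := (Ideal.span_singleton_prime hq.ne_zero).2 hq
  let z : Spec R := ⟨Ideal.span {q}, hp⟩
  refine ⟨z, rfl, ?_⟩
  refine (coheight_eq_of_isOpenImmersion f (x := z)).trans ?_
  rw [← idealHeight_eq_coheight]
  refine le_antisymm ?_ ?_
  · exact Ideal.height_le_one_of_isPrincipal_of_mem_minimalPrimes (Ideal.span {q}) _
      (by rw [Ideal.minimalPrimes_eq_subsingleton_self]; rfl)
  · rw [Order.one_le_iff_ne_zero, Ne, Ideal.height_eq_zero_iff_eq_bot]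
    simpa [z] using hq.ne_zero

end OpenImmersion

/-! ### Charts of toric varieties as affine spaces, and characters -/

/-- The set of the elements of a lattice basis: the generators of a cone of full dimension. -/
noncomputable def gens {d : ℕ} (b : Module.Basis (Fin d) ℤ (Fin d → ℤ)) : Finset (Fin d → ℤ) :=
  Finset.univ.image b

lemma mem_gens {d : ℕ} {b : Module.Basis (Fin d) ℤ (Fin d → ℤ)} {v : Fin d → ℤ} :
    v ∈ gens b ↔ ∃ i, b i = v := by simp [gens]

/-- The functional that takes the value `1` on the elements of the basis `b`. -/
noncomputable def coordSum {d : ℕ} (b : Module.Basis (Fin d) ℤ (Fin d → ℤ)) :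
    Module.Dual ℤ (Fin d → ℤ) := ∑ i, b.coord i

lemma coordSum_apply {d : ℕ} (b : Module.Basis (Fin d) ℤ (Fin d → ℤ)) (v : Fin d → ℤ) :
    coordSum b v = ∑ i, b.repr v i := by
  simp [coordSum]

lemma coordSum_basis {d : ℕ} (b : Module.Basis (Fin d) ℤ (Fin d → ℤ)) (i : Fin d) :
    coordSum b (b i) = 1 := by
  simp [coordSum_apply, Finsupp.single_apply]

section PolynomialChart

variable (k : Type u) [Field k] {d : ℕ} (b : Module.Basis (Fin d) ℤ (Fin d → ℤ))

lemma coord_mem_dualMonoid (i : Fin d) : b.coord i ∈ dualMonoid (gens b) := by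
  intro v hv
  obtain ⟨j, rfl⟩ := mem_gens.1 hv
  rw [Module.Basis.coord_apply, Module.Basis.repr_self, Finsupp.single_apply]
  split_ifs <;> simp

/-- The monoid `σ^∨ ∩ M` of a nonsingular cone of full dimension is free. -/
noncomputable def dualMonoidEquiv : (Fin d →₀ ℕ) ≃+ dualMonoid (gens b) where
  toFun n := ∑ i, n i • ⟨b.coord i, coord_mem_dualMonoid b i⟩
  invFun u := Finsupp.equivFunOnFinite.symm fun i => (u.1 (b i)).toNat
  left_inv n := by
    ext i
    simp [Finsupp.single_apply]
  right_inv u := by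
    refine Subtype.ext (b.ext fun j => ?_)
    have := u.2 (b j) (mem_gens.2 ⟨j, rfl⟩)
    simp [Finsupp.single_apply, this]
  map_add' n m := by
    rw [← Finset.sum_add_distrib]
    exact Finset.sum_congr rfl fun i _ => add_smul _ _ _

/-- The coordinate ring of the chart of a nonsingular cone of full dimension is a polynomial
ring. -/
noncomputable def polynomialEquiv : MvPolynomial (Fin d) k ≃ₐ[k] ChartRing k (gens b) :=
  AddMonoidAlgebra.domCongr k k (dualMonoidEquiv b)

/-- The coordinates on the chart of a nonsingular cone of full dimension. -/
noncomputable def coordVar (i : Fin d) : ChartRing k (gens b) :=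
  AddMonoidAlgebra.single ⟨b.coord i, coord_mem_dualMonoid b i⟩ 1

lemma polynomialEquiv_X (i : Fin d) : polynomialEquiv k b (MvPolynomial.X i) = coordVar k b i := by
  have : (dualMonoidEquiv b) (Finsupp.single i 1) = ⟨b.coord i, coord_mem_dualMonoid b i⟩ := by
    change ∑ j, Finsupp.single i 1 j • _ = _
    rw [Finset.sum_eq_single i (fun j _ hj => by rw [Finsupp.single_eq_of_ne hj, zero_smul])
      (by simp), Finsupp.single_eq_same, one_smul]
  rw [coordVar, ← this]
  exact AddMonoidAlgebra.domCongr_single _ _ _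

instance : UniqueFactorizationMonoid (ChartRing k (gens b)) :=
  (polynomialEquiv k b).toMulEquiv.uniqueFactorizationMonoid inferInstance

lemma isNoetherianRing_gens : IsNoetherianRing (ChartRing k (gens b)) :=
  isNoetherianRing_of_ringEquiv _ (polynomialEquiv k b).toRingEquiv

lemma prime_coordVar (i : Fin d) : Prime (coordVar k b i) := by
  rw [← polynomialEquiv_X]
  exact (MulEquiv.prime_iff (polynomialEquiv k b).toMulEquiv).2 MvPolynomial.X_prime

lemma not_coordVar_dvd {i j : Fin d} (h : i ≠ j) : ¬ coordVar k b i ∣ coordVar k b j := by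
  rw [← polynomialEquiv_X, ← polynomialEquiv_X, map_dvd_iff, MvPolynomial.X_dvd_X]
  simpa using h

lemma exists_algebraMap_of_isUnit {x : ChartRing k (gens b)} (hx : IsUnit x) :
    ∃ r : k, r ≠ 0 ∧ x = algebraMap k _ r := by
  have h := hx.map (polynomialEquiv k b).symm
  obtain ⟨r, hr, h⟩ := MvPolynomial.isUnit_iff_eq_C_of_isReduced.1 h
  refine ⟨r, hr.ne_zero, ?_⟩
  rw [← (polynomialEquiv k b).commutes, MvPolynomial.algebraMap_eq, ← h, AlgEquiv.apply_symm_apply]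

end PolynomialChart

/-- In a unique factorization domain, an element all of whose prime multiplicities are even is a
square up to a unit. -/
lemma exists_unit_mul_sq {R : Type*} [CommRing R] [IsDomain R] [UniqueFactorizationMonoid R]
    (val : R → R → ℤ) (hmul : ∀ p, Prime p → ∀ x y, x ≠ 0 → y ≠ 0 → val p (x * y) =
      val p x + val p y)
    (hone : ∀ p, Prime p → val p p = 1) (hzero : ∀ p, Prime p → ∀ x, ¬ p ∣ x → val p x = 0)
    (x : R) (hx : x ≠ 0) (heven : ∀ p, Prime p → Even (val p x)) :
    ∃ y w, IsUnit w ∧ x = w * y ^ 2 := by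
  induction x using (wellFounded_dvdNotUnit (α := R)).induction with
  | _ x ih =>
  by_cases hu : IsUnit x
  · exact ⟨1, x, hu, by simp⟩
  obtain ⟨p, hp, a, rfl⟩ := WfDvdMonoid.exists_irreducible_factor hu hx
  have hp := hp.prime
  have ha : a ≠ 0 := right_ne_zero_of_mul hx
  have hpa : p ∣ a := by
    by_contra h
    have h1 := heven p hp
    rw [hmul p hp _ _ hp.ne_zero ha, hone p hp, hzero p hp _ h] at h1
    exact absurd h1 (by decide)
  obtain ⟨a', rfl⟩ := hpa
  have ha' : a' ≠ 0 := right_ne_zero_of_mul ha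
  obtain ⟨y, w, hw, rfl⟩ := ih a' ⟨ha', p * p, fun h => hp.not_isUnit (isUnit_of_mul_isUnit_left h),
    by ring⟩ ha' fun q hq => by
      have h1 := heven q hq
      rw [hmul q hq _ _ hp.ne_zero ha, hmul q hq _ _ hp.ne_zero ha'] at h1
      rw [← add_assoc, ← two_mul] at h1
      exact (Int.even_add.1 h1).1 (even_two_mul _)
  exact ⟨p * y, w, hw, by ring⟩

section FactorialChart

variable {X : Scheme.{u}} [AlgebraicGeometry.IsIntegral X] [IsLocallyNoetherian X]
  {R : CommRingCat.{u}} [IsDomain R] [IsNoetherianRing R]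

lemma ord_one (x : X) : X.ord 1 x = 0 := by
  have := Scheme.ord_mul (x := x) (one_ne_zero (α := X.functionField)) one_ne_zero
  rw [mul_one] at this
  omega

lemma ord_inv {a : X.functionField} (ha : a ≠ 0) (x : X) : X.ord a⁻¹ x = - X.ord a x := by
  have := Scheme.ord_mul (x := x) ha (inv_ne_zero ha)
  rw [mul_inv_cancel₀ ha, ord_one] at this
  omega

lemma ord_pow {a : X.functionField} (ha : a ≠ 0) (n : ℕ) (x : X) :
    X.ord (a ^ n) x = n * X.ord a x := by
  induction n with
  | zero => simp [ord_one]
  | succ n ih =>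
    rw [pow_succ, Scheme.ord_mul (pow_ne_zero _ ha) ha, ih]
    push_cast
    ring

lemma exists_valuation (f : Spec R ⟶ X) [IsOpenImmersion f] :
    ∃ pt : R → Spec R, ∀ p, Prime p → Order.coheight (f (pt p)) = 1 ∧
      X.ord (toFunctionField f p) (f (pt p)) = 1 ∧
      ∀ q, ¬ p ∣ q → X.ord (toFunctionField f q) (f (pt p)) = 0 := by
  choose! pt h1 h2 using fun (q : R) (hq : Prime q) => exists_point_of_prime f hq
  refine ⟨pt, fun p hp => ⟨h2 p hp, ord_eq_one f _ p (h2 p hp) hp.ne_zero (h1 p hp),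
    fun q hq => ?_⟩⟩
  refine ord_eq_zero_of_notMem f _ q fun h => hq ?_
  rwa [h1 p hp, Ideal.mem_span_singleton] at h

variable [UniqueFactorizationMonoid R]

/-- On a factorial chart, a rational function without poles is regular. -/
lemma exists_regular (f : Spec R ⟶ X) [IsOpenImmersion f] (a : X.functionField)
    (ha : ∀ z, Order.coheight (f z) = 1 → 0 ≤ X.ord a (f z)) : ∃ p, a = toFunctionField f p := by
  obtain ⟨p, q, hq, rfl⟩ := exists_eq_div f a
  obtain ⟨p, q, c, hpq, hp', hq'⟩ := UniqueFactorizationMonoid.exists_reduced_factors' p q hq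
  have hinj := toFunctionField_injective f
  by_cases hp0 : p = 0
  · refine ⟨0, ?_⟩
    rw [← hp', hp0, mul_zero, map_zero, zero_div]
  have hc0 : c ≠ 0 := by rintro rfl; exact hq (by rw [← hq', zero_mul])
  have hq0 : q ≠ 0 := by rintro rfl; exact hq (by rw [← hq', mul_zero])
  have hne : ∀ {r : R}, r ≠ 0 → toFunctionField f r ≠ 0 := fun h => (map_ne_zero_iff _ hinj).2 h
  have heq : toFunctionField f p / toFunctionField f q =
      toFunctionField f (c * p) / toFunctionField f (c * q) := by
    rw [map_mul, map_mul, mul_div_mul_left _ _ (hne hc0)]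
  rw [← hp', ← hq', ← heq] at ha ⊢
  have hu : IsUnit q := by
    by_contra hu
    obtain ⟨r, hr, hrq⟩ := WfDvdMonoid.exists_irreducible_factor hu hq0
    have hr := hr.prime
    obtain ⟨q', rfl⟩ := hrq
    obtain ⟨pt, hpt⟩ := exists_valuation f
    obtain ⟨h1, h2, h3⟩ := hpt r hr
    have h4 := ha _ h1
    have h5 : ¬ r ∣ p := fun h => hr.not_isUnit (hpq h (dvd_mul_right _ _))
    have h6 := ord_nonneg f (pt r) q'
    rw [div_eq_mul_inv, Scheme.ord_mul (hne hp0) (inv_ne_zero (hne hq0)), h3 p h5,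
      ord_inv (hne hq0), map_mul, Scheme.ord_mul (hne hr.ne_zero) (hne (right_ne_zero_of_mul hq0)),
      h2] at h4
    omega
  obtain ⟨u, rfl⟩ := hu
  refine ⟨p * (u⁻¹ : Rˣ), ?_⟩
  rw [div_eq_iff (hne hq0), ← map_mul, mul_assoc, Units.inv_mul, mul_one]

/-- On a factorial chart, a rational function all of whose orders are even is a square up to a
unit. -/
lemma exists_unit_mul_sq_of_even (f : Spec R ⟶ X) [IsOpenImmersion f] (a : X.functionField)
    (ha0 : a ≠ 0) (ha : ∀ z, Order.coheight (f z) = 1 → Even (X.ord a (f z))) :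
    ∃ (w : R) (g : X.functionField), IsUnit w ∧ g ≠ 0 ∧ a = toFunctionField f w * g ^ 2 := by
  obtain ⟨p, q, hq, rfl⟩ := exists_eq_div f a
  have hinj := toFunctionField_injective f
  have hne : ∀ {r : R}, r ≠ 0 → toFunctionField f r ≠ 0 := fun h => (map_ne_zero_iff _ hinj).2 h
  have hp : p ≠ 0 := by rintro rfl; simp at ha0
  obtain ⟨pt, hpt⟩ := exists_valuation f
  obtain ⟨y, w, hw, hy⟩ := exists_unit_mul_sq (fun p x => X.ord (toFunctionField f x) (f (pt p)))
    (fun p hp x y hx hy => by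
      simp only [map_mul]
      rw [Scheme.ord_mul (hne hx) (hne hy)]) (fun p hp => (hpt p hp).2.1)
    (fun p hp => (hpt p hp).2.2) (p * q) (mul_ne_zero hp hq) (fun r hr => by
      have := ha _ (hpt r hr).1
      rw [div_eq_mul_inv, Scheme.ord_mul (hne hp) (inv_ne_zero (hne hq)), ord_inv (hne hq)] at this
      rw [map_mul, Scheme.ord_mul (hne hp) (hne hq)]
      rw [← sub_eq_add_neg, Int.even_sub] at this
      exact Int.even_add.2 this)
  have hy0 : y ≠ 0 := by
    rintro rfl
    exact mul_ne_zero hp hq (by rw [hy]; ring)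
  refine ⟨w, toFunctionField f y / toFunctionField f q, hw, div_ne_zero (hne hy0) (hne hq), ?_⟩
  rw [div_pow, ← mul_div_assoc, ← map_pow, ← map_mul, ← hy, map_mul, pow_two,
    mul_div_mul_right _ _ (hne hq)]

end FactorialChart

namespace SmoothCompleteFan

variable {d : ℕ} (F : SmoothCompleteFan d) (k : Type u) [Field k]

instance (c : F.cones) : IsOpenImmersion (F.chartι k c) :=
  inferInstanceAs (IsOpenImmersion (colimit.ι (F.chartFunctor k) c))

/-- The coordinate ring of a chart, inside the function field. -/
noncomputable def chartToField (c : F.cones) :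
    ChartRing k c.1 →+* (F.toricVariety k).functionField :=
  toFunctionField (R := .of (ChartRing k c.1)) (F.chartι k c)

lemma chartToField_injective (c : F.cones) : Function.Injective (F.chartToField k c) :=
  toFunctionField_injective (R := .of (ChartRing k c.1)) _

lemma map_chartι {a c : F.cones} (h : a ≤ c) :
    Spec.map (CommRingCat.ofHom (chartMap k h).toRingHom) ≫ F.chartι k c = F.chartι k a :=
  colimit.w (F.chartFunctor k) (homOfLE h)

lemma chartToField_chartMap {a c : F.cones} (h : a ≤ c) (x : ChartRing k c.1) :
    F.chartToField k a (chartMap k h x) = F.chartToField k c x :=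
  toFunctionField_comp (R := .of (ChartRing k c.1)) (S := .of (ChartRing k a.1)) _ _
    (CommRingCat.ofHom (chartMap k h).toRingHom) (F.map_chartι k h) x

lemma chartι_structureMap (c : F.cones) : F.chartι k c ≫ F.structureMap k =
    Spec.map (CommRingCat.ofHom (algebraMap k (ChartRing k c.1))) :=
  colimit.ι_desc _ _

lemma chartToField_algebraMap (c : F.cones) (r : k) :
    letI := functionFieldAlgebra (F.structureMap k)
    F.chartToField k c (algebraMap k _ r) = algebraMap k _ r := by
  exact toFunctionField_structure (R := .of (ChartRing k c.1)) (S := .of k) (F.chartι k c)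
    (F.structureMap k) (CommRingCat.ofHom (algebraMap k _)) (F.chartι_structureMap k c) r

lemma bot_le_cone (c : F.cones) : (⟨∅, F.empty_mem_cones⟩ : F.cones) ≤ c := Finset.empty_subset c.1

/-- The character `χ^m` of the torus, as a rational function. -/
noncomputable def chi (m : Module.Dual ℤ (Fin d → ℤ)) : (F.toricVariety k).functionField :=
  F.chartToField k ⟨∅, F.empty_mem_cones⟩ (AddMonoidAlgebra.single ⟨m, by simp [mem_dualMonoid]⟩ 1)

lemma chi_add (m n : Module.Dual ℤ (Fin d → ℤ)) : F.chi k (m + n) = F.chi k m * F.chi k n := by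
  rw [chi, chi, chi, ← map_mul, AddMonoidAlgebra.single_mul_single, one_mul]
  rfl

lemma chi_zero : F.chi k 0 = 1 := by
  rw [chi, ← map_one (F.chartToField k ⟨∅, F.empty_mem_cones⟩)]
  rfl

lemma chi_ne_zero (m : Module.Dual ℤ (Fin d → ℤ)) : F.chi k m ≠ 0 := fun h => by
  have := F.chi_add k m (-m)
  rw [h, zero_mul, add_neg_cancel, chi_zero] at this
  exact one_ne_zero this

lemma chi_zsmul (n : ℤ) (m : Module.Dual ℤ (Fin d → ℤ)) : F.chi k (n • m) = F.chi k m ^ n := by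
  let φ : Multiplicative (Module.Dual ℤ (Fin d → ℤ)) →* (F.toricVariety k).functionFieldˣ :=
    { toFun := fun m => Units.mk0 _ (F.chi_ne_zero k m.toAdd)
      map_one' := Units.ext (F.chi_zero k)
      map_mul' := fun a b => Units.ext (F.chi_add k _ _) }
  have := congrArg Units.val (map_zpow φ (Multiplicative.ofAdd m) n)
  simpa [φ] using this

lemma chartToField_single (c : F.cones) (m : dualMonoid c.1) :
    F.chartToField k c (AddMonoidAlgebra.single m 1) = F.chi k m.1 := by
  rw [← F.chartToField_chartMap k (F.bot_le_cone c), chartMap_single]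
  rfl

end SmoothCompleteFan

/-! ### The canonical divisor of a toric variety -/

/-- The values of an alternating map of top degree are determined by its value on a basis. -/
lemma alternatingMap_eq_det_smul {R M N ι : Type*} [CommRing R] [AddCommGroup M] [Module R M]
    [AddCommGroup N] [Module R N] [Fintype ι] [DecidableEq ι] (e : Module.Basis ι R M)
    (A : M [⋀^ι]→ₗ[R] N) (v : ι → M) : A v = e.det v • A e := by
  have : A = (LinearMap.toSpanSingleton R N (A e)).compAlternatingMap e.det := by
    refine Module.Basis.ext_alternating e fun w hw => ?_
    obtain ⟨σ, rfl⟩ : ∃ σ : Equiv.Perm ι, w = σ :=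
      ⟨Equiv.ofBijective w (Finite.injective_iff_bijective.1 hw), rfl⟩
    have h1 := A.map_perm (fun i => e i) σ
    have h2 := e.det.map_perm (fun i => e i) σ
    change A (fun i => e (σ i)) = _ at h1
    change e.det (fun i => e (σ i)) = _ at h2
    rw [h1]
    change _ = e.det (fun i => e (σ i)) • A e
    rw [h2, e.det_self]
    rcases Int.units_eq_one_or (Equiv.Perm.sign σ) with h | h <;> simp [h]
  conv_lhs => rw [this]
  rfl

namespace SmoothCompleteFan

variable {d : ℕ} (F : SmoothCompleteFan d) (k : Type u) [Field k]

lemma chartToField_coordVar (b : Module.Basis (Fin d) ℤ (Fin d → ℤ)) (hb : gens b ∈ F.cones)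
    (i : Fin d) : F.chartToField k ⟨gens b, hb⟩ (coordVar k b i) = F.chi k (b.coord i) :=
  F.chartToField_single k ⟨gens b, hb⟩ _

lemma chi_sum {ι : Type*} (s : Finset ι) (m : ι → Module.Dual ℤ (Fin d → ℤ)) :
    F.chi k (∑ i ∈ s, m i) = ∏ i ∈ s, F.chi k (m i) := by
  classical
  induction s using Finset.induction_on with
  | empty => simp [chi_zero]
  | insert a s ha ih => rw [Finset.sum_insert ha, Finset.prod_insert ha, chi_add, ih]

/-- The function field of the toric variety. -/
abbrev FF : Type u := (F.toricVariety k).functionField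

section Differentials

open scoped KaehlerDifferential

variable [Algebra k (F.FF k)]

/-- The logarithmic differential `dχ^m / χ^m` of a character. -/
noncomputable def dlog : Module.Dual ℤ (Fin d → ℤ) →ₗ[ℤ] Ω[F.FF k⁄k] :=
  AddMonoidHom.toIntLinearMap
    { toFun := fun m => (F.chi k m)⁻¹ • KaehlerDifferential.D k (F.FF k) (F.chi k m)
      map_zero' := by simp [chi_zero]
      map_add' := fun m n => by
        rw [chi_add, Derivation.leibniz, smul_add, smul_smul, smul_smul, add_comm]
        have hm := F.chi_ne_zero k m
        have hn := F.chi_ne_zero k n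
        congr 2 <;> field_simp }

lemma D_chi (m : Module.Dual ℤ (Fin d → ℤ)) :
    KaehlerDifferential.D k (F.FF k) (F.chi k m) = F.chi k m • F.dlog k m := by
  change _ = F.chi k m • (F.chi k m)⁻¹ • KaehlerDifferential.D k (F.FF k) (F.chi k m)
  rw [smul_smul, mul_inv_cancel₀ (F.chi_ne_zero k m), one_smul]

/-- The logarithmic volume form attached to a lattice basis. -/
noncomputable def logForm (b : Module.Basis (Fin d) ℤ (Fin d → ℤ)) : ⋀[F.FF k]^d Ω[F.FF k⁄k] :=
  exteriorPower.ιMulti (F.FF k) d fun i => F.dlog k (b.coord i)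

lemma logForm_eq_or_neg (b b' : Module.Basis (Fin d) ℤ (Fin d → ℤ)) :
    F.logForm k b' = F.logForm k b ∨ F.logForm k b' = - F.logForm k b := by
  let A : (Module.Dual ℤ (Fin d → ℤ)) [⋀^Fin d]→ₗ[ℤ] ⋀[F.FF k]^d Ω[F.FF k⁄k] :=
    { ((exteriorPower.ιMulti (F.FF k) d (M := Ω[F.FF k⁄k])).toMultilinearMap.restrictScalars
        ℤ).compLinearMap (fun _ => F.dlog k) with
      map_eq_zero_of_eq' := fun v i j hv hij =>
        (exteriorPower.ιMulti (F.FF k) d (M := Ω[F.FF k⁄k])).map_eq_zero_of_eq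
          (fun i => F.dlog k (v i)) (congrArg (F.dlog k) hv) hij }
  have h := alternatingMap_eq_det_smul b.dualBasis A b'.dualBasis
  have h1 : ∀ b : Module.Basis (Fin d) ℤ (Fin d → ℤ), A b.dualBasis = F.logForm k b := fun b => by
    rw [Module.Basis.coe_dualBasis]; rfl
  rw [h1, h1] at h
  rcases Int.isUnit_iff.1 (b.dualBasis.isUnit_det b'.dualBasis) with hu | hu
  · left; rw [h, hu, one_smul]
  · right; rw [h, hu, neg_smul, one_smul]

lemma ιMulti_D_coord (b : Module.Basis (Fin d) ℤ (Fin d → ℤ)) :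
    exteriorPower.ιMulti (F.FF k) d
        (fun i => KaehlerDifferential.D k (F.FF k) (F.chi k (b.coord i))) =
      F.chi k (coordSum b) • F.logForm k b := by
  simp_rw [D_chi]
  rw [AlternatingMap.map_smul_univ, coordSum, chi_sum]
  rfl

end Differentials

lemma chartToField_mem_localSubring (c : F.cones) (z : Spec (.of (ChartRing k c.1)))
    (p : ChartRing k c.1) : F.chartToField k c p ∈ localSubring (F.chartι k c z) := by
  refine (mem_localSubring_iff (R := .of (ChartRing k c.1)) (F.chartι k c) z _).2
    ⟨p, 1, fun h => ?_, ?_⟩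
  · exact (isPrime_asIdeal z).ne_top ((Ideal.eq_top_iff_one _).2 h)
  · rw [map_one, div_one]; rfl

open scoped KaehlerDifferential in
/-- The differentials of the local ring are spanned by those of the coordinates. -/
lemma D_mem_span (b : Module.Basis (Fin d) ℤ (Fin d → ℤ)) (hb : gens b ∈ F.cones)
    (z : Spec (.of (ChartRing k (gens b))))
    (a : (F.toricVariety k).functionField)
    (ha : a ∈ localSubring (F.chartι k ⟨gens b, hb⟩ z)) :
    letI := functionFieldAlgebra (F.structureMap k)
    KaehlerDifferential.D k (F.toricVariety k).functionField a ∈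
      Submodule.span (localSubring (F.chartι k ⟨gens b, hb⟩ z))
        (Set.range fun i => KaehlerDifferential.D k (F.toricVariety k).functionField
          (F.chi k (b.coord i))) := by
  let := functionFieldAlgebra (F.structureMap k)
  set O := localSubring (F.chartι k ⟨gens b, hb⟩ z) with hO
  set Λ := Submodule.span O (Set.range fun i =>
    KaehlerDifferential.D k (F.toricVariety k).functionField (F.chi k (b.coord i)))
  have hmem : ∀ p, F.chartToField k ⟨gens b, hb⟩ p ∈ O :=
    fun p => F.chartToField_mem_localSubring k ⟨gens b, hb⟩ z p
  have hsmul : ∀ a ∈ O, ∀ η ∈ Λ, a • η ∈ Λ := fun a ha η hη => Λ.smul_mem ⟨a, ha⟩ hη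
  have hpol : ∀ p, KaehlerDifferential.D k (F.toricVariety k).functionField
      (F.chartToField k ⟨gens b, hb⟩ p) ∈ Λ := fun p => by
    obtain ⟨q, rfl⟩ := (polynomialEquiv k b).surjective p
    induction q using MvPolynomial.induction_on with
    | C r =>
      rw [← MvPolynomial.algebraMap_eq, AlgEquiv.commutes]
      have := F.chartToField_algebraMap k ⟨gens b, hb⟩ r
      erw [this, Derivation.map_algebraMap]
      exact zero_mem _
    | add p q hp hq =>
      rw [map_add, map_add, map_add]
      exact add_mem hp hq
    | mul_X p i hp =>
      rw [map_mul, map_mul, Derivation.leibniz, polynomialEquiv_X]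
      refine add_mem (hsmul _ (hmem _) _ ?_) (hsmul _ (hmem _) _ hp)
      rw [F.chartToField_coordVar k b hb]
      exact Submodule.subset_span ⟨i, rfl⟩
  obtain ⟨p, q, hq, rfl⟩ := (mem_localSubring_iff (R := .of (ChartRing k (gens b)))
    (F.chartι k ⟨gens b, hb⟩) z _).1 ha
  have hq' : (F.chartToField k ⟨gens b, hb⟩ q)⁻¹ ∈ O := by
    refine (mem_localSubring_iff (R := .of (ChartRing k (gens b)))
      (F.chartι k ⟨gens b, hb⟩) z _).2 ⟨1, q, hq, ?_⟩
    rw [map_one, one_div]; rfl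
  rw [Derivation.leibniz_div]
  exact hsmul _ (pow_mem hq' 2) _ (sub_mem (hsmul _ (hmem _) _ (hpol _))
    (hsmul _ (hmem _) _ (hpol _)))

open scoped KaehlerDifferential in
/-- The top forms of the local ring are spanned by the volume form of the coordinates. -/
lemma ιMulti_D_mem_span (b : Module.Basis (Fin d) ℤ (Fin d → ℤ)) (hb : gens b ∈ F.cones)
    (z : Spec (.of (ChartRing k (gens b)))) (a : Fin d → F.FF k)
    (ha : ∀ i, a i ∈ localSubring (F.chartι k ⟨gens b, hb⟩ z)) :
    letI := functionFieldAlgebra (F.structureMap k)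
    ∃ r ∈ localSubring (F.chartι k ⟨gens b, hb⟩ z),
      exteriorPower.ιMulti (F.FF k) d (fun i => KaehlerDifferential.D k (F.FF k) (a i)) =
        r • exteriorPower.ιMulti (F.FF k) d
          (fun i => KaehlerDifferential.D k (F.FF k) (F.chi k (b.coord i))) := by
  let := functionFieldAlgebra (F.structureMap k)
  set O := localSubring (F.chartι k ⟨gens b, hb⟩ z) with hO
  have h1 : ∀ i, ∃ c : Fin d → O, ∑ j, c j • KaehlerDifferential.D k (F.FF k)
      (F.chi k (b.coord j)) = KaehlerDifferential.D k (F.FF k) (a i) := fun i =>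
    (Submodule.mem_span_range_iff_exists_fun O).1 (F.D_mem_span k b hb z (a i) (ha i))
  choose c hc using h1
  let T : (Fin d → F.FF k) →ₗ[F.FF k] Ω[F.FF k⁄k] :=
    Fintype.linearCombination (F.FF k) fun j => KaehlerDifferential.D k (F.FF k)
      (F.chi k (b.coord j))
  let A := (exteriorPower.ιMulti (F.FF k) d (M := Ω[F.FF k⁄k])).compLinearMap T
  have h2 := alternatingMap_eq_det_smul (Pi.basisFun (F.FF k) (Fin d)) A
    (fun i j => (c i j : F.FF k))
  have h3 : A (fun i j => (c i j : F.FF k)) =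
      exteriorPower.ιMulti (F.FF k) d (fun i => KaehlerDifferential.D k (F.FF k) (a i)) := by
    change exteriorPower.ιMulti (F.FF k) d (fun i => T _) = _
    congr 1
    funext i
    rw [← hc i]
    simp [T, Fintype.linearCombination_apply]
    rfl
  have h4 : A (Pi.basisFun (F.FF k) (Fin d)) = exteriorPower.ιMulti (F.FF k) d
      (fun i => KaehlerDifferential.D k (F.FF k) (F.chi k (b.coord i))) := by
    change exteriorPower.ιMulti (F.FF k) d (fun i => T _) = _
    congr 1
    funext i
    simp [T, Fintype.linearCombination_apply_single]
  rw [h3, h4] at h2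
  refine ⟨_, ?_, h2⟩
  have h5 : (Pi.basisFun (F.FF k) (Fin d)).det (fun i j => (c i j : F.FF k)) =
      O.subtype (Matrix.det (Matrix.of c)) :=
    (congrArg (fun φ : (Fin d → F.FF k) [⋀^Fin d]→ₗ[F.FF k] F.FF k => φ _)
      (Pi.basisFun_det (R := F.FF k) (ι := Fin d))).trans
      (RingHom.map_det O.subtype (Matrix.of c)).symm
  rw [h5]
  exact (Matrix.det (Matrix.of c)).2

/-- In terms of the rational function `f` with `ω = f • dlog χ₁ ∧ ⋯ ∧ dlog χ_d`, the canonical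
divisor of `ω` is `div f - ∑ D_v`. -/
lemma exists_canonical_function (D : F.toricVariety k → ℤ)
    (hD : IsCanonicalDivisor (F.structureMap k) d D) :
    ∃ f : F.FF k, f ≠ 0 ∧ ∀ (b : Module.Basis (Fin d) ℤ (Fin d → ℤ)) (hb : gens b ∈ F.cones)
      (z : Spec (.of (ChartRing k (gens b)))), Order.coheight (F.chartι k ⟨gens b, hb⟩ z) = 1 →
      (F.toricVariety k).ord f (F.chartι k ⟨gens b, hb⟩ z) = D (F.chartι k ⟨gens b, hb⟩ z) +
        (F.toricVariety k).ord (F.chi k (coordSum b)) (F.chartι k ⟨gens b, hb⟩ z) := by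
  let := functionFieldAlgebra (F.structureMap k)
  obtain ⟨-, ω, hω, hD⟩ := hD
  have key : ∀ (b : Module.Basis (Fin d) ℤ (Fin d → ℤ)) (hb : gens b ∈ F.cones)
      (z : Spec (.of (ChartRing k (gens b)))), Order.coheight (F.chartι k ⟨gens b, hb⟩ z) = 1 →
      ∃ f : F.FF k, f ≠ 0 ∧ ω = f • F.logForm k b ∧
        (F.toricVariety k).ord f (F.chartι k ⟨gens b, hb⟩ z) = D (F.chartι k ⟨gens b, hb⟩ z) +
        (F.toricVariety k).ord (F.chi k (coordSum b)) (F.chartι k ⟨gens b, hb⟩ z) := by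
    intro b hb z hz
    obtain ⟨g, hg, hgD, hspan⟩ := hD _ hz
    set y := F.chartι k ⟨gens b, hb⟩ z with hy
    set η := exteriorPower.ιMulti (F.FF k) d
          (fun i => KaehlerDifferential.D k (F.FF k) (F.chi k (b.coord i))) with hη
    have hs : Submodule.span (localSubring y) {ω} = Submodule.span (localSubring y) {g • η} := by
      rw [hspan]
      refine le_antisymm (Submodule.span_le.2 ?_) (Submodule.span_mono ?_)
      · rintro _ ⟨a, ha, rfl⟩
        obtain ⟨r, hr, h⟩ := F.ιMulti_D_mem_span k b hb z a ha
        rw [h, smul_comm]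
        exact Submodule.smul_mem _ (⟨r, hr⟩ : localSubring y) (Submodule.subset_span rfl)
      · rintro _ rfl
        refine ⟨fun i => F.chi k (b.coord i), fun i => ?_, rfl⟩
        change F.chi k (b.coord i) ∈ _
        rw [← F.chartToField_coordVar k b hb]
        exact F.chartToField_mem_localSubring k ⟨gens b, hb⟩ z _
    obtain ⟨u, hu⟩ := Submodule.mem_span_singleton.1
      (hs ▸ Submodule.mem_span_singleton_self ω : ω ∈ _)
    obtain ⟨w, hw⟩ := Submodule.mem_span_singleton.1
      (hs ▸ Submodule.mem_span_singleton_self (g • η) : g • η ∈ _)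
    have hwu : (w : F.FF k) * u = 1 := by
      have h1 : ((w : F.FF k) * (u : F.FF k)) • (g • η) = (1 : F.FF k) • (g • η) := by
        rw [one_smul, mul_smul]
        exact (congrArg (fun x => w • x) hu).trans hw
      have hne : g • η ≠ 0 := fun h0 => hω (by rw [← hu, h0, smul_zero])
      exact smul_left_injective (F.FF k) hne h1
    have hu0 : (u : F.FF k) ≠ 0 := right_ne_zero_of_mul (hwu ▸ one_ne_zero)
    have hw0 : (w : F.FF k) ≠ 0 := left_ne_zero_of_mul (hwu ▸ one_ne_zero)
    have hnn : ∀ r : localSubring y, (r : F.FF k) ≠ 0 → 0 ≤ (F.toricVariety k).ord (r : F.FF k) y :=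
      fun r hr => by
      obtain ⟨p, q, hq, h⟩ := (mem_localSubring_iff (R := .of (ChartRing k (gens b)))
        (F.chartι k ⟨gens b, hb⟩) z _).1 r.2
      rw [h] at hr ⊢
      have hq0 :
          toFunctionField (R := .of (ChartRing k (gens b))) (F.chartι k ⟨gens b, hb⟩) q ≠ 0 :=
        fun h0 => hr (by rw [h0, div_zero])
      rw [div_eq_mul_inv, Scheme.ord_mul (left_ne_zero_of_mul (div_eq_mul_inv (_ : F.FF k) _ ▸ hr))
        (inv_ne_zero hq0), ord_inv hq0, hy, ord_eq_zero_of_notMem _ _ _ hq, neg_zero, add_zero]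
      exact ord_nonneg _ _ _
    have hu1 : (F.toricVariety k).ord (u : F.FF k) y = 0 := by
      have h1 := Scheme.ord_mul (x := y) hw0 hu0
      rw [hwu, ord_one] at h1
      have h2 := hnn u hu0
      have h3 := hnn w hw0
      omega
    have hchi := F.chi_ne_zero k (coordSum b)
    refine ⟨u * g * F.chi k (coordSum b), mul_ne_zero (mul_ne_zero hu0 hg) hchi, ?_, ?_⟩
    · rw [mul_smul, mul_smul, ← F.ιMulti_D_coord k b]
      exact hu.symm
    · rw [Scheme.ord_mul (mul_ne_zero hu0 hg) hchi, Scheme.ord_mul hu0 hg, hu1, hgD, zero_add]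
  by_cases hex : ∃ (b : Module.Basis (Fin d) ℤ (Fin d → ℤ)) (hb : gens b ∈ F.cones)
      (z : Spec (.of (ChartRing k (gens b)))), Order.coheight (F.chartι k ⟨gens b, hb⟩ z) = 1
  · obtain ⟨b, hb, z, hz⟩ := hex
    obtain ⟨f, hf, hωf, -⟩ := key b hb z hz
    refine ⟨f, hf, fun b' hb' z' hz' => ?_⟩
    obtain ⟨f', hf', hωf', h⟩ := key b' hb' z' hz'
    have h0 : F.logForm k b ≠ 0 := fun h0 => hω (by rw [hωf, h0, smul_zero])
    rcases F.logForm_eq_or_neg k b b' with hl | hl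
    · have : f' = f := smul_left_injective _ h0 (by
        change f' • F.logForm k b = f • F.logForm k b
        rw [← hωf, hωf', hl])
      rw [← this, h]
    · have : -f' = f := smul_left_injective _ h0 (by
        change (-f') • F.logForm k b = f • F.logForm k b
        rw [← hωf, hωf', hl]
        exact (neg_smul f' (F.logForm k b)).trans (smul_neg f' (F.logForm k b)).symm)
      rw [← this, ← h]
      have h2 : ∀ y, 2 * (F.toricVariety k).ord (-f') y = 2 * (F.toricVariety k).ord f' y :=
          fun y => by
        have h1 := ord_pow (neg_ne_zero.2 hf') 2 y
        rw [neg_sq, ord_pow hf'] at h1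
        exact_mod_cast h1.symm
      have := h2 (F.chartι k ⟨gens b', hb'⟩ z')
      omega
  · push Not at hex
    exact ⟨1, one_ne_zero, fun b hb z hz => absurd hz (hex b hb z)⟩

end SmoothCompleteFan

/-! ### Sections of the anticanonical bundle and invariant curves -/

namespace SmoothCompleteFan

variable {d : ℕ} (F : SmoothCompleteFan d) (k : Type u) [Field k]

/-- For an ample anticanonical divisor and a point `x` of a toric variety, there is a section `h` of
a multiple `n` of the divisor `∑ D_v` which does not vanish at `x` and whose nonvanishing locus `U`
is affine. On the chart of a cone `σ` of full dimension, this section is given by the regular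
function `h χ^(n u)`, where `u` takes the value `1` on the generators of `σ`. -/
lemma exists_section (D : F.toricVariety k → ℤ)
    (hD : IsCanonicalDivisor (F.structureMap k) d D) (hA : IsAmple (-D)) (x : F.toricVariety k) :
    ∃ (n : ℕ) (h : F.FF k) (U : (F.toricVariety k).Opens)
      (p : ∀ b : Module.Basis (Fin d) ℤ (Fin d → ℤ), ChartRing k (gens b)), 1 ≤ n ∧ h ≠ 0 ∧
      IsAffineOpen U ∧ x ∈ U ∧ ∀ (b : Module.Basis (Fin d) ℤ (Fin d → ℤ)) (hb : gens b ∈ F.cones),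
        F.chartToField k ⟨gens b, hb⟩ (p b) = h * F.chi k (n • coordSum b) ∧
        ∀ z, F.chartι k ⟨gens b, hb⟩ z ∈ U ↔ p b ∉ z.asIdeal := by
  obtain ⟨f₀, hf₀, hf⟩ := F.exists_canonical_function k D hD
  obtain ⟨-, hA⟩ := hA
  obtain ⟨n, hn, f, hf0, hnn, U, hU, hxU, hUz⟩ := hA x
  have hpow := pow_ne_zero n hf₀
  have hh : f / f₀ ^ n ≠ 0 := div_ne_zero hf0 hpow
  -- the order of the section, computed on the chart of `b`
  have hord : ∀ (b : Module.Basis (Fin d) ℤ (Fin d → ℤ)) (hb : gens b ∈ F.cones)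
      (z : Spec (.of (ChartRing k (gens b)))), Order.coheight (F.chartι k ⟨gens b, hb⟩ z) = 1 →
      (F.toricVariety k).ord (f / f₀ ^ n * F.chi k (n • coordSum b)) (F.chartι k ⟨gens b, hb⟩ z) =
        n * (-D) (F.chartι k ⟨gens b, hb⟩ z) +
          (F.toricVariety k).ord f (F.chartι k ⟨gens b, hb⟩ z) := by
    intro b hb z hz
    have h1 := hf b hb z hz
    have h2 := F.chi_zsmul k n (coordSum b)
    rw [natCast_zsmul, zpow_natCast] at h2
    rw [Scheme.ord_mul hh (F.chi_ne_zero k _), h2, ord_pow (F.chi_ne_zero k _), div_eq_mul_inv,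
      Scheme.ord_mul hf0 (inv_ne_zero hpow), ord_inv hpow, ord_pow hf₀, h1]
    simp only [Pi.neg_apply]
    ring
  have hp : ∀ (b : Module.Basis (Fin d) ℤ (Fin d → ℤ)), ∃ p : ChartRing k (gens b),
      ∀ (hb : gens b ∈ F.cones), F.chartToField k ⟨gens b, hb⟩ p =
        f / f₀ ^ n * F.chi k (n • coordSum b) := by
    intro b
    by_cases hb : gens b ∈ F.cones
    · have : IsNoetherianRing (CommRingCat.of (ChartRing k (gens b))) := isNoetherianRing_gens k b
      have : UniqueFactorizationMonoid (CommRingCat.of (ChartRing k (gens b))) :=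
        inferInstanceAs (UniqueFactorizationMonoid (ChartRing k (gens b)))
      obtain ⟨p, hp⟩ := exists_regular (R := .of (ChartRing k (gens b)))
        (F.chartι k ⟨gens b, hb⟩) (f / f₀ ^ n * F.chi k (n • coordSum b)) fun z hz => by
          rw [hord b hb z hz]
          exact hnn _
      exact ⟨p, fun _ => hp.symm⟩
    · exact ⟨0, fun h => absurd h hb⟩
  choose p hp using hp
  refine ⟨n, f / f₀ ^ n, U, p, hn, hh, hU, hxU, fun b hb => ⟨hp b hb, fun z => ?_⟩⟩
  have : IsNoetherianRing (CommRingCat.of (ChartRing k (gens b))) := isNoetherianRing_gens k b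
  have : UniqueFactorizationMonoid (CommRingCat.of (ChartRing k (gens b))) :=
    inferInstanceAs (UniqueFactorizationMonoid (ChartRing k (gens b)))
  have hinj := F.chartToField_injective k ⟨gens b, hb⟩
  have hpb0 : p b ≠ 0 := fun h0 => by
    have := hp b hb
    rw [h0, map_zero] at this
    exact mul_ne_zero hh (F.chi_ne_zero k _) this.symm
  rw [hUz]
  constructor
  · -- a prime factor of `p b` that vanishes at `z` defines a prime divisor through `z`
    intro hz hpz
    obtain ⟨q, hq, hqz, hqp⟩ : ∃ q, Prime q ∧ q ∈ z.asIdeal ∧ q ∣ p b := by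
      have h1 := UniqueFactorizationMonoid.factors_prod hpb0
      have h2 : (UniqueFactorizationMonoid.factors (p b)).prod ∈ z.asIdeal := by
        obtain ⟨w, hw⟩ := h1.symm
        rw [← hw]
        exact Ideal.mul_mem_right _ _ hpz
      obtain ⟨q, hq, hqz⟩ := ((isPrime_asIdeal z).multiset_prod_mem_iff_exists_mem _).1 h2
      exact ⟨q, UniqueFactorizationMonoid.prime_of_factor _ hq, hqz,
        UniqueFactorizationMonoid.dvd_of_mem_factors hq⟩
    obtain ⟨y, hy, hy1⟩ := exists_point_of_prime (R := .of (ChartRing k (gens b)))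
      (F.chartι k ⟨gens b, hb⟩) hq
    have hyz : y ⤳ z := by
      refine (PrimeSpectrum.le_iff_specializes y z).1 ?_
      change y.asIdeal ≤ z.asIdeal
      rw [hy, Ideal.span_singleton_le_iff_mem]
      exact hqz
    have h3 := hz _ (hyz.map (F.chartι k ⟨gens b, hb⟩).continuous)
    rw [← hord b hb y hy1, ← hp b hb] at h3
    obtain ⟨r, hr⟩ := hqp
    have hr0 : r ≠ 0 := by rintro rfl; exact hpb0 (by rw [hr, mul_zero])
    rw [hr, map_mul, Scheme.ord_mul ((map_ne_zero_iff _ hinj).2 hq.ne_zero)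
      ((map_ne_zero_iff _ hinj).2 hr0)] at h3
    have h4 := ord_eq_one (R := .of (ChartRing k (gens b))) (F.chartι k ⟨gens b, hb⟩) y q hy1
      hq.ne_zero hy
    have h5 := ord_nonneg (R := .of (ChartRing k (gens b))) (F.chartι k ⟨gens b, hb⟩) y r
    change (F.toricVariety k).ord (toFunctionField (R := .of (ChartRing k (gens b)))
      (F.chartι k ⟨gens b, hb⟩) q) _ + (F.toricVariety k).ord (toFunctionField
      (R := .of (ChartRing k (gens b))) (F.chartι k ⟨gens b, hb⟩) r) _ = 0 at h3
    omega
  · intro hpz y hy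
    obtain ⟨y', rfl⟩ : y ∈ Set.range (F.chartι k ⟨gens b, hb⟩) :=
      hy.mem_open (F.chartι k ⟨gens b, hb⟩).isOpenEmbedding.isOpen_range ⟨z, rfl⟩
    have hyz : y' ⤳ z := (F.chartι k ⟨gens b, hb⟩).isOpenEmbedding.isInducing.specializes_iff.1 hy
    by_cases h1 : Order.coheight (F.chartι k ⟨gens b, hb⟩ y') = 1
    · rw [← hord b hb y' h1, ← hp b hb]
      refine ord_eq_zero_of_notMem (R := .of (ChartRing k (gens b))) _ _ _ fun h => hpz ?_
      exact (PrimeSpectrum.le_iff_specializes y' z).2 hyz h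
    · rw [Scheme.ord_eq_zero_of_coheight_neq_one h1, Pi.neg_apply, hD.1 _ h1, neg_zero, mul_zero,
        zero_add]

section Curve

/-- The restriction of functions on a chart to the open torus of the invariant curve attached to
the cone spanned by `τ`, with the coordinate whose exponent is the value at `w`: the characters
that do not vanish on `τ` restrict to zero. -/
noncomputable def curveHom (τ : Finset (Fin d → ℤ)) (w : Fin d → ℤ) :
    ChartRing k τ →ₐ[k] LaurentPolynomial k :=
  AddMonoidAlgebra.lift k (LaurentPolynomial k) (dualMonoid τ)
    { toFun := fun u => open scoped Classical in
        if ∀ v ∈ τ, u.toAdd.1 v = 0 then LaurentPolynomial.T (u.toAdd.1 w) else 0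
      map_one' := by simp
      map_mul' := fun u u' => by
        classical
        by_cases h : ∀ v ∈ τ, u.toAdd.1 v = 0
        · by_cases h' : ∀ v ∈ τ, u'.toAdd.1 v = 0
          · rw [if_pos h, if_pos h', if_pos fun v hv => by simp [h v hv, h' v hv],
              ← LaurentPolynomial.T_add]
            rfl
          · rw [if_neg h', mul_zero, if_neg fun h2 => h' fun v hv => by
              have := h2 v hv
              simp only [toAdd_mul, AddSubmonoid.coe_add, LinearMap.add_apply, h v hv] at this
              simpa using this]
        · rw [if_neg h, zero_mul, if_neg fun h2 => h fun v hv => ?_]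
          have := h2 v hv
          simp only [toAdd_mul, AddSubmonoid.coe_add, LinearMap.add_apply] at this
          have h3 := u.toAdd.2 v hv
          have h4 := u'.toAdd.2 v hv
          omega }

lemma curveHom_single_of_eq_zero {τ : Finset (Fin d → ℤ)} (w : Fin d → ℤ) (u : dualMonoid τ)
    (h : ∀ v ∈ τ, u.1 v = 0) :
    curveHom k τ w (AddMonoidAlgebra.single u 1) = LaurentPolynomial.T (u.1 w) := by
  rw [curveHom, AddMonoidAlgebra.lift_single, one_smul]
  exact if_pos h

lemma curveHom_single_of_ne_zero {τ : Finset (Fin d → ℤ)} (w : Fin d → ℤ) (u : dualMonoid τ)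
    {v : Fin d → ℤ} (hv : v ∈ τ) (h : u.1 v ≠ 0) :
    curveHom k τ w (AddMonoidAlgebra.single u 1) = 0 := by
  rw [curveHom, AddMonoidAlgebra.lift_single, one_smul]
  exact if_neg fun h' => h (h' v hv)

/-- The restriction of functions on the chart of the basis `b` to its `i`-th coordinate axis. -/
noncomputable def axisHom (b : Module.Basis (Fin d) ℤ (Fin d → ℤ)) (i : Fin d) :
    ChartRing k (gens b) →ₐ[k] Polynomial k :=
  (MvPolynomial.aeval (Pi.single i Polynomial.X)).comp (polynomialEquiv k b).symm.toAlgHom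

lemma axisHom_coordVar (b : Module.Basis (Fin d) ℤ (Fin d → ℤ)) (i j : Fin d) :
    axisHom k b i (coordVar k b j) = (Pi.single i Polynomial.X : Fin d → Polynomial k) j := by
  rw [← polynomialEquiv_X]
  simp [axisHom]

lemma algHom_ext_coordVar {b : Module.Basis (Fin d) ℤ (Fin d → ℤ)} {A : Type*} [CommRing A]
    [Algebra k A] {f g : ChartRing k (gens b) →ₐ[k] A}
    (h : ∀ i, f (coordVar k b i) = g (coordVar k b i)) : f = g := by
  have : f.comp (polynomialEquiv k b).toAlgHom = g.comp (polynomialEquiv k b).toAlgHom :=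
    MvPolynomial.algHom_ext fun i => by
      change f (polynomialEquiv k b _) = g (polynomialEquiv k b _)
      rw [polynomialEquiv_X]
      exact h i
  refine AlgHom.ext fun x => ?_
  obtain ⟨y, rfl⟩ := (polynomialEquiv k b).surjective x
  exact congrArg (fun φ => φ y) this

/-- On the chart of an adjacent cone of full dimension, the restriction to the invariant curve is
the restriction to a coordinate axis. The map `e` is the identity on one side of the wall, and the
inversion of the coordinate on the other one. -/
lemma curveHom_comp_chartMap (b : Module.Basis (Fin d) ℤ (Fin d → ℤ)) (i : Fin d)
    {τ : Finset (Fin d → ℤ)} (hτ : τ ⊆ gens b) (hτi : ∀ v, v ∈ τ ↔ ∃ j, j ≠ i ∧ b j = v)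
    (w : Fin d → ℤ) (e : LaurentPolynomial k →ₐ[k] LaurentPolynomial k)
    (he : e (LaurentPolynomial.T 1) = LaurentPolynomial.T (b.coord i w)) :
    (curveHom k τ w).comp (chartMap k hτ) =
      (e.comp Polynomial.toLaurentAlg).comp (axisHom k b i) := by
  refine algHom_ext_coordVar k fun j => ?_
  rw [AlgHom.comp_apply, AlgHom.comp_apply, AlgHom.comp_apply, axisHom_coordVar, coordVar,
    chartMap_single]
  by_cases hij : j = i
  · subst hij
    rw [curveHom_single_of_eq_zero, Pi.single_eq_same, Polynomial.toLaurentAlg_apply,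
      Polynomial.toLaurent_X, he]
    intro v hv
    obtain ⟨l, hl, rfl⟩ := (hτi v).1 hv
    simp [hl]
  · rw [Pi.single_eq_of_ne hij, map_zero, map_zero]
    exact curveHom_single_of_ne_zero k w _ ((hτi _).2 ⟨j, hij, rfl⟩) (by simp)

/-- A function on the projective line is constant. -/
lemma eq_C_of_toLaurent_eq_invert {p q : Polynomial k}
    (h : Polynomial.toLaurent p = LaurentPolynomial.invert (Polynomial.toLaurent q)) :
    p = Polynomial.C (p.coeff 0) ∧ q = Polynomial.C (p.coeff 0) := by
  have hcoeff : ∀ (r : Polynomial k) (n : ℕ), (Polynomial.toLaurent r).coeff (n : ℤ) = r.coeff n :=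
    fun r n => by
      rw [LaurentPolynomial.coeff_toLaurent]
      exact Finsupp.mapDomain_apply Nat.castEmbedding.injective _ _
  have hneg : ∀ (r : Polynomial k) (n : ℕ), n ≠ 0 →
      (Polynomial.toLaurent r).coeff (-n : ℤ) = 0 := fun r n hn => by
    rw [LaurentPolynomial.coeff_toLaurent]
    refine Finsupp.mapDomain_of_notMem_range _ _ ?_
    rintro ⟨m, hm⟩
    simp only [Nat.castEmbedding_apply] at hm
    omega
  have hinv : ∀ n : ℤ, (Polynomial.toLaurent p).coeff n =
      (Polynomial.toLaurent q).coeff (-n) := fun n => by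
    rw [h, LaurentPolynomial.invert_apply]
  constructor
  · ext n
    rcases Nat.eq_zero_or_pos n with rfl | hn
    · simp
    · rw [← hcoeff, hinv, hneg _ _ hn.ne', Polynomial.coeff_C, if_neg hn.ne']
  · ext n
    rcases Nat.eq_zero_or_pos n with rfl | hn
    · rw [Polynomial.coeff_C, if_pos rfl, ← hcoeff, ← hcoeff, hinv]
      simp
    · rw [← hcoeff, Polynomial.coeff_C, if_neg hn.ne', ← neg_neg (n : ℤ), ← hinv, hneg _ _ hn.ne']

/-- Two parametrizations of the affine line that glue to a morphism from the projective line to an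
affine scheme agree at `0`. -/
lemma specMap_eval_comp_eq {R : CommRingCat.{u}} (g g' : Spec (.of (Polynomial k)) ⟶ Spec R)
    (h : Spec.map (CommRingCat.ofHom (Polynomial.toLaurent (R := k))) ≫ g =
      Spec.map (CommRingCat.ofHom ((LaurentPolynomial.invert (R := k)).toRingHom.comp
        Polynomial.toLaurent)) ≫ g') :
    Spec.map (CommRingCat.ofHom (Polynomial.evalRingHom (0 : k))) ≫ g =
      Spec.map (CommRingCat.ofHom (Polynomial.evalRingHom (0 : k))) ≫ g' := by
  obtain ⟨a, rfl⟩ := Spec.map_surjective g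
  obtain ⟨a', rfl⟩ := Spec.map_surjective g'
  rw [← Spec.map_comp, ← Spec.map_comp] at h ⊢
  have h := Spec.map_injective h
  congr 1
  ext r
  have h1 := congrArg (fun φ => φ.hom r) h
  obtain ⟨h2, h3⟩ := eq_C_of_toLaurent_eq_invert k (p := a.hom r) (q := a'.hom r) h1
  change Polynomial.eval 0 (a.hom r) = Polynomial.eval 0 (a'.hom r)
  rw [h3, h2]
  simp

end Curve

/-- The fixed point of the chart of a cone of full dimension. -/
noncomputable def fixedPoint (b : Module.Basis (Fin d) ℤ (Fin d → ℤ)) :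
    Spec (.of (ChartRing k (gens b))) :=
  Spec.map (CommRingCat.ofHom ((MvPolynomial.eval (0 : Fin d → k)).comp
    (polynomialEquiv k b).symm.toRingEquiv.toRingHom)) (⊥ : PrimeSpectrum k)

lemma mem_fixedPoint (b : Module.Basis (Fin d) ℤ (Fin d → ℤ)) (p : ChartRing k (gens b)) :
    p ∈ (fixedPoint k b).asIdeal ↔ MvPolynomial.eval 0 ((polynomialEquiv k b).symm p) = 0 :=
  Iff.rfl

lemma eval_zero_axisHom (b : Module.Basis (Fin d) ℤ (Fin d → ℤ)) (i : Fin d)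
    (p : ChartRing k (gens b)) : Polynomial.eval 0 (axisHom k b i p) =
      MvPolynomial.eval 0 ((polynomialEquiv k b).symm p) := by
  have : ((Polynomial.aeval (0 : k)).comp (axisHom k b i)) =
      (MvPolynomial.aeval (0 : Fin d → k)).comp (polynomialEquiv k b).symm.toAlgHom :=
    algHom_ext_coordVar k fun j => by
      rw [AlgHom.comp_apply, axisHom_coordVar, ← polynomialEquiv_X]
      rcases eq_or_ne j i with rfl | h
      · simp
      · simp [Pi.single_eq_of_ne h]
  have := congrArg (fun φ => φ p) this
  simpa [Polynomial.aeval_def, MvPolynomial.aeval_def, Polynomial.eval₂_eq_eval_map] using this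

/-- The restrictions to the projective line attached to a wall, on the charts of the two adjacent
cones of full dimension. -/
lemma exists_curve (b b' : Module.Basis (Fin d) ℤ (Fin d → ℤ))
    (i : Fin d) (hij : ∀ j, j ≠ i → b' j = b j) (hi : b.coord i (b' i) = -1) :
    ∃ (τ : Finset (Fin d → ℤ)) (h : τ ⊆ gens b) (h' : τ ⊆ gens b')
      (ρ : ChartRing k τ →ₐ[k] LaurentPolynomial k),
      ρ.comp (chartMap k h) = Polynomial.toLaurentAlg.comp (axisHom k b i) ∧
      ρ.comp (chartMap k h') =
        (LaurentPolynomial.invert.toAlgHom.comp Polynomial.toLaurentAlg).comp (axisHom k b' i) := by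
  set τ := (gens b).erase (b i) with hτ
  have hτb : τ ⊆ gens b := Finset.erase_subset _ _
  have hτi : ∀ v, v ∈ τ ↔ ∃ j, j ≠ i ∧ b j = v := fun v => by
    rw [hτ, Finset.mem_erase, mem_gens]
    constructor
    · rintro ⟨h1, j, rfl⟩
      exact ⟨j, fun h => h1 (by rw [h]), rfl⟩
    · rintro ⟨j, h1, rfl⟩
      exact ⟨fun h => h1 (b.injective h), j, rfl⟩
  have hτi' : ∀ v, v ∈ τ ↔ ∃ j, j ≠ i ∧ b' j = v := fun v => by
    rw [hτi]
    exact exists_congr fun j => and_congr_right fun hj => by rw [hij j hj]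
  have hτb' : τ ⊆ gens b' := fun v hv => by
    obtain ⟨j, hj, rfl⟩ := (hτi' v).1 hv
    exact mem_gens.2 ⟨j, rfl⟩
  have hi' : b'.coord i (b i) = -1 := by
    have h1 : b'.coord i = - b.coord i := b'.ext fun j => by
      rcases eq_or_ne j i with rfl | hj
      · rw [LinearMap.neg_apply, hi]; simp
      · rw [LinearMap.neg_apply]
        nth_rewrite 2 [hij j hj]
        simp [hj]
    rw [h1]
    simp
  exact ⟨τ, hτb, hτb', curveHom k τ (b i),
    curveHom_comp_chartMap k b i hτb hτi (b i) (AlgHom.id k _) (by simp),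
    curveHom_comp_chartMap k b' i hτb' hτi' (b i) LaurentPolynomial.invert.toAlgHom
      (by rw [hi']; simp)⟩

/-- The origin of each coordinate axis is the fixed point. -/
lemma specMap_eval_axis (b : Module.Basis (Fin d) ℤ (Fin d → ℤ)) (i : Fin d) :
    Spec.map (CommRingCat.ofHom (axisHom k b i).toRingHom)
      (Spec.map (CommRingCat.ofHom (Polynomial.evalRingHom (0 : k))) (⊥ : PrimeSpectrum k)) =
      fixedPoint k b := by
  refine PrimeSpectrum.ext (Ideal.ext fun p => ?_)
  rw [mem_fixedPoint, ← eval_zero_axisHom k b i]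
  exact Iff.rfl

/-- A coordinate axis lies in a nonvanishing locus if the function restricts to a nonzero constant
on it. -/
lemma range_axis_subset (b : Module.Basis (Fin d) ℤ (Fin d → ℤ)) (hb : gens b ∈ F.cones)
    (i : Fin d) (U : (F.toricVariety k).Opens) (p : ChartRing k (gens b))
    (hp : ∀ z, F.chartι k ⟨gens b, hb⟩ z ∈ U ↔ p ∉ z.asIdeal) (c : k) (hc0 : c ≠ 0)
    (hc : axisHom k b i p = Polynomial.C c) :
    Set.range (Spec.map (CommRingCat.ofHom (axisHom k b i).toRingHom) ≫
      F.chartι k ⟨gens b, hb⟩) ⊆ U := by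
  rintro _ ⟨x, rfl⟩
  refine (hp _).2 fun h3 => (isPrime_asIdeal x).ne_top ?_
  have h4 : axisHom k b i p ∈ x.asIdeal := h3
  rw [hc] at h4
  exact Ideal.eq_top_of_isUnit_mem _ h4 ((Polynomial.isUnit_C).2 (isUnit_iff_ne_zero.2 hc0))

/-- The fixed point of the chart of a cone of full dimension lies in no chart of a cone that does
not contain this one. -/
lemma chartι_fixedPoint_ne (b : Module.Basis (Fin d) ℤ (Fin d → ℤ)) (hb : gens b ∈ F.cones)
    (c : F.cones) (h : ¬ gens b ⊆ c.1) (z : Spec (.of (ChartRing k c.1))) :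
    F.chartι k ⟨gens b, hb⟩ (fixedPoint k b) ≠ F.chartι k c z := by
  intro heq
  obtain ⟨a, fb, fc, x, hx, -⟩ := (Scheme.IsLocallyDirected.ι_eq_ι_iff (F.chartFunctor k)
    (i := ⟨gens b, hb⟩) (j := c)).1 heq
  obtain ⟨v, hv, hva⟩ : ∃ v ∈ gens b, v ∉ a.1 := by
    by_contra! h'
    exact h fun v hv => leOfHom fc (h' v hv)
  obtain ⟨j, rfl⟩ := mem_gens.1 hv
  have h1 : coordVar k b j ∈ (fixedPoint k b).asIdeal := by
    rw [mem_fixedPoint, ← polynomialEquiv_X]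
    simp
  rw [← hx] at h1
  have hab : a.1 ⊆ gens b := leOfHom fb
  have h0 : ∀ v ∈ a.1, b.coord j v = 0 := fun v hv => by
    obtain ⟨l, rfl⟩ := mem_gens.1 (hab hv)
    have : l ≠ j := fun h => hva (h ▸ hv)
    simp [this]
  have h2 : chartMap k hab (coordVar k b j) ∈ x.asIdeal := h1
  refine (isPrime_asIdeal x).ne_top (Ideal.eq_top_of_isUnit_mem _ h2 ?_)
  rw [coordVar, chartMap_single]
  refine IsUnit.of_mul_eq_one
    (AddMonoidAlgebra.single ⟨-b.coord j, fun v hv => by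
      rw [LinearMap.neg_apply, h0 v hv, neg_zero]⟩ 1) ?_
  rw [AddMonoidAlgebra.single_mul_single, AddMonoidAlgebra.one_def, mul_one]
  congr 1
  exact Subtype.ext (add_neg_cancel _)

/-- If a regular function on each of the charts of two adjacent cones of full dimension is given
such that the two functions agree on the common chart, then they restrict to a constant on the
projective line attached to the wall. If this constant is not zero, then this line is not contained
in an affine open subset on which the functions vanish nowhere. -/
lemma not_affine_of_wall (b b' : Module.Basis (Fin d) ℤ (Fin d → ℤ)) (hb : gens b ∈ F.cones)
    (hb' : gens b' ∈ F.cones)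
    (i : Fin d) (hij : ∀ j, j ≠ i → b' j = b j) (hi : b.coord i (b' i) = -1)
    (U : (F.toricVariety k).Opens) (hU : IsAffineOpen U) (p : ChartRing k (gens b))
    (p' : ChartRing k (gens b')) (hpp : F.chartToField k ⟨gens b, hb⟩ p =
      F.chartToField k ⟨gens b', hb'⟩ p')
    (hp : ∀ z, F.chartι k ⟨gens b, hb⟩ z ∈ U ↔ p ∉ z.asIdeal)
    (hp' : ∀ z, F.chartι k ⟨gens b', hb'⟩ z ∈ U ↔ p' ∉ z.asIdeal) :
    F.chartι k ⟨gens b, hb⟩ (fixedPoint k b) ∉ U := by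
  intro hxU
  obtain ⟨τ, hτ, hτ', ρ, hρ, hρ'⟩ := exists_curve k b b' i hij hi
  have hτF : τ ∈ F.cones := F.face_mem _ hb _ hτ
  have hres : chartMap k hτ p = chartMap k hτ' p' := by
    apply F.chartToField_injective k ⟨τ, hτF⟩
    rw [F.chartToField_chartMap k (c := ⟨gens b, hb⟩) hτ,
      F.chartToField_chartMap k (c := ⟨gens b', hb'⟩) hτ', hpp]
  obtain ⟨h1, h2⟩ := eq_C_of_toLaurent_eq_invert k (p := axisHom k b i p)
    (q := axisHom k b' i p') (by
      have h1 := congrArg (fun φ => φ p) hρ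
      have h2 := congrArg (fun φ => φ p') hρ'
      simp only [AlgHom.comp_apply] at h1 h2
      rw [← hres, h1] at h2
      exact h2)
  set c := (axisHom k b i p).coeff 0
  have hne : c ≠ 0 := by
    have h3 := (hp _).1 hxU
    rw [mem_fixedPoint, ← eval_zero_axisHom k b i, h1] at h3
    simpa using h3
  have hsub := F.range_axis_subset k b hb i U p hp c hne h1
  have hsub' := F.range_axis_subset k b' hb' i U p' hp' c hne h2
  rw [← hU.range_fromSpec] at hsub hsub'
  let g := IsOpenImmersion.lift hU.fromSpec _ hsub
  let g' := IsOpenImmersion.lift hU.fromSpec _ hsub'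
  have hg : g ≫ hU.fromSpec = _ := IsOpenImmersion.lift_fac _ _ _
  have hg' : g' ≫ hU.fromSpec = _ := IsOpenImmersion.lift_fac _ _ _
  have hcomp : ∀ {b₁ : Module.Basis (Fin d) ℤ (Fin d → ℤ)} (hb₁ : gens b₁ ∈ F.cones)
      (hτ₁ : τ ⊆ gens b₁) (e : Polynomial k →+* LaurentPolynomial k),
      ρ.toRingHom.comp (chartMap k hτ₁).toRingHom = e.comp (axisHom k b₁ i).toRingHom →
      Spec.map (CommRingCat.ofHom e) ≫ Spec.map (CommRingCat.ofHom (axisHom k b₁ i).toRingHom) ≫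
        F.chartι k ⟨gens b₁, hb₁⟩ = Spec.map (CommRingCat.ofHom ρ.toRingHom) ≫
          F.chartι k ⟨τ, hτF⟩ := by
    intro b₁ hb₁ hτ₁ e he
    rw [← F.map_chartι k (a := ⟨τ, hτF⟩) (c := ⟨gens b₁, hb₁⟩) hτ₁, ← Spec.map_comp_assoc,
      ← Spec.map_comp_assoc, ← CommRingCat.ofHom_comp, ← CommRingCat.ofHom_comp, he]
  have hgg := specMap_eval_comp_eq k g g' (by
    rw [← cancel_mono hU.fromSpec, Category.assoc, Category.assoc, hg, hg']
    refine (hcomp hb hτ _ ?_).trans (hcomp hb' hτ' _ ?_).symm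
    · exact congrArg AlgHom.toRingHom hρ
    · exact congrArg AlgHom.toRingHom hρ')
  have hpt := congrArg (fun φ => (φ ≫ hU.fromSpec) (⊥ : PrimeSpectrum k)) hgg
  simp only [Category.assoc, hg, hg'] at hpt
  have hpt' : F.chartι k ⟨gens b, hb⟩ (fixedPoint k b) =
      F.chartι k ⟨gens b', hb'⟩ (fixedPoint k b') := by
    rw [← specMap_eval_axis k b i, ← specMap_eval_axis k b' i]
    exact hpt
  refine F.chartι_fixedPoint_ne k b hb ⟨gens b', hb'⟩ (fun hle => ?_) _ hpt'
  obtain ⟨j, hj⟩ := mem_gens.1 (hle (mem_gens.2 ⟨i, rfl⟩))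
  by_cases hji : j = i
  · subst hji
    rw [hj] at hi
    simp at hi
  · rw [hij j hji] at hj
    exact hji (b.injective hj)

/-- Strict concavity across a wall: if the functionals of two adjacent cones of full dimension
coincided, the anticanonical bundle would be trivial on the projective line attached to the wall,
and an affine nonvanishing locus of a section could not contain the fixed points on it. -/
lemma coordSum_ne_one_of_wall (D : F.toricVariety k → ℤ)
    (hD : IsCanonicalDivisor (F.structureMap k) d D) (hA : IsAmple (-D))
    (b b' : Module.Basis (Fin d) ℤ (Fin d → ℤ)) (hb : gens b ∈ F.cones) (hb' : gens b' ∈ F.cones)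
    (i : Fin d) (hij : ∀ j, j ≠ i → b' j = b j) (hi : b.coord i (b' i) = -1) :
    coordSum b (b' i) ≠ 1 := by
  intro hone
  obtain ⟨n, h, U, p, hn, hh, hU, hxU, hp⟩ := F.exists_section k D hD hA
    (F.chartι k ⟨gens b, hb⟩ (fixedPoint k b))
  have hsum : coordSum b' = coordSum b := b'.ext fun j => by
    rw [coordSum_basis]
    by_cases hj : j = i
    · rw [hj, hone]
    · rw [hij j hj, coordSum_basis]
  refine F.not_affine_of_wall k b b' hb hb' i hij hi U hU (p b) (p b') ?_ (hp b hb).2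
    (hp b' hb').2 hxU
  rw [(hp b hb).1, (hp b' hb').1, hsum]

end SmoothCompleteFan
/-! ### Orders of characters along invariant divisors -/

namespace SmoothCompleteFan

variable {d : ℕ} (F : SmoothCompleteFan d) (k : Type u) [Field k]

lemma coeff_chartMap_of_mem {a c : Finset (Fin d → ℤ)} (h : a ⊆ c) (p : ChartRing k c)
    (m : dualMonoid c) :
    (chartMap k h p).coeff ⟨m.1, dualMonoid_anti h m.2⟩ = p.coeff m := by
  change (AddMonoidAlgebra.mapDomain _ p).coeff _ = _
  exact Finsupp.mapDomain_apply (AddSubmonoid.inclusion_injective (dualMonoid_anti h)) p.coeff m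

lemma mem_of_coeff_chartMap_ne_zero {a c : Finset (Fin d → ℤ)} (h : a ⊆ c) (p : ChartRing k c)
    (m : dualMonoid a) (hm : (chartMap k h p).coeff m ≠ 0) : m.1 ∈ dualMonoid c := by
  by_contra hmc
  refine hm ?_
  change (AddMonoidAlgebra.mapDomain _ p).coeff _ = _
  refine Finsupp.mapDomain_of_notMem_range p.coeff m ?_
  rintro ⟨m', rfl⟩
  exact hmc m'.2

lemma eval_zero_polynomialEquiv_symm (b : Module.Basis (Fin d) ℤ (Fin d → ℤ))
    (p : ChartRing k (gens b)) :
    MvPolynomial.eval 0 ((polynomialEquiv k b).symm p) = p.coeff 0 := by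
  rw [MvPolynomial.eval_zero, MvPolynomial.constantCoeff_eq]
  change (((AddMonoidAlgebra.domCongr k k (dualMonoidEquiv b)).symm p).coeff) 0 = _
  rw [AddMonoidAlgebra.domCongr_symm, AddMonoidAlgebra.coeff_domCongr]
  simp

/-- The piecewise linear function attached to the anticanonical divisor of a toric Fano variety is
concave: this follows from the existence of a section of some multiple that does not vanish at a
given torus-fixed point. -/
lemma coordSum_le_one (D : F.toricVariety k → ℤ)
    (hD : IsCanonicalDivisor (F.structureMap k) d D) (hA : IsAmple (-D))
    (b b' : Module.Basis (Fin d) ℤ (Fin d → ℤ)) (hb : gens b ∈ F.cones) (hb' : gens b' ∈ F.cones)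
    {v : Fin d → ℤ} (hv : v ∈ gens b') : coordSum b v ≤ 1 := by
  obtain ⟨n, h, U, p, hn, hh, hU, hxU, hp⟩ := F.exists_section k D hD hA
    (F.chartι k ⟨gens b, hb⟩ (fixedPoint k b))
  have h0 := ((hp b hb).2 _).1 hxU
  rw [mem_fixedPoint, eval_zero_polynomialEquiv_symm] at h0
  let m : dualMonoid (∅ : Finset (Fin d → ℤ)) :=
    ⟨n • (coordSum b - coordSum b'), by simp [mem_dualMonoid]⟩
  have heq : chartMap k (Finset.empty_subset _) (p b) =
      chartMap k (Finset.empty_subset _) (p b') * AddMonoidAlgebra.single m 1 := by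
    apply F.chartToField_injective k ⟨∅, F.empty_mem_cones⟩
    rw [map_mul, F.chartToField_chartMap k (c := ⟨gens b, hb⟩) (Finset.empty_subset _),
      F.chartToField_chartMap k (c := ⟨gens b', hb'⟩) (Finset.empty_subset _), (hp b hb).1,
      (hp b' hb').1, F.chartToField_single k ⟨∅, F.empty_mem_cones⟩, mul_assoc, ← chi_add]
    congr 2
    change _ = _ + n • (coordSum b - coordSum b')
    rw [smul_sub, add_sub_cancel]
  have h1 := coeff_chartMap_of_mem k (Finset.empty_subset _) (p b) 0
  rw [heq] at h1
  let m' : dualMonoid (∅ : Finset (Fin d → ℤ)) :=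
    ⟨-(n • (coordSum b - coordSum b')), by simp [mem_dualMonoid]⟩
  have h2 : ∀ q : ChartRing k ∅, (q * AddMonoidAlgebra.single m 1).coeff 0 = q.coeff m' := by
    intro q
    rw [AddMonoidAlgebra.coeff_mul_single_eq_coeff_mul (m₂ := m'), mul_one]
    intro x _
    constructor
    · intro hx
      exact Subtype.ext (eq_neg_of_add_eq_zero_left (congrArg Subtype.val hx))
    · rintro rfl
      exact Subtype.ext (neg_add_cancel _)
  have h3 := mem_of_coeff_chartMap_ne_zero k (Finset.empty_subset _) (p b') m' (by
    rw [← h2]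
    intro h4
    exact h0 (h1.symm.trans h4)) v hv
  change 0 ≤ -(n • (coordSum b v - coordSum b' v)) at h3
  obtain ⟨i, rfl⟩ := mem_gens.1 hv
  rw [coordSum_basis b', nsmul_eq_mul, ← mul_neg] at h3
  have := nonneg_of_mul_nonneg_right h3 (by exact_mod_cast hn)
  omega

lemma chi_eq_prod (b : Module.Basis (Fin d) ℤ (Fin d → ℤ)) (m : Module.Dual ℤ (Fin d → ℤ)) :
    F.chi k m = ∏ i, F.chi k (b.coord i) ^ (m (b i)) := by
  have : m = ∑ i, m (b i) • b.coord i := b.ext fun j => by simp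
  conv_lhs => rw [this]
  rw [chi_sum]
  exact Finset.prod_congr rfl fun i _ => F.chi_zsmul k _ _

lemma ord_zpow {X : Scheme.{u}} [AlgebraicGeometry.IsIntegral X] [IsLocallyNoetherian X]
    {a : X.functionField} (ha : a ≠ 0) (n : ℤ) (x : X) : X.ord (a ^ n) x = n * X.ord a x := by
  obtain ⟨n, rfl | rfl⟩ := n.eq_nat_or_neg
  · rw [zpow_natCast, ord_pow ha]
  · rw [zpow_neg, zpow_natCast, ord_inv (pow_ne_zero _ ha), ord_pow ha, neg_mul]

/-- The order of a character along the divisor of the `i`-th generator of a cone of full dimension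
is its value at this generator; constants have order zero. -/
lemma exists_point_ord_chi (b : Module.Basis (Fin d) ℤ (Fin d → ℤ)) (hb : gens b ∈ F.cones)
    (i : Fin d) : ∃ x : F.toricVariety k, (∀ m, (F.toricVariety k).ord (F.chi k m) x = m (b i)) ∧
      ∀ r : k, r ≠ 0 →
        (F.toricVariety k).ord (F.chartToField k ⟨gens b, hb⟩ (algebraMap k _ r)) x = 0 := by
  have : IsNoetherianRing (CommRingCat.of (ChartRing k (gens b))) := isNoetherianRing_gens k b
  obtain ⟨pt, hpt⟩ := exists_valuation (R := .of (ChartRing k (gens b))) (F.chartι k ⟨gens b, hb⟩)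
  obtain ⟨-, h1, h2⟩ := hpt _ (prime_coordVar k b i)
  refine ⟨_, fun m => ?_, fun r hr => h2 _ fun hdvd => (prime_coordVar k b i).not_isUnit
    (isUnit_of_dvd_unit hdvd ((IsUnit.mk0 r hr).map (algebraMap k _)))⟩
  have hprod : ∀ (s : Finset (Fin d)) (x : F.toricVariety k), (F.toricVariety k).ord
      (∏ j ∈ s, F.chi k (b.coord j) ^ (m (b j))) x =
        ∑ j ∈ s, m (b j) * (F.toricVariety k).ord (F.chi k (b.coord j)) x := by
    intro s x
    induction s using Finset.induction_on with
    | empty => simp [ord_one]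
    | insert a s ha ih =>
      rw [Finset.prod_insert ha, Finset.sum_insert ha, Scheme.ord_mul
        (zpow_ne_zero _ (F.chi_ne_zero k _))
        (Finset.prod_ne_zero_iff.2 fun j _ => zpow_ne_zero _ (F.chi_ne_zero k _)), ih,
        ord_zpow (F.chi_ne_zero k _)]
  rw [F.chi_eq_prod k b m, hprod, Finset.sum_eq_single i]
  · rw [← F.chartToField_coordVar k b hb]
    exact (congrArg _ h1).trans (mul_one _)
  · intro j _ hj
    rw [← F.chartToField_coordVar k b hb]
    exact (congrArg _ (h2 _ (not_coordVar_dvd k b hj.symm))).trans (mul_zero _)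
  · simp

/-- If the canonical divisor is divisible by `2`, then the functionals attached to two cones of full
dimension are congruent modulo `2`: their difference is, as a character, the square of a rational
function up to a constant. -/
lemma odd_coordSum (K H : F.toricVariety k → ℤ)
    (hK : IsCanonicalDivisor (F.structureMap k) d K) (hH : LinEquiv (-K) (2 • H))
    (b b' : Module.Basis (Fin d) ℤ (Fin d → ℤ)) (hb : gens b ∈ F.cones) (hb' : gens b' ∈ F.cones)
    {v : Fin d → ℤ} (hv : v ∈ gens b') : Odd (coordSum b v) := by
  let := functionFieldAlgebra (F.structureMap k)
  obtain ⟨f₀, hf₀, hf⟩ := F.exists_canonical_function k K hK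
  obtain ⟨f₁, hf₁, hH⟩ := hH
  have hne := mul_ne_zero hf₀ hf₁
  have key : ∀ (b : Module.Basis (Fin d) ℤ (Fin d → ℤ)) (hb : gens b ∈ F.cones),
      ∃ (r : k) (g : F.FF k), r ≠ 0 ∧ g ≠ 0 ∧
        F.chi k (coordSum b) = algebraMap k (F.FF k) r * g ^ 2 * (f₀ * f₁) := by
    intro b hb
    have : IsNoetherianRing (CommRingCat.of (ChartRing k (gens b))) := isNoetherianRing_gens k b
    have : UniqueFactorizationMonoid (CommRingCat.of (ChartRing k (gens b))) :=
      inferInstanceAs (UniqueFactorizationMonoid (ChartRing k (gens b)))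
    obtain ⟨w, g, hw, hg, hwg⟩ := exists_unit_mul_sq_of_even (R := .of (ChartRing k (gens b)))
      (F.chartι k ⟨gens b, hb⟩) (F.chi k (coordSum b) / (f₀ * f₁))
      (div_ne_zero (F.chi_ne_zero k _) hne) fun z hz => by
        have h1 := hf b hb z hz
        have h2 := hH (F.chartι k ⟨gens b, hb⟩ z)
        rw [Pi.neg_apply, Pi.smul_apply, two_nsmul] at h2
        rw [div_eq_mul_inv, Scheme.ord_mul (F.chi_ne_zero k _) (inv_ne_zero hne), ord_inv hne,
          Scheme.ord_mul hf₀ hf₁]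
        refine ⟨H (F.chartι k ⟨gens b, hb⟩ z), ?_⟩
        omega
    obtain ⟨r, hr, rfl⟩ := exists_algebraMap_of_isUnit k b hw
    refine ⟨r, g, hr, hg, ?_⟩
    rw [← F.chartToField_algebraMap k ⟨gens b, hb⟩]
    exact (div_eq_iff hne).1 hwg
  obtain ⟨r, g, hr, hg, h1⟩ := key b hb
  obtain ⟨r', g', hr', hg', h2⟩ := key b' hb'
  obtain ⟨i, rfl⟩ := mem_gens.1 hv
  obtain ⟨x, hx, hx0⟩ := F.exists_point_ord_chi k b' hb' i
  have h3 := congrArg (fun f => (F.toricVariety k).ord f x) h1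
  have h4 := congrArg (fun f => (F.toricVariety k).ord f x) h2
  have hc : ∀ r : k, r ≠ 0 → (F.toricVariety k).ord (algebraMap k (F.FF k) r) x = 0 :=
      fun r hr => by
    rw [← F.chartToField_algebraMap k ⟨gens b', hb'⟩]
    exact hx0 r hr
  have hr0 : ∀ r : k, r ≠ 0 → algebraMap k (F.FF k) r ≠ 0 := fun r hr => by simpa using hr
  rw [hx, Scheme.ord_mul (mul_ne_zero (hr0 r hr) (pow_ne_zero _ hg)) hne,
    Scheme.ord_mul (hr0 r hr) (pow_ne_zero _ hg), hc r hr, ord_pow hg] at h3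
  rw [hx, coordSum_basis, Scheme.ord_mul (mul_ne_zero (hr0 r' hr') (pow_ne_zero _ hg')) hne,
    Scheme.ord_mul (hr0 r' hr') (pow_ne_zero _ hg'), hc r' hr', ord_pow hg'] at h4
  push_cast at h3 h4
  rw [Int.odd_iff]
  omega

end SmoothCompleteFan
/-! ### Cones of a smooth complete fan -/

section LatticeCone

variable {d : ℕ}

/-- The real-linear extension of an integral functional. -/
noncomputable def realExt (u : Module.Dual ℤ (Fin d → ℤ)) : (Fin d → ℝ) →ₗ[ℝ] ℝ :=
  ∑ j, (u (Pi.single j 1) : ℝ) • LinearMap.proj j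

lemma realExt_cast (u : Module.Dual ℤ (Fin d → ℤ)) (v : Fin d → ℤ) :
    realExt u (fun i => (v i : ℝ)) = u v := by
  have h : u v = ∑ j, u (Pi.single j 1) * v j := by
    conv_lhs => rw [pi_eq_sum_univ' v]
    rw [map_sum]
    exact Finset.sum_congr rfl fun j _ => by
      rw [map_smul, smul_eq_mul, mul_comm]
  rw [h]
  simp [realExt]

lemma mem_realCone {c : Finset (Fin d → ℤ)} {x : Fin d → ℝ} (hx : x ∈ realCone c) :
    ∃ s : (Fin d → ℤ) → ℝ, (∀ v, 0 ≤ s v) ∧ x = ∑ v ∈ c, s v • (fun i => (v i : ℝ)) := by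
  obtain ⟨s, hs⟩ := (Submodule.mem_span_image_finset_iff_exists_fun _).1 hx
  classical
  refine ⟨fun v => if h : v ∈ c then s ⟨v, h⟩ else 0, fun v => ?_, ?_⟩
  · by_cases h : v ∈ c
    · simpa [h] using (s ⟨v, h⟩).2
    · simp [h]
  · rw [← hs, ← Finset.sum_coe_sort c]
    refine Finset.sum_congr rfl fun v _ => ?_
    simp only [dif_pos v.2]
    rfl

lemma sum_mem_realCone {c : Finset (Fin d → ℤ)} {s : (Fin d → ℤ) → ℝ} (hs : ∀ v ∈ c, 0 ≤ s v) :
    ∑ v ∈ c, s v • (fun i => (v i : ℝ)) ∈ realCone c :=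
  Submodule.sum_mem _ fun v hv => Submodule.smul_mem (realCone c)
    (⟨s v, hs v hv⟩ : {r : ℝ // 0 ≤ r})
    (Submodule.subset_span ⟨v, hv, rfl⟩)

lemma cast_sum_smul (c : Finset (Fin d → ℤ)) (s : (Fin d → ℤ) → ℤ) :
    (fun i => (((∑ v ∈ c, s v • v) i : ℤ) : ℝ)) = ∑ v ∈ c, (s v : ℝ) • (fun i => (v i : ℝ)) := by
  ext i
  simp [Finset.sum_apply]

end LatticeCone

namespace SmoothCompleteFan

variable {d : ℕ} (F : SmoothCompleteFan d)

/-- A lattice vector has at most one expression as a nonnegative combination of the generators of a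
cone of the fan. -/
lemma mem_and_eq_of_sum_eq {c c' : Finset (Fin d → ℤ)} (hc : c ∈ F.cones) (hc' : c' ∈ F.cones)
    {s s' : (Fin d → ℤ) → ℤ} (hs : ∀ v ∈ c, 0 ≤ s v) (hs' : ∀ v ∈ c', 0 ≤ s' v)
    (h : ∑ v ∈ c, s v • v = ∑ v ∈ c', s' v • v) {v : Fin d → ℤ} (hv : v ∈ c) (hv0 : 0 < s v) :
    v ∈ c' ∧ s v = s' v := by
  classical
  have h1 : ∑ v ∈ c, (s v : ℝ) • (fun i => (v i : ℝ)) ∈ realCone (c ∩ c') := by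
    rw [← F.inter_eq c hc c' hc']
    refine ⟨sum_mem_realCone fun v hv => by exact_mod_cast hs v hv, ?_⟩
    rw [← cast_sum_smul, h, cast_sum_smul]
    exact sum_mem_realCone fun v hv => by exact_mod_cast hs' v hv
  obtain ⟨t, ht, h2⟩ := mem_realCone h1
  -- the coefficients with respect to a lattice basis that contains a given cone
  have key : ∀ (e : Finset (Fin d → ℤ)) (r : (Fin d → ℤ) → ℤ), e ∈ F.cones → c ∩ c' ⊆ e →
      ∑ v ∈ e, (r v : ℝ) • (fun i => (v i : ℝ)) = ∑ v ∈ c, (s v : ℝ) • (fun i => (v i : ℝ)) →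
      ∀ v ∈ e, (r v : ℝ) = if v ∈ c ∩ c' then t v else 0 := by
    intro e r he hce hr v hv
    obtain ⟨b, hb⟩ := F.nonsingular e he
    obtain ⟨i, rfl⟩ := hb hv
    have hcoord : ∀ w ∈ e, (b.coord i w : ℝ) = if w = b i then 1 else 0 := by
      intro w hw
      obtain ⟨j, rfl⟩ := hb hw
      rw [Module.Basis.coord_apply, Module.Basis.repr_self, Finsupp.single_apply]
      by_cases hji : j = i <;> simp [hji, b.injective.eq_iff]
    have h3 := congrArg (realExt (b.coord i)) (hr.trans h2)
    simp only [map_sum, map_smul, realExt_cast, smul_eq_mul] at h3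
    rw [Finset.sum_congr rfl fun w hw => by rw [hcoord w hw],
      Finset.sum_congr rfl fun w (hw : w ∈ c ∩ c') => by rw [hcoord w (hce hw)]] at h3
    simpa [Finset.mem_inter, hv] using h3
  have h3 := key c s hc Finset.inter_subset_left rfl v hv
  by_cases hvc : v ∈ c'
  · have h4 := key c' s' hc' Finset.inter_subset_right (by
      rw [← cast_sum_smul, ← cast_sum_smul, h]) v hvc
    refine ⟨hvc, ?_⟩
    exact_mod_cast h3.trans h4.symm
  · rw [if_neg fun h => hvc (Finset.mem_inter.1 h).2] at h3
    have : s v = 0 := by exact_mod_cast h3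
    omega

/-- Uniqueness in the star of a cone: the coefficients at the generators of the common face `e` may
have any sign. -/
lemma mem_and_eq_of_sum_eq_star {c c' e : Finset (Fin d → ℤ)} (hc : c ∈ F.cones)
    (hc' : c' ∈ F.cones) (hec : e ⊆ c) (hec' : e ⊆ c') {s s' : (Fin d → ℤ) → ℤ}
    (hs : ∀ v ∈ c, v ∉ e → 0 ≤ s v) (hs' : ∀ v ∈ c', v ∉ e → 0 ≤ s' v)
    (h : ∑ v ∈ c, s v • v = ∑ v ∈ c', s' v • v) {v : Fin d → ℤ} (hv : v ∈ c) (hve : v ∉ e)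
    (hv0 : 0 < s v) : v ∈ c' ∧ s v = s' v := by
  classical
  let N : ℤ := ∑ v ∈ e, (|s v| + |s' v|)
  have hN : ∀ v ∈ e, |s v| + |s' v| ≤ N := fun v hv =>
    Finset.single_le_sum (f := fun v => |s v| + |s' v|) (fun _ _ => by positivity) hv
  let g : (Fin d → ℤ) → ℤ := fun v => if v ∈ e then N else 0
  have hg : ∀ c : Finset (Fin d → ℤ), e ⊆ c → ∀ r : (Fin d → ℤ) → ℤ,
      ∑ v ∈ c, (r v + g v) • v = ∑ v ∈ c, r v • v + ∑ v ∈ e, N • v := by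
    intro c hec r
    simp only [add_smul, Finset.sum_add_distrib, g, ite_smul, zero_smul]
    rw [Finset.sum_ite_mem, Finset.inter_eq_right.2 hec]
  have := F.mem_and_eq_of_sum_eq hc hc' (s := fun v => s v + g v) (s' := fun v => s' v + g v)
    (fun v hv => ?_) (fun v hv => ?_) (by rw [hg c hec, hg c' hec', h]) hv (by simp [g, hve, hv0])
  · simpa [g, hve] using this
  · by_cases hve : v ∈ e
    · have h1 := hN v hve
      have h2 := neg_abs_le (s v)
      have h3 := abs_nonneg (s' v)
      simp only [g, if_pos hve]
      linarith
    · simpa [g, hve] using hs v hv hve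
  · by_cases hve : v ∈ e
    · have h1 := hN v hve
      have h2 := neg_abs_le (s' v)
      have h3 := abs_nonneg (s v)
      simp only [g, if_pos hve]
      linarith
    · simpa [g, hve] using hs' v hv hve

lemma sum_basis_eq {c : Finset (Fin d → ℤ)} {b : Module.Basis (Fin d) ℤ (Fin d → ℤ)}
    (hcb : ↑c ⊆ Set.range b) (s : (Fin d → ℤ) → ℤ) (i : Fin d) :
    b.coord i (∑ v ∈ c, s v • v) = if b i ∈ c then s (b i) else 0 := by
  classical
  rw [map_sum, ← Finset.sum_ite_eq' c (b i) s]
  refine Finset.sum_congr rfl fun v hv => ?_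
  obtain ⟨j, rfl⟩ := hcb hv
  rw [map_smul, smul_eq_mul]
  by_cases hji : j = i
  · simp [hji]
  · rw [if_neg fun h => hji (b.injective h)]
    simp [hji]

lemma eq_sum_of_coord_eq_zero {c : Finset (Fin d → ℤ)} {b : Module.Basis (Fin d) ℤ (Fin d → ℤ)}
    (hcb : ↑c ⊆ Set.range b) (x : Fin d → ℤ) (h : ∀ i, b i ∉ c → b.coord i x = 0) :
    ∃ s : (Fin d → ℤ) → ℤ, x = ∑ v ∈ c, s v • v ∧ ∀ i, s (b i) = b.coord i x := by
  classical
  let s : (Fin d → ℤ) → ℤ := fun v => if hv : ∃ i, b i = v then b.coord hv.choose x else 0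
  have hs : ∀ i, s (b i) = b.coord i x := fun i => by
    have : ∃ j, b j = b i := ⟨i, rfl⟩
    simp only [s, dif_pos this, b.injective this.choose_spec]
  refine ⟨s, b.ext_elem fun i => ?_, hs⟩
  have := sum_basis_eq hcb s i
  rw [Module.Basis.coord_apply] at this
  rw [this]
  split_ifs with hi
  · rw [hs]; rfl
  · exact h i hi

/-- Completeness, for lattice vectors and integral coefficients. -/
lemma exists_nonneg_sum (x : Fin d → ℤ) : ∃ c ∈ F.cones, ∃ s : (Fin d → ℤ) → ℤ,
    (∀ v ∈ c, 0 ≤ s v) ∧ x = ∑ v ∈ c, s v • v := by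
  classical
  obtain ⟨c, hc, hx⟩ := F.complete (fun i => (x i : ℝ))
  obtain ⟨t, ht, htx⟩ := mem_realCone hx
  obtain ⟨b, hb⟩ := F.nonsingular c hc
  have key : ∀ i, (b.coord i x : ℝ) = if b i ∈ c then t (b i) else 0 := by
    intro i
    have h := congrArg (realExt (b.coord i)) htx
    simp only [map_sum, map_smul, realExt_cast, smul_eq_mul] at h
    rw [h, ← Finset.sum_ite_eq' c (b i) t]
    refine Finset.sum_congr rfl fun v hv => ?_
    obtain ⟨j, rfl⟩ := hb hv
    by_cases hji : j = i
    · simp [hji]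
    · rw [if_neg fun h => hji (b.injective h)]
      simp [hji]
  obtain ⟨s, hs, hs'⟩ := eq_sum_of_coord_eq_zero hb x fun i hi => by
    have := key i
    rw [if_neg hi] at this
    exact_mod_cast this
  refine ⟨c, hc, s, fun v hv => ?_, hs⟩
  obtain ⟨i, rfl⟩ := hb hv
  have := key i
  rw [if_pos hv] at this
  have h2 := ht (b i)
  rw [← this] at h2
  rw [hs']
  exact_mod_cast h2

/-- The star of a cone `c` is complete: each lattice vector is, modulo the span of `c`, a
nonnegative combination of the further generators of some cone that contains `c`. -/
lemma exists_star_sum {c : Finset (Fin d → ℤ)} (hc : c ∈ F.cones) (w : Fin d → ℤ) :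
    ∃ c' ∈ F.cones, c ⊆ c' ∧ ∃ s : (Fin d → ℤ) → ℤ,
      (∀ v ∈ c', v ∉ c → 0 ≤ s v) ∧ w = ∑ v ∈ c', s v • v := by
  classical
  choose cn hcn sn hsn hx using fun n : ℕ => F.exists_nonneg_sum (((n : ℤ) + 1) • ∑ v ∈ c, v + w)
  -- some cone contains infinitely many of the points `(n + 1) ∑ v + w`
  obtain ⟨c', hc'⟩ := Finite.exists_infinite_fiber (fun n => (⟨cn n, hcn n⟩ : F.cones))
  rw [Set.infinite_coe_iff] at hc'
  have hinf : ∀ N : ℕ, ∃ n, N < n ∧ cn n = c'.1 := fun N => by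
    obtain ⟨n, hn, hN⟩ := hc'.exists_gt N
    exact ⟨n, hN, congrArg Subtype.val hn⟩
  obtain ⟨b, hb⟩ := F.nonsingular c'.1 c'.2
  set x₀ := ∑ v ∈ c, v with hx₀
  have hnn : ∀ i, ∀ N : ℕ, ∃ n : ℕ, N < n ∧ 0 ≤ ((n : ℤ) + 1) * b.coord i x₀ + b.coord i w ∧
      (b i ∉ c'.1 → ((n : ℤ) + 1) * b.coord i x₀ + b.coord i w = 0) := by
    intro i N
    obtain ⟨n, hN, hn⟩ := hinf N
    have h1 := congrArg (b.coord i) (hx n)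
    rw [map_add, map_smul, smul_eq_mul, hn, sum_basis_eq hb] at h1
    refine ⟨n, hN, ?_⟩
    rw [h1]
    by_cases hi : b i ∈ c'.1
    · rw [if_pos hi]
      exact ⟨hsn n _ (hn ▸ hi), fun h => absurd hi h⟩
    · simp [hi]
  have h0 : ∀ i, b i ∉ c'.1 → b.coord i x₀ = 0 ∧ b.coord i w = 0 := by
    intro i hi
    obtain ⟨n, -, -, h1⟩ := hnn i 0
    obtain ⟨m, hm, -, h2⟩ := hnn i n
    have h1 := h1 hi
    have h2 := h2 hi
    have h3 : ((m : ℤ) - n) * b.coord i x₀ = 0 := by linarith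
    rcases mul_eq_zero.1 h3 with h | h
    · omega
    · rw [h] at h1
      exact ⟨h, by linarith⟩
  have hpos : ∀ i, 0 ≤ b.coord i x₀ := by
    intro i
    by_contra! hneg
    obtain ⟨n, hn, h1, -⟩ := hnn i (b.coord i w).natAbs
    have : ((n : ℤ) + 1) * b.coord i x₀ ≤ -((n : ℤ) + 1) := by nlinarith
    omega
  obtain ⟨s, hs, hs'⟩ := eq_sum_of_coord_eq_zero hb w fun i hi => (h0 i hi).2
  obtain ⟨t, ht, ht'⟩ := eq_sum_of_coord_eq_zero hb x₀ fun i hi => (h0 i hi).1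
  have ht0 : ∀ v ∈ c'.1, 0 ≤ t v := fun v hv => by
    obtain ⟨i, rfl⟩ := hb hv
    rw [ht']
    exact hpos i
  have hsum : ∑ v ∈ c, (fun _ => (1 : ℤ)) v • v = ∑ v ∈ c'.1, t v • v := by
    rw [← ht]
    simp [hx₀]
  refine ⟨c'.1, c'.2, fun v hv => ?_, s, fun v hv hvc => ?_, hs⟩
  · exact (F.mem_and_eq_of_sum_eq hc c'.2 (fun _ _ => zero_le_one) ht0 hsum hv zero_lt_one).1
  · have h1 : t v = 0 := by
      by_contra hne
      exact hvc (F.mem_and_eq_of_sum_eq c'.2 hc ht0 (fun _ _ => zero_le_one) hsum.symm hv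
        (lt_of_le_of_ne (ht0 v hv) (Ne.symm hne))).1
    obtain ⟨i, rfl⟩ := hb hv
    obtain ⟨n, -, h2, -⟩ := hnn i 0
    rw [ht'] at h1
    rw [hs']
    rw [h1] at h2
    linarith

/-- Every cone of a complete fan is a face of a cone of full dimension. -/
lemma exists_gens_superset {c : Finset (Fin d → ℤ)} (hc : c ∈ F.cones) :
    ∃ b : Module.Basis (Fin d) ℤ (Fin d → ℤ), c ⊆ gens b ∧ gens b ∈ F.cones := by
  classical
  obtain ⟨m, hcm, hm⟩ := (F.cones.finite_toSet).exists_le_maximal hc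
  obtain ⟨b, hb⟩ := F.nonsingular m hm.1
  have hmb : m = gens b := by
    refine Finset.Subset.antisymm (fun v hv => mem_gens.2 (hb hv)) fun v hv => ?_
    obtain ⟨i, rfl⟩ := mem_gens.1 hv
    by_contra hi
    obtain ⟨c', hc', hmc, s, -, hs⟩ := F.exists_star_sum hm.1 (b i)
    have h1 : c' = m := Finset.Subset.antisymm (hm.2 hc' hmc) hmc
    have h2 := congrArg (b.coord i) hs
    rw [h1, sum_basis_eq hb, if_neg hi] at h2
    simp at h2
  exact ⟨b, hmb ▸ hcm, hmb ▸ hm.1⟩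

lemma exists_basis_of_image_mem (v : Fin d → Fin d → ℤ) (hv : Function.Injective v)
    (h : Finset.univ.image v ∈ F.cones) :
    ∃ b : Module.Basis (Fin d) ℤ (Fin d → ℤ), ⇑b = v ∧ gens b ∈ F.cones := by
  obtain ⟨b, hb⟩ := F.nonsingular _ h
  have : ∀ j, ∃ i, b i = v j := fun j => hb (by simp)
  choose σ hσ using this
  have hσi : Function.Injective σ := fun i j hij => hv (by rw [← hσ, ← hσ, hij])
  refine ⟨b.reindex (Equiv.ofBijective σ (Finite.injective_iff_bijective.1 hσi)).symm, ?_, ?_⟩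
  · ext1 j
    simp [hσ]
  · convert h using 1
    ext w
    simp only [gens, Finset.mem_image]
    simp [hσ]

lemma mem_Gen_of_mem {c : Finset (Fin d → ℤ)} (hc : c ∈ F.cones) {v : Fin d → ℤ} (hv : v ∈ c) :
    v ∈ F.Gen :=
  F.face_mem c hc _ (Finset.singleton_subset_iff.2 hv)

/-- A generator of a ray is not a nonnegative combination of other generators of a cone. -/
lemma mem_of_mem_Gen {c : Finset (Fin d → ℤ)} (hc : c ∈ F.cones) {v : Fin d → ℤ} (hv : v ∈ F.Gen)
    {s : (Fin d → ℤ) → ℤ} (hs : ∀ w ∈ c, 0 ≤ s w) (h : v = ∑ w ∈ c, s w • w) : v ∈ c :=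
  (F.mem_and_eq_of_sum_eq (s := fun _ => 1) hv hc (fun _ _ => zero_le_one) hs
    (by simpa using h) (Finset.mem_singleton_self v) zero_lt_one).1

/-- The cone on the other side of a wall. -/
lemma exists_neighbour (b : Module.Basis (Fin d) ℤ (Fin d → ℤ)) (hb : gens b ∈ F.cones)
    (i : Fin d) : ∃ b' : Module.Basis (Fin d) ℤ (Fin d → ℤ), gens b' ∈ F.cones ∧
      (∀ j, j ≠ i → b' j = b j) ∧ b.coord i (b' i) = -1 := by
  classical
  have hc := F.face_mem _ hb _ (Finset.erase_subset (b i) (gens b))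
  obtain ⟨c', hc', hcc, s, hs, hsum⟩ := F.exists_star_sum hc (-b i)
  have hcoord : ∀ v ∈ (gens b).erase (b i), b.coord i v = 0 := by
    intro v hv
    obtain ⟨hvi, hv⟩ := Finset.mem_erase.1 hv
    obtain ⟨j, rfl⟩ := mem_gens.1 hv
    have : j ≠ i := fun h => hvi (h ▸ rfl)
    simp [this]
  obtain ⟨b'', hb''⟩ := F.nonsingular c' hc'
  have hcard : c'.card ≤ d := by
    have h1 : c' ⊆ gens b'' := fun v hv => mem_gens.2 (hb'' hv)
    refine (Finset.card_le_card h1).trans (Finset.card_image_le.trans (by simp))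
  have hcard' : ((gens b).erase (b i)).card = d - 1 := by
    rw [Finset.card_erase_of_mem (mem_gens.2 ⟨i, rfl⟩), gens,
      Finset.card_image_of_injective _ b.injective, Finset.card_univ, Fintype.card_fin]
  have hd := i.pos
  have h1 := congrArg (b.coord i) hsum
  rw [map_sum] at h1
  have h2 : ∃ x ∈ c', x ∉ (gens b).erase (b i) := by
    by_contra! h
    rw [Finset.sum_eq_zero fun v hv => by rw [map_smul, hcoord v (h v hv), smul_zero]] at h1
    simp at h1
  obtain ⟨x, hxc, hxe⟩ := h2
  have h3 : c' = insert x ((gens b).erase (b i)) := by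
    refine (Finset.eq_of_subset_of_card_le (Finset.insert_subset hxc hcc) ?_).symm
    rw [Finset.card_insert_of_notMem hxe, hcard']
    omega
  rw [h3, Finset.sum_insert hxe, Finset.sum_eq_zero (s := (gens b).erase (b i))
    fun v hv => by rw [map_smul, hcoord v hv, smul_zero]] at h1
  have h4 := hs x hxc hxe
  have h5 : s x * b.coord i x = -1 := by
    rw [map_smul, smul_eq_mul, add_zero] at h1
    simpa using h1.symm
  have h6 : b.coord i x = -1 := by
    rcases Int.eq_one_or_neg_one_of_mul_eq_neg_one h5 with h | h
    · rw [h] at h5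
      linarith
    · omega
  let v : Fin d → Fin d → ℤ := fun j => if j = i then x else b j
  have hv : Function.Injective v := by
    intro j l hjl
    simp only [v] at hjl
    split_ifs at hjl with h h' h'
    · rw [h, h']
    · exact absurd (Finset.mem_erase.2 ⟨fun h => h' (b.injective h), mem_gens.2 ⟨l, rfl⟩⟩)
        (hjl ▸ hxe)
    · exact absurd (Finset.mem_erase.2 ⟨fun h'' => h (b.injective h''), mem_gens.2 ⟨j, rfl⟩⟩)
        (hjl ▸ hxe)
    · exact b.injective hjl
  have himg : Finset.univ.image v = c' := by
    rw [h3]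
    ext w
    simp only [Finset.mem_image, Finset.mem_univ, true_and, Finset.mem_insert, Finset.mem_erase,
      mem_gens, v]
    constructor
    · rintro ⟨j, rfl⟩
      by_cases hj : j = i
      · simp [hj]
      · exact Or.inr ⟨by simpa [hj] using fun h => hj (b.injective h), j, by simp [hj]⟩
    · rintro (rfl | ⟨hw, j, rfl⟩)
      · exact ⟨i, by simp⟩
      · exact ⟨j, if_neg fun h => hw (congrArg b h)⟩
  obtain ⟨b', hb', hb'F⟩ := F.exists_basis_of_image_mem v hv (himg ▸ hc')
  refine ⟨b', hb'F, fun j hj => ?_, ?_⟩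
  · rw [hb']; simp [v, hj]
  · rw [hb']; simpa [v] using h6

end SmoothCompleteFan
/-! ### The Fano condition for even index -/

namespace SmoothCompleteFan

variable {d : ℕ} (F : SmoothCompleteFan d)

/-- The combinatorial form of the Fano condition for a variety of even index: the functional that is
`1` on the generators of a cone of full dimension is odd and negative at all other generators of
rays. -/
def IsFanoEven : Prop :=
  ∀ b : Module.Basis (Fin d) ℤ (Fin d → ℤ), gens b ∈ F.cones → ∀ v ∈ F.Gen,
    Odd (coordSum b v) ∧ (v ∉ gens b → coordSum b v ≤ -1)

variable {F}

lemma coordSum_of_wall {b b' : Module.Basis (Fin d) ℤ (Fin d → ℤ)} {i : Fin d}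
    (hij : ∀ j, j ≠ i → b' j = b j) (hi : b.coord i (b' i) = -1) (v : Fin d → ℤ) :
    coordSum b' v = coordSum b v + (coordSum b (b' i) - 1) * b.coord i v := by
  have : coordSum b' = coordSum b + (coordSum b (b' i) - 1) • b.coord i := b'.ext fun j => by
    rw [coordSum_basis, LinearMap.add_apply, LinearMap.smul_apply, smul_eq_mul]
    by_cases hj : j = i
    · rw [hj, hi]; ring
    · rw [hij j hj, coordSum_basis, Module.Basis.coord_apply, Module.Basis.repr_self,
        Finsupp.single_eq_of_ne (Ne.symm hj)]
      ring
  rw [this, LinearMap.add_apply, LinearMap.smul_apply, smul_eq_mul]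

/-- A generator of a ray that does not belong to a given cone of full dimension has a negative
coordinate with respect to this cone. -/
lemma exists_coord_neg {b : Module.Basis (Fin d) ℤ (Fin d → ℤ)} (hb : gens b ∈ F.cones)
    {v : Fin d → ℤ} (hv : v ∈ F.Gen) (hvb : v ∉ gens b) : ∃ i, b.coord i v < 0 := by
  by_contra! h
  have hsub : ↑(gens b) ⊆ Set.range b := fun w hw => mem_gens.1 hw
  obtain ⟨s, hs, hs'⟩ := eq_sum_of_coord_eq_zero hsub v fun i hi => absurd (mem_gens.2 ⟨i, rfl⟩) hi
  refine hvb (F.mem_of_mem_Gen hb hv (fun w hw => ?_) hs)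
  obtain ⟨i, rfl⟩ := mem_gens.1 hw
  rw [hs']
  exact h i

/-- Concavity across the walls implies strict concavity: crossing a wall would increase the value
`1` at a further generator. -/
lemma isFanoEven_of (h1 : ∀ b b' : Module.Basis (Fin d) ℤ (Fin d → ℤ), gens b ∈ F.cones →
      gens b' ∈ F.cones → ∀ v ∈ gens b', coordSum b v ≤ 1 ∧ Odd (coordSum b v))
    (h2 : ∀ b b' : Module.Basis (Fin d) ℤ (Fin d → ℤ), gens b ∈ F.cones → gens b' ∈ F.cones →
      ∀ i, (∀ j, j ≠ i → b' j = b j) → b.coord i (b' i) = -1 → coordSum b (b' i) ≠ 1) :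
    F.IsFanoEven := by
  intro b hb v hv
  obtain ⟨b₁, hvb₁, hb₁⟩ := F.exists_gens_superset hv
  rw [Finset.singleton_subset_iff] at hvb₁
  obtain ⟨hle, hodd⟩ := h1 b b₁ hb hb₁ v hvb₁
  refine ⟨hodd, fun hvb => ?_⟩
  suffices coordSum b v ≠ 1 by
    rcases hodd with ⟨r, hr⟩
    omega
  intro hone
  obtain ⟨i, hi⟩ := exists_coord_neg hb hv hvb
  obtain ⟨b', hb', hij, hii⟩ := F.exists_neighbour b hb i
  have h3 := coordSum_of_wall hij hii v
  have h4 := (h1 b' b₁ hb' hb₁ v hvb₁).1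
  have h5 := h2 b b' hb hb' i hij hii
  have h6 := (h1 b b' hb hb' _ (mem_gens.2 ⟨i, rfl⟩)).1
  have h7 : coordSum b (b' i) - 1 < 0 := by omega
  nlinarith

/-- A generator of a ray at which the functional of a cone takes the value `-1` spans a cone with
each facet of which it is on the other side. -/
lemma IsFanoEven.flip_basis (hF : F.IsFanoEven)
    {b : Module.Basis (Fin d) ℤ (Fin d → ℤ)} (hb : gens b ∈ F.cones)
    {v : Fin d → ℤ} (hv : v ∈ F.Gen) (hone : coordSum b v = -1) {i : Fin d}
    (hi : b.coord i v < 0) :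
    b.coord i v = -1 ∧ ∃ b' : Module.Basis (Fin d) ℤ (Fin d → ℤ), gens b' ∈ F.cones ∧
      (∀ j, j ≠ i → b' j = b j) ∧ b' i = v := by
  obtain ⟨b', hb', hij, hii⟩ := F.exists_neighbour b hb i
  have hx := F.mem_Gen_of_mem hb' (mem_gens.2 ⟨i, rfl⟩)
  have h1 : b' i ∉ gens b := fun h => by
    obtain ⟨j, hj⟩ := mem_gens.1 h
    rw [← hj, Module.Basis.coord_apply, Module.Basis.repr_self, Finsupp.single_apply] at hii
    split_ifs at hii
  have h2 := (hF b hb _ hx).2 h1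
  have h3 := coordSum_of_wall hij hii v
  rw [hone] at h3
  have h4 : v ∈ gens b' := by
    by_contra h
    have := (hF b' hb' v hv).2 h
    nlinarith
  obtain ⟨j, rfl⟩ := mem_gens.1 h4
  rw [coordSum_basis] at h3
  by_cases hj : j = i
  · subst hj
    exact ⟨hii, b', hb', hij, rfl⟩
  · rw [hij j hj, Module.Basis.coord_apply, Module.Basis.repr_self, Finsupp.single_apply] at hi
    split_ifs at hi
    · omega

end SmoothCompleteFan

/-! ### Cones given by lists of generators -/

namespace SmoothCompleteFan

section Cone

variable {d : ℕ} {F : SmoothCompleteFan d}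

/-- The vectors in the list `l` span a cone of the fan. -/
def Cone (F : SmoothCompleteFan d) (l : List (Fin d → ℤ)) : Prop := l.toFinset ∈ F.cones

lemma Cone.of_subset {l l' : List (Fin d → ℤ)} (h : F.Cone l) (hl : l' ⊆ l) : F.Cone l' :=
  F.face_mem _ h _ fun v hv => by simpa using hl (by simpa using hv)

lemma Cone.mem_Gen {l : List (Fin d → ℤ)} (h : F.Cone l) {v : Fin d → ℤ} (hv : v ∈ l) :
    v ∈ F.Gen := F.mem_Gen_of_mem h (by simpa using hv)

/-- If two sets of generators span cones and have the same sum, then they are equal. -/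
lemma Cone.mem_of_sum_eq {l l' : List (Fin d → ℤ)} (h : F.Cone l) (h' : F.Cone l')
    (hl : l.Nodup) (hl' : l'.Nodup) (hsum : l.sum = l'.sum) {v : Fin d → ℤ} (hv : v ∈ l) :
    v ∈ l' := by
  have := F.mem_and_eq_of_sum_eq h h' (s := fun _ => 1) (s' := fun _ => 1)
    (fun _ _ => zero_le_one) (fun _ _ => zero_le_one) (by
      simp only [one_smul]
      rw [List.sum_toFinset _ hl, List.sum_toFinset _ hl']
      simpa using hsum) (v := v) (by simpa using hv) zero_lt_one
  simpa using this.1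

lemma Cone.exists_basis {l : List (Fin d → ℤ)} (h : F.Cone l) (hl : l.Nodup) (hd : l.length = d) :
    ∃ b : Module.Basis (Fin d) ℤ (Fin d → ℤ), gens b ∈ F.cones ∧ gens b = l.toFinset ∧
      ∀ i : Fin d, b i = l.get (i.cast hd.symm) := by
  have himg : Finset.univ.image (fun i : Fin d => l.get (i.cast hd.symm)) = l.toFinset := by
    ext v
    simp only [Finset.mem_image, Finset.mem_univ, true_and, List.mem_toFinset, List.mem_iff_get]
    exact ⟨fun ⟨i, hi⟩ => ⟨_, hi⟩, fun ⟨i, hi⟩ => ⟨i.cast hd, hi⟩⟩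
  obtain ⟨b, hb, hbF⟩ := F.exists_basis_of_image_mem (fun i => l.get (i.cast hd.symm))
    (fun i j hij => by simpa using hl.injective_get hij) (himg ▸ h)
  refine ⟨b, hbF, ?_, fun i => by rw [hb]⟩
  rw [← himg, gens, hb]

/-- If two cones share the face spanned by `l`, then a generator `v` of one of them does not lie in
the interior of the other one modulo the span of this face. -/
lemma Cone.mem_of_star {l : List (Fin d → ℤ)} {p q v : Fin d → ℤ} (h : F.Cone (p :: q :: l))
    (h' : F.Cone (v :: l)) (hn : (p :: q :: l).Nodup) (α β : ℤ)
    (s : (Fin d → ℤ) → ℤ) (hv : v = α • p + β • q + (l.map fun x => s x • x).sum) (hα : 0 < α)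
    (hβ : 0 ≤ β) : p = v := by
  classical
  obtain ⟨h1, h2, hn⟩ : p ∉ q :: l ∧ q ∉ l ∧ l.Nodup := by
    simpa [List.nodup_cons, and_assoc] using hn
  simp only [List.mem_cons, not_or] at h1
  let r : (Fin d → ℤ) → ℤ := fun x => if x = p then α else if x = q then β else s x
  have hr : ∀ x ∈ l, r x = s x := fun x hx => by
    have h3 : x ≠ p := fun h => h1.2 (h ▸ hx)
    have h4 : x ≠ q := fun h => h2 (h ▸ hx)
    simp [r, h3, h4]
  have hrp : r p = α := by simp [r]
  have hrq : r q = β := by simp [r, Ne.symm h1.1]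
  have := F.mem_and_eq_of_sum_eq_star h h' (e := l.toFinset) (s := r)
    (s' := fun x => if x = v then 1 else 0) (fun x hx => by simp_all) (fun x hx => by simp_all)
    (fun x hx hxl => by
      simp only [List.toFinset_cons, Finset.mem_insert, hxl, or_false] at hx
      rcases hx with rfl | rfl
      · rw [hrp]; exact hα.le
      · rw [hrq]; exact hβ)
    (fun x _ _ => by split_ifs <;> simp) (by
      rw [Finset.sum_eq_single (s := (v :: l).toFinset) v (fun x _ hx => by simp [hx])
        (fun h => by simp at h), List.sum_toFinset _ (by simp [h1, h2, hn])]
      rw [List.map_cons, List.map_cons, List.sum_cons, List.sum_cons, hrp, hrq,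
        List.map_congr_left fun x hx => by rw [hr x hx], if_pos rfl, one_smul, ← add_assoc]
      exact hv.symm) (v := p) (by simp) (by simpa using h1.2) (by rw [hrp]; exact hα)
  have h3 := this.1
  simp only [List.toFinset_cons, Finset.mem_insert, List.mem_toFinset, h1.2, or_false] at h3
  exact h3

end Cone

end SmoothCompleteFan
/-! ### Coordinates in rank five -/

namespace SmoothCompleteFan

/-- The vector with the given coordinates with respect to a lattice basis of rank five. -/
noncomputable def vec (b : Module.Basis (Fin 5) ℤ (Fin 5 → ℤ)) (a₀ a₁ a₂ a₃ a₄ : ℤ) : Fin 5 → ℤ :=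
  a₀ • b 0 + a₁ • b 1 + a₂ • b 2 + a₃ • b 3 + a₄ • b 4

/-- The functional with the given values on a lattice basis of rank five. -/
noncomputable def phi (b : Module.Basis (Fin 5) ℤ (Fin 5 → ℤ)) (c₀ c₁ c₂ c₃ c₄ : ℤ) :
    Module.Dual ℤ (Fin 5 → ℤ) :=
  c₀ • b.coord 0 + c₁ • b.coord 1 + c₂ • b.coord 2 + c₃ • b.coord 3 + c₄ • b.coord 4

section vec

variable (b : Module.Basis (Fin 5) ℤ (Fin 5 → ℤ))

lemma coord_vec (a₀ a₁ a₂ a₃ a₄ : ℤ) (i : Fin 5) :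
    b.coord i (vec b a₀ a₁ a₂ a₃ a₄) = ![a₀, a₁, a₂, a₃, a₄] i := by
  simp only [vec, map_add, map_smul, Module.Basis.coord_apply, Module.Basis.repr_self,
    Finsupp.single_apply, smul_eq_mul]
  fin_cases i <;> simp

lemma phi_vec (c₀ c₁ c₂ c₃ c₄ a₀ a₁ a₂ a₃ a₄ : ℤ) : phi b c₀ c₁ c₂ c₃ c₄ (vec b a₀ a₁ a₂ a₃ a₄) =
    c₀ * a₀ + c₁ * a₁ + c₂ * a₂ + c₃ * a₃ + c₄ * a₄ := by
  simp [phi, LinearMap.add_apply, LinearMap.smul_apply, coord_vec, -Module.Basis.coord_apply]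

lemma vec_inj {a₀ a₁ a₂ a₃ a₄ c₀ c₁ c₂ c₃ c₄ : ℤ} : vec b a₀ a₁ a₂ a₃ a₄ = vec b c₀ c₁ c₂ c₃ c₄ ↔
    a₀ = c₀ ∧ a₁ = c₁ ∧ a₂ = c₂ ∧ a₃ = c₃ ∧ a₄ = c₄ := by
  refine ⟨fun h => ?_, fun ⟨h0, h1, h2, h3, h4⟩ => by rw [h0, h1, h2, h3, h4]⟩
  have := fun i => congrArg (b.coord i) h
  simp only [coord_vec] at this
  exact ⟨this 0, this 1, this 2, this 3, this 4⟩

lemma exists_eq_vec (v : Fin 5 → ℤ) : ∃ a₀ a₁ a₂ a₃ a₄, v = vec b a₀ a₁ a₂ a₃ a₄ := by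
  refine ⟨b.repr v 0, b.repr v 1, b.repr v 2, b.repr v 3, b.repr v 4, ?_⟩
  conv_lhs => rw [← b.sum_repr v]
  rw [Fin.sum_univ_five, vec]

lemma coordSum_eq_phi : coordSum b = phi b 1 1 1 1 1 := by
  simp [coordSum, phi, Fin.sum_univ_five]

/-- The basis vectors, as a list. -/
noncomputable def basisList : List (Fin 5 → ℤ) :=
  [vec b 1 0 0 0 0, vec b 0 1 0 0 0, vec b 0 0 1 0 0, vec b 0 0 0 1 0, vec b 0 0 0 0 1]

lemma basisList_toFinset : (basisList b).toFinset = gens b := by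
  ext v
  simp [basisList, vec, mem_gens, Fin.exists_fin_succ, eq_comm]

/-- A list of five vectors that span a cone is a lattice basis, and coordinates with respect to it
can be computed from coordinates with respect to another basis. -/
lemma Cone.exists_vec {F : SmoothCompleteFan 5} {p q r s t : Fin 5 → ℤ} (h : F.Cone [p, q, r, s, t])
    (hn : [p, q, r, s, t].Nodup) : ∃ b' : Module.Basis (Fin 5) ℤ (Fin 5 → ℤ),
      F.Cone (basisList b') ∧ (∀ a₀ a₁ a₂ a₃ a₄, vec b' a₀ a₁ a₂ a₃ a₄ =
        a₀ • p + a₁ • q + a₂ • r + a₃ • s + a₄ • t) ∧ ∀ j, b' j = [p, q, r, s, t].get j := by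
  obtain ⟨b', hb', -, hi⟩ := h.exists_basis hn rfl
  refine ⟨b', ?_, fun a₀ a₁ a₂ a₃ a₄ => ?_, hi⟩
  · rw [Cone, basisList_toFinset]; exact hb'
  · rw [vec, hi, hi, hi, hi, hi]; rfl

end vec

variable {F : SmoothCompleteFan 5} {b : Module.Basis (Fin 5) ℤ (Fin 5 → ℤ)}

/-- The value of the functional of a cone of full dimension at the other generators of rays. -/
lemma IsFanoEven.phi_le (hF : F.IsFanoEven) {l : List (Fin 5 → ℤ)}
    {c₀ c₁ c₂ c₃ c₄ a₀ a₁ a₂ a₃ a₄ : ℤ} (h : F.Cone l)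
    (hv : vec b a₀ a₁ a₂ a₃ a₄ ∈ F.Gen) (hl : l.Nodup ∧ l.length = 5)
    (hc : ∀ v ∈ l, phi b c₀ c₁ c₂ c₃ c₄ v = 1) (hvl : vec b a₀ a₁ a₂ a₃ a₄ ∉ l) :
    c₀ * a₀ + c₁ * a₁ + c₂ * a₂ + c₃ * a₃ + c₄ * a₄ ≤ -1 ∧
      (c₀ * a₀ + c₁ * a₁ + c₂ * a₂ + c₃ * a₃ + c₄ * a₄) % 2 = 1 := by
  obtain ⟨b', hb', hg, hi⟩ := h.exists_basis hl.1 hl.2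
  have h1 : coordSum b' = phi b c₀ c₁ c₂ c₃ c₄ := b'.ext fun i => by
    rw [coordSum_basis, hc _ (by rw [hi]; exact List.get_mem _ _)]
  have h2 := hF b' hb' _ hv
  rw [h1, hg, List.mem_toFinset, phi_vec] at h2
  exact ⟨h2.2 hvl, Int.odd_iff.1 h2.1⟩

/-- A generator of a ray at which the functional of a cone takes the value `-1` spans a cone with
each facet of which it is on the other side. -/
lemma IsFanoEven.flip (hF : F.IsFanoEven) {p q r s t v : Fin 5 → ℤ} (h : F.Cone [p, q, r, s, t])
    (hn : [p, q, r, s, t].Nodup) (hv : v ∈ F.Gen) (α β γ δ ε : ℤ)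
    (hsum : v = α • p + β • q + γ • r + δ • s + ε • t) (hone : α + β + γ + δ + ε = -1)
    (hα : α < 0) : α = -1 ∧ F.Cone [v, q, r, s, t] := by
  obtain ⟨b', hb', hvec, hbasis⟩ := h.exists_vec hn
  rw [Cone, basisList_toFinset] at hb'
  rw [← hvec] at hsum
  obtain ⟨h1, b₂, hb₂, hij, hi⟩ := hF.flip_basis hb' hv (i := 0) (by
    rw [coordSum_eq_phi, hsum, phi_vec]; omega) (by rw [hsum, coord_vec]; exact hα)
  rw [hsum, coord_vec] at h1
  refine ⟨h1, ?_⟩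
  have : [v, q, r, s, t].toFinset = gens b₂ := by
    rw [← basisList_toFinset, basisList]
    simp only [vec, one_smul, zero_smul, add_zero, zero_add, hi]
    rw [hij 1 (by decide), hij 2 (by decide), hij 3 (by decide), hij 4 (by decide), hbasis, hbasis,
      hbasis, hbasis]
    rfl
  rw [Cone, this]
  exact hb₂

lemma Cone.exists_neighbour {p q r s t : Fin 5 → ℤ} (h : F.Cone [p, q, r, s, t])
    (hn : [p, q, r, s, t].Nodup) : ∃ (v : Fin 5 → ℤ) (β γ δ ε : ℤ), F.Cone [v, q, r, s, t] ∧
      v = (-1 : ℤ) • p + β • q + γ • r + δ • s + ε • t := by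
  obtain ⟨b', hb', hvec, hbasis⟩ := h.exists_vec hn
  rw [Cone, basisList_toFinset] at hb'
  obtain ⟨b₂, hb₂, hij, hi⟩ := F.exists_neighbour b' hb' 0
  obtain ⟨a₀, β, γ, δ, ε, hv⟩ := exists_eq_vec b' (b₂ 0)
  rw [hv, coord_vec] at hi
  obtain rfl : a₀ = -1 := hi
  refine ⟨b₂ 0, β, γ, δ, ε, ?_, by rw [hv, hvec]⟩
  have : [b₂ 0, q, r, s, t].toFinset = gens b₂ := by
    rw [← basisList_toFinset, basisList]
    simp only [vec, one_smul, zero_smul, add_zero, zero_add]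
    rw [hij 1 (by decide), hij 2 (by decide), hij 3 (by decide), hij 4 (by decide), hbasis, hbasis,
      hbasis, hbasis]
    rfl
  rw [Cone, this]
  exact hb₂

end SmoothCompleteFan
/-! ### Bases adapted to a primitive collection -/

namespace SmoothCompleteFan

/-- The first three elements of the basis `b`, together with minus their sum, form a primitive
collection of the fan, and `b` spans a cone. In comments, the elements of `b` are called
`x₀, x₁, x₂, y, z`, and `x₃` stands for `-x₀ - x₁ - x₂`. -/
structure Adapted (F : SmoothCompleteFan 5) (b : Module.Basis (Fin 5) ℤ (Fin 5 → ℤ)) : Prop where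
  cone : F.Cone (basisList b)
  cone₀ : F.Cone [vec b 0 1 0 0 0, vec b 0 0 1 0 0, vec b (-1) (-1) (-1) 0 0]
  cone₁ : F.Cone [vec b 1 0 0 0 0, vec b 0 0 1 0 0, vec b (-1) (-1) (-1) 0 0]
  cone₂ : F.Cone [vec b 1 0 0 0 0, vec b 0 1 0 0 0, vec b (-1) (-1) (-1) 0 0]

namespace Adapted

variable {F : SmoothCompleteFan 5} {b : Module.Basis (Fin 5) ℤ (Fin 5 → ℤ)}

lemma mem_Gen (h : F.Adapted b) : vec b (-1) (-1) (-1) 0 0 ∈ F.Gen := h.cone₀.mem_Gen (by simp)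

/-- An adapted basis stays adapted when its first two elements are interchanged. This and the next
two lemmas generate all the symmetries of `x₀, x₁, x₂` and of `y, z`. -/
lemma swap₀₁ (h : F.Adapted b) : ∃ b', F.Adapted b' ∧
    ∀ a₀ a₁ a₂ a₃ a₄, vec b' a₀ a₁ a₂ a₃ a₄ = vec b a₁ a₀ a₂ a₃ a₄ := by
  obtain ⟨b', h1, h2, -⟩ := (h.cone.of_subset (l' := [vec b 0 1 0 0 0, vec b 1 0 0 0 0,
    vec b 0 0 1 0 0, vec b 0 0 0 1 0, vec b 0 0 0 0 1]) (by simp [basisList])).exists_vec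
    (by simp [vec_inj])
  have h3 : ∀ a₀ a₁ a₂ a₃ a₄, vec b' a₀ a₁ a₂ a₃ a₄ = vec b a₁ a₀ a₂ a₃ a₄ := fun _ _ _ _ _ => by
    rw [h2]
    simp only [vec]
    module
  refine ⟨b', ⟨h1, ?_, ?_, ?_⟩, h3⟩ <;> simp only [h3]
  · exact h.cone₁
  · exact h.cone₀
  · exact h.cone₂.of_subset (by simp)

lemma swap₁₂ (h : F.Adapted b) : ∃ b', F.Adapted b' ∧
    ∀ a₀ a₁ a₂ a₃ a₄, vec b' a₀ a₁ a₂ a₃ a₄ = vec b a₀ a₂ a₁ a₃ a₄ := by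
  obtain ⟨b', h1, h2, -⟩ := (h.cone.of_subset (l' := [vec b 1 0 0 0 0, vec b 0 0 1 0 0,
    vec b 0 1 0 0 0, vec b 0 0 0 1 0, vec b 0 0 0 0 1]) (by simp [basisList])).exists_vec
    (by simp [vec_inj])
  have h3 : ∀ a₀ a₁ a₂ a₃ a₄, vec b' a₀ a₁ a₂ a₃ a₄ = vec b a₀ a₂ a₁ a₃ a₄ := fun _ _ _ _ _ => by
    rw [h2]
    simp only [vec]
    module
  refine ⟨b', ⟨h1, ?_, ?_, ?_⟩, h3⟩ <;> simp only [h3]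
  · exact h.cone₀.of_subset (by simp)
  · exact h.cone₂
  · exact h.cone₁

lemma swap₃₄ (h : F.Adapted b) : ∃ b', F.Adapted b' ∧
    ∀ a₀ a₁ a₂ a₃ a₄, vec b' a₀ a₁ a₂ a₃ a₄ = vec b a₀ a₁ a₂ a₄ a₃ := by
  obtain ⟨b', h1, h2, -⟩ := (h.cone.of_subset (l' := [vec b 1 0 0 0 0, vec b 0 1 0 0 0,
    vec b 0 0 1 0 0, vec b 0 0 0 0 1, vec b 0 0 0 1 0]) (by simp [basisList])).exists_vec
    (by simp [vec_inj])
  have h3 : ∀ a₀ a₁ a₂ a₃ a₄, vec b' a₀ a₁ a₂ a₃ a₄ = vec b a₀ a₁ a₂ a₄ a₃ := fun _ _ _ _ _ => by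
    rw [h2]
    simp only [vec]
    module
  refine ⟨b', ⟨h1, ?_, ?_, ?_⟩, h3⟩ <;> simp only [h3]
  · exact h.cone₀
  · exact h.cone₁
  · exact h.cone₂

/-- The generator `y` may be replaced by another one in the star of the first three generators. -/
lemma replace₄ (h : F.Adapted b) {f₀ f₁ f₂ f₃ f₄ : ℤ} (h4 : f₄ ≠ 0)
    (hc : F.Cone [vec b f₀ f₁ f₂ f₃ f₄, vec b 1 0 0 0 0, vec b 0 1 0 0 0, vec b 0 0 1 0 0,
      vec b 0 0 0 1 0]) : ∃ b', F.Adapted b' ∧ ∀ a₀ a₁ a₂ a₃ a₄, vec b' a₀ a₁ a₂ a₃ a₄ =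
        vec b (a₀ + a₄ * f₀) (a₁ + a₄ * f₁) (a₂ + a₄ * f₂) (a₃ + a₄ * f₃) (a₄ * f₄) := by
  obtain ⟨b', h1, h2, -⟩ := (hc.of_subset (l' := [vec b 1 0 0 0 0, vec b 0 1 0 0 0,
    vec b 0 0 1 0 0, vec b 0 0 0 1 0, vec b f₀ f₁ f₂ f₃ f₄]) (by simp)).exists_vec
    (by simp [vec_inj, Ne.symm h4])
  have h3 : ∀ a₀ a₁ a₂ a₃ a₄, vec b' a₀ a₁ a₂ a₃ a₄ =
      vec b (a₀ + a₄ * f₀) (a₁ + a₄ * f₁) (a₂ + a₄ * f₂) (a₃ + a₄ * f₃) (a₄ * f₄) :=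
    fun _ _ _ _ _ => by
      rw [h2]
      simp only [vec]
      module
  refine ⟨b', ⟨h1, ?_, ?_, ?_⟩, h3⟩ <;> simp only [h3, zero_mul, add_zero]
  · exact h.cone₀
  · exact h.cone₁
  · exact h.cone₂

/-- The neighbours across the walls that contain the first three generators. -/
lemma exists_neighbour₃ (h : F.Adapted b) : ∃ f₀ f₁ f₂ e : ℤ,
    F.Cone [vec b f₀ f₁ f₂ (-1) e, vec b 1 0 0 0 0, vec b 0 1 0 0 0, vec b 0 0 1 0 0,
      vec b 0 0 0 0 1] := by
  obtain ⟨v, f₀, f₁, f₂, e, hc, hv⟩ := (h.cone.of_subset (l' := [vec b 0 0 0 1 0, vec b 1 0 0 0 0,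
    vec b 0 1 0 0 0, vec b 0 0 1 0 0, vec b 0 0 0 0 1]) (by simp [basisList])).exists_neighbour
    (by simp [vec_inj])
  have : v = vec b f₀ f₁ f₂ (-1) e := by
    rw [hv]
    simp only [vec]
    module
  exact ⟨f₀, f₁, f₂, e, this ▸ hc⟩

lemma exists_neighbour₄ (h : F.Adapted b) : ∃ f₀ f₁ f₂ e : ℤ,
    F.Cone [vec b f₀ f₁ f₂ e (-1), vec b 1 0 0 0 0, vec b 0 1 0 0 0, vec b 0 0 1 0 0,
      vec b 0 0 0 1 0] := by
  obtain ⟨b', hb', hvec⟩ := h.swap₃₄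
  obtain ⟨f₀, f₁, f₂, e, hc⟩ := hb'.exists_neighbour₃
  simp only [hvec] at hc
  exact ⟨f₀, f₁, f₂, e, hc⟩

/-- Modulo the span of the first three generators, the star of their cone is a fan in the plane;
a vector in the interior of a cone of this fan is not a generator. -/
lemma eq_of_star {f₀ f₁ f₂ f₃ f₄ g₀ g₁ g₂ g₃ g₄ p₀ p₁ p₂ p₃ p₄ α β : ℤ}
    (hc : F.Cone [vec b p₀ p₁ p₂ p₃ p₄, vec b f₀ f₁ f₂ f₃ f₄, vec b 1 0 0 0 0, vec b 0 1 0 0 0,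
      vec b 0 0 1 0 0])
    (hc' : F.Cone [vec b g₀ g₁ g₂ g₃ g₄, vec b 1 0 0 0 0, vec b 0 1 0 0 0,
      vec b 0 0 1 0 0]) (hn : p₃ ≠ f₃ ∨ p₄ ≠ f₄) (hp : p₃ ≠ 0 ∨ p₄ ≠ 0) (hf : f₃ ≠ 0 ∨ f₄ ≠ 0)
    (h3 : g₃ = α * p₃ + β * f₃) (h4 : g₄ = α * p₄ + β * f₄) (hα : 0 < α)
    (hβ : 0 ≤ β) : vec b p₀ p₁ p₂ p₃ p₄ = vec b g₀ g₁ g₂ g₃ g₄ := by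
  obtain ⟨s, hs⟩ : ∃ s : (Fin 5 → ℤ) → ℤ, ∀ x, s x =
    g₀ * b.coord 0 x + g₁ * b.coord 1 x + g₂ * b.coord 2 x
    - α * (p₀ * b.coord 0 x + p₁ * b.coord 1 x + p₂ * b.coord 2 x)
    - β * (f₀ * b.coord 0 x + f₁ * b.coord 1 x + f₂ * b.coord 2 x) := ⟨_, fun _ => rfl⟩
  refine hc.mem_of_star hc' ?_ α β s ?_ hα hβ
  · simp only [List.nodup_cons, List.mem_cons, vec_inj, List.not_mem_nil, or_false]
    refine ⟨?_, ?_, ?_⟩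
    · omega
    · omega
    · simp
  · have hs₀ : s (vec b 1 0 0 0 0) = g₀ - α * p₀ - β * f₀ := by
      simp [hs, coord_vec, -Module.Basis.coord_apply]
    have hs₁ : s (vec b 0 1 0 0 0) = g₁ - α * p₁ - β * f₁ := by
      simp [hs, coord_vec, -Module.Basis.coord_apply]
    have hs₂ : s (vec b 0 0 1 0 0) = g₂ - α * p₂ - β * f₂ := by
      simp [hs, coord_vec, -Module.Basis.coord_apply]
    simp only [List.map_cons, List.map_nil, List.sum_cons, List.sum_nil, hs₀, hs₁, hs₂]
    simp only [vec, h3, h4]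
    module

end Adapted
end SmoothCompleteFan
/-! ### Strict concavity at an adapted basis -/

namespace SmoothCompleteFan
namespace Adapted

variable {F : SmoothCompleteFan 5} {b : Module.Basis (Fin 5) ℤ (Fin 5 → ℤ)}

/-- The condition `IsFanoEven` for the cone spanned by `b` itself, at a generator outside this
cone. -/
lemma sum_le (hF : F.IsFanoEven) (h : F.Adapted b) {f₀ f₁ f₂ f₃ f₄ : ℤ}
    (hv : vec b f₀ f₁ f₂ f₃ f₄ ∈ F.Gen) (hneg : f₃ < 0 ∨ f₄ < 0) :
    f₀ + f₁ + f₂ + f₃ + f₄ ≤ -1 ∧ (f₀ + f₁ + f₂ + f₃ + f₄) % 2 = 1 := by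
  have := hF.phi_le (b := b) (c₀ := 1) (c₁ := 1) (c₂ := 1) (c₃ := 1) (c₄ := 1) h.cone hv
    ⟨by simp [basisList, vec_inj], rfl⟩ (by simp [basisList, phi_vec])
    (by simp only [basisList, List.mem_cons, vec_inj, List.not_mem_nil, or_false]; omega)
  simpa only [one_mul] using this

/-- If three generators of rays have the same sum as the generators `x₀, x₁, x₃` of a cone, then the
functional of a cone that contains the latter ones is `1` at each of them, so that they span a cone,
too, and are the same generators. -/
lemma false_of_sum_eq (hF : F.IsFanoEven) (h : F.Adapted b) {p q r : Fin 5 → ℤ} (hp : p ∈ F.Gen)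
    (hq : q ∈ F.Gen) (hr : r ∈ F.Gen) (hn : [p, q, r].Nodup)
    (h0 : vec b 1 0 0 0 0 ∉ [p, q, r]) (hsum : p + q + r = vec b 0 0 (-1) 0 0) : False := by
  obtain ⟨b', hsub, hb'⟩ := F.exists_gens_superset h.cone₂
  have hone : ∀ v ∈ [vec b 1 0 0 0 0, vec b 0 1 0 0 0, vec b (-1) (-1) (-1) 0 0],
      coordSum b' v = 1 := fun v hv => by
    obtain ⟨i, rfl⟩ := mem_gens.1 (hsub (List.mem_toFinset.2 hv))
    exact coordSum_basis b' i
  have hle : ∀ v ∈ F.Gen, coordSum b' v ≤ 1 ∧ (coordSum b' v = 1 → v ∈ gens b') := fun v hv => by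
    by_cases hvb : v ∈ gens b'
    · obtain ⟨i, rfl⟩ := mem_gens.1 hvb
      exact ⟨(coordSum_basis b' i).le, fun _ => hvb⟩
    · have := (hF b' hb' v hv).2 hvb
      exact ⟨by omega, by omega⟩
  have hs : vec b 1 0 0 0 0 + vec b 0 1 0 0 0 + vec b (-1) (-1) (-1) 0 0 = p + q + r := by
    rw [hsum]
    simp only [vec]
    module
  have h1 := congrArg (coordSum b') hs
  simp only [map_add] at h1
  rw [hone _ (by simp), hone _ (by simp), hone _ (by simp)] at h1
  have h2 := hle p hp
  have h3 := hle q hq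
  have h4 := hle r hr
  have hc : F.Cone [p, q, r] := F.face_mem _ hb' _ fun v hv => by
    simp only [List.mem_toFinset, List.mem_cons, List.not_mem_nil, or_false] at hv
    rcases hv with rfl | rfl | rfl
    · exact h2.2 (by omega)
    · exact h3.2 (by omega)
    · exact h4.2 (by omega)
  exact h0 (h.cone₂.mem_of_sum_eq hc (by simp [vec_inj]) hn
    (by simpa [add_assoc] using hs) (by simp))

/-! ### A neighbour of the form `x₃ + y + z`

The possible generators on the other side of the wall opposite to `x₀` are called of type one, two
and three according to the number of elements of `x₀, x₁, x₂` that occur in them with coefficient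
`-1`. Each type is excluded by the same pattern: such a generator produces further cones, whose
functionals bound the coefficients of the generators opposite to `y` and `z` in the star of
`x₀, x₁, x₂`, until the fan of this star can no longer be complete without overlaps
(`eq_of_star`). -/

lemma typeThree_le (hF : F.IsFanoEven) (h : F.Adapted b) (hx : vec b (-1) (-1) (-1) 1 1 ∈ F.Gen)
    {f₀ f₁ f₂ e : ℤ} (hv : vec b f₀ f₁ f₂ (-1) e ∈ F.Gen) : -3 * f₀ + f₁ + f₂ + e ≤ -2 := by
  have h1 := (hF.flip h.cone (by simp [vec_inj]) hx (-1) (-1) (-1) 1 1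
    (by simp only [vec]; module) (by norm_num) (by norm_num)).2
  have h2 := (hF.flip (h1.of_subset (l' := [vec b 0 0 0 1 0, vec b (-1) (-1) (-1) 1 1,
    vec b 0 1 0 0 0, vec b 0 0 1 0 0, vec b 0 0 0 0 1]) (by simp)) (by simp [vec_inj]) h.mem_Gen
    (-1) 1 0 0 (-1) (by simp only [vec]; module) (by norm_num) (by norm_num)).2
  have := (hF.phi_le (b := b) (c₀ := -3) (c₁ := 1) (c₂ := 1) (c₃ := -1) (c₄ := 1) h2 hv
    ⟨by simp [vec_inj], rfl⟩ (by simp [phi_vec])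
    (by simp only [List.mem_cons, vec_inj, List.not_mem_nil, or_false]; omega)).1
  omega

lemma typeThree_exponent (hF : F.IsFanoEven) (h : F.Adapted b)
    (hx : vec b (-1) (-1) (-1) 1 1 ∈ F.Gen)
    {f₀ f₁ f₂ e : ℤ} (hv : vec b f₀ f₁ f₂ (-1) e ∈ F.Gen) : e ≤ -2 := by
  have h0 := h.typeThree_le hF hx hv
  obtain ⟨b₁, hb₁, hvec₁⟩ := h.swap₀₁
  have h1 := hb₁.typeThree_le hF (f₀ := f₁) (f₁ := f₀) (f₂ := f₂) (e := e) (by rwa [hvec₁])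
    (by rwa [hvec₁])
  obtain ⟨b₂, hb₂, hvec₂⟩ := h.swap₁₂
  obtain ⟨b₃, hb₃, hvec₃⟩ := hb₂.swap₀₁
  have h2 := hb₃.typeThree_le hF (f₀ := f₂) (f₁ := f₀) (f₂ := f₁) (e := e) (by rwa [hvec₃, hvec₂])
    (by rwa [hvec₃, hvec₂])
  have h3 := (h.sum_le hF hv (by omega)).1
  omega

lemma not_typeThree (hF : F.IsFanoEven) (h : F.Adapted b) :
    vec b (-1) (-1) (-1) 1 1 ∉ F.Gen := by
  intro hx
  obtain ⟨f₀, f₁, f₂, e, hy⟩ := h.exists_neighbour₃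
  obtain ⟨g₀, g₁, g₂, e', hz⟩ := h.exists_neighbour₄
  have h1 := h.typeThree_exponent hF hx (hy.mem_Gen (v := vec b f₀ f₁ f₂ (-1) e) (by simp))
  obtain ⟨b', hb', hvec⟩ := h.swap₃₄
  have h2 := hb'.typeThree_exponent hF (f₀ := g₀) (f₁ := g₁) (f₂ := g₂) (e := e') (by rwa [hvec])
    (by rw [hvec]; exact hz.mem_Gen (by simp))
  have := Adapted.eq_of_star (α := -1 + e * e') (β := -e')
    (hy.of_subset (l' := [vec b 0 0 0 0 1, vec b f₀ f₁ f₂ (-1) e, vec b 1 0 0 0 0, vec b 0 1 0 0 0,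
      vec b 0 0 1 0 0]) (by simp)) (hz.of_subset (l' := [vec b g₀ g₁ g₂ e' (-1), vec b 1 0 0 0 0,
      vec b 0 1 0 0 0, vec b 0 0 1 0 0]) (by simp)) (by omega) (by omega) (by omega) (by ring)
    (by ring) (by nlinarith) (by omega)
  rw [vec_inj] at this
  omega

/-! ### A neighbour of the form `-x₀ - x₁ + y` -/

lemma typeTwo_le (hF : F.IsFanoEven) (h : F.Adapted b) (hx : vec b (-1) (-1) 0 1 0 ∈ F.Gen)
    {f₀ f₁ f₂ f₃ f₄ : ℤ} (hv : vec b f₀ f₁ f₂ f₃ f₄ ∈ F.Gen) (hneg : f₃ < 0 ∨ f₄ < 0) :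
    -f₀ + f₁ + f₂ + f₃ + f₄ ≤ -1 ∧ -3 * f₀ + f₁ + f₂ - f₃ + f₄ ≤ -1 ∧
      -f₀ + f₁ - f₂ + f₃ + f₄ ≤ -1 := by
  have h1 := (hF.flip h.cone (by simp [vec_inj]) hx (-1) (-1) 0 1 0
    (by simp only [vec]; module) (by norm_num) (by norm_num)).2
  have h2 := (hF.flip (h1.of_subset (l' := [vec b 0 0 0 1 0, vec b (-1) (-1) 0 1 0,
    vec b 0 1 0 0 0, vec b 0 0 1 0 0, vec b 0 0 0 0 1]) (by simp)) (by simp [vec_inj]) h.mem_Gen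
    (-1) 1 0 (-1) 0 (by simp only [vec]; module) (by norm_num) (by norm_num)).2
  have h3 := (hF.flip (h1.of_subset (l' := [vec b 0 0 1 0 0, vec b (-1) (-1) 0 1 0,
    vec b 0 1 0 0 0, vec b 0 0 0 1 0, vec b 0 0 0 0 1]) (by simp)) (by simp [vec_inj]) h.mem_Gen
    (-1) 1 0 (-1) 0 (by simp only [vec]; module) (by norm_num) (by norm_num)).2
  have k1 := (hF.phi_le (b := b) (c₀ := -1) (c₁ := 1) (c₂ := 1) (c₃ := 1) (c₄ := 1) h1 hv
    ⟨by simp [vec_inj], rfl⟩ (by simp [phi_vec])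
    (by simp only [List.mem_cons, vec_inj, List.not_mem_nil, or_false]; omega)).1
  have k2 := (hF.phi_le (b := b) (c₀ := -3) (c₁ := 1) (c₂ := 1) (c₃ := -1) (c₄ := 1) h2 hv
    ⟨by simp [vec_inj], rfl⟩ (by simp [phi_vec])
    (by simp only [List.mem_cons, vec_inj, List.not_mem_nil, or_false]; omega)).1
  have k3 := (hF.phi_le (b := b) (c₀ := -1) (c₁ := 1) (c₂ := -1) (c₃ := 1) (c₄ := 1) h3 hv
    ⟨by simp [vec_inj], rfl⟩ (by simp [phi_vec])
    (by simp only [List.mem_cons, vec_inj, List.not_mem_nil, or_false]; omega)).1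
  omega

/-- The mirror image of `typeTwo_le` under the exchange of `x₀` and `x₁`. -/
lemma typeTwo_le' (hF : F.IsFanoEven) (h : F.Adapted b) (hx : vec b (-1) (-1) 0 1 0 ∈ F.Gen)
    {f₀ f₁ f₂ f₃ f₄ : ℤ} (hv : vec b f₀ f₁ f₂ f₃ f₄ ∈ F.Gen) (hneg : f₃ < 0 ∨ f₄ < 0) :
    f₀ - f₁ + f₂ + f₃ + f₄ ≤ -1 ∧ f₀ - 3 * f₁ + f₂ - f₃ + f₄ ≤ -1 ∧
      f₀ - f₁ - f₂ + f₃ + f₄ ≤ -1 := by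
  obtain ⟨b', hb', hvec⟩ := h.swap₀₁
  have := hb'.typeTwo_le hF (f₀ := f₁) (f₁ := f₀) (f₂ := f₂) (f₃ := f₃) (f₄ := f₄) (by rwa [hvec])
    (by rwa [hvec]) hneg
  omega

lemma not_typeTwo (hF : F.IsFanoEven) (h : F.Adapted b) : vec b (-1) (-1) 0 1 0 ∉ F.Gen := by
  intro hx
  obtain ⟨f₀, f₁, f₂, e, hy⟩ := h.exists_neighbour₃
  obtain ⟨g₀, g₁, g₂, e', hz⟩ := h.exists_neighbour₄
  have hyG := hy.mem_Gen (v := vec b f₀ f₁ f₂ (-1) e) (by simp)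
  have hzG := hz.mem_Gen (v := vec b g₀ g₁ g₂ e' (-1)) (by simp)
  have y1 := h.typeTwo_le hF hx hyG (by omega)
  have y2 := h.typeTwo_le' hF hx hyG (by omega)
  have y3 := h.sum_le hF hyG (by omega)
  have z1 := h.typeTwo_le hF hx hzG (by omega)
  have z2 := h.typeTwo_le' hF hx hzG (by omega)
  have z3 := h.sum_le hF hzG (by omega)
  have he : e ≤ -1 := by omega
  have hcy := hy.of_subset (l' := [vec b 0 0 0 0 1, vec b f₀ f₁ f₂ (-1) e, vec b 1 0 0 0 0,
    vec b 0 1 0 0 0, vec b 0 0 1 0 0]) (by simp)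
  by_cases he' : 0 ≤ e'
  · -- the generator on the other side of `z` is `-z`
    obtain ⟨rfl, rfl, rfl, rfl⟩ : g₀ = 0 ∧ g₁ = 0 ∧ g₂ = 0 ∧ e' = 0 := by omega
    obtain ⟨b', hb', hvec⟩ := h.replace₄ (by norm_num) hz
    obtain ⟨h₀, h₁, h₂, e₁, hy'⟩ := hb'.exists_neighbour₃
    have hx' : vec b' (-1) (-1) 0 1 0 ∈ F.Gen := by rw [hvec]; simpa using hx
    have hyG' := hy'.mem_Gen (v := vec b' h₀ h₁ h₂ (-1) e₁) (by simp)
    have w1 := hb'.typeTwo_le hF hx' hyG' (by omega)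
    have w2 := hb'.typeTwo_le' hF hx' hyG' (by omega)
    have w3 := hb'.sum_le hF hyG' (by omega)
    have he₁ : e₁ ≤ -1 := by omega
    simp only [hvec] at hy'
    have := Adapted.eq_of_star (α := -e₁ - e) (β := 1) hcy (hy'.of_subset
      (l' := [vec b (h₀ + e₁ * 0) (h₁ + e₁ * 0) (h₂ + e₁ * 0) (-1 + e₁ * 0) (e₁ * -1),
        vec b 1 0 0 0 0, vec b 0 1 0 0 0, vec b 0 0 1 0 0]) (by simp)) (by omega) (by omega)
      (by omega) (by ring) (by ring) (by omega) (by omega)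
    rw [vec_inj] at this
    omega
  · have hcz := hz.of_subset (l' := [vec b g₀ g₁ g₂ e' (-1), vec b 1 0 0 0 0,
      vec b 0 1 0 0 0, vec b 0 0 1 0 0]) (by simp)
    have hee : e = -1 ∧ e' = -1 := by
      by_contra hne
      have := Adapted.eq_of_star (α := -1 + e * e') (β := -e') hcy hcz (by omega) (by omega)
        (by omega) (by ring) (by ring) (by
          have : e ≤ -2 ∨ e' ≤ -2 := by omega
          rcases this with h | h <;> nlinarith) (by omega)
      rw [vec_inj] at this
      omega
    obtain ⟨rfl, rfl⟩ := hee
    have := Adapted.eq_of_star (α := 1) (β := 0) (hy.of_subset (l' := [vec b f₀ f₁ f₂ (-1) (-1),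
      vec b 0 0 0 0 1, vec b 1 0 0 0 0, vec b 0 1 0 0 0, vec b 0 0 1 0 0]) (by simp)) hcz (by omega)
      (by omega) (by omega) (by ring) (by ring) (by omega) (by omega)
    rw [vec_inj] at this
    have hcases : (f₀ = 1 ∧ f₁ = 1 ∧ f₂ = -1) ∨ (f₀ = 0 ∧ f₁ = 0 ∧ f₂ = -1) := by omega
    have hyz := h.cone.mem_Gen (v := vec b 0 0 0 0 1) (by simp [basisList])
    rcases hcases with ⟨rfl, rfl, rfl⟩ | ⟨rfl, rfl, rfl⟩
    · exact h.false_of_sum_eq hF hyG hx hyz (by simp [vec_inj]) (by simp [vec_inj])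
        (by simp only [vec]; module)
    · exact h.false_of_sum_eq hF hyG (h.cone.mem_Gen (v := vec b 0 0 0 1 0) (by simp [basisList]))
        hyz (by simp [vec_inj]) (by simp [vec_inj]) (by simp only [vec]; module)

/-! ### The neighbours across the facets of a primitive collection -/

set_option maxHeartbeats 400000 in
/-- The coordinates of the generator on the other side of a wall opposite to an element of the
primitive collection: each of the two generators that are opposite to the wall has coordinates at
least `-1` with respect to the cone of the other one. -/
lemma neighbour₀_bounds (hF : F.IsFanoEven) (h : F.Adapted b) {p q r s : ℤ}
    (hc : F.Cone [vec b (-1) p q r s, vec b 0 1 0 0 0, vec b 0 0 1 0 0, vec b 0 0 0 1 0,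
      vec b 0 0 0 0 1]) (h4 : ¬ (p = -1 ∧ q = -1 ∧ r = 0 ∧ s = 0)) :
    p + q + r + s = 0 ∧ (p = -1 ∨ p = 0) ∧ (q = -1 ∨ q = 0) ∧ r ≤ 1 ∧ s ≤ 1 := by
  have hG := hc.mem_Gen (v := vec b (-1) p q r s) (by simp)
  have h1 := (hF.phi_le (b := b) (c₀ := 1) (c₁ := 1) (c₂ := 1) (c₃ := 1) (c₄ := 1) h.cone hG
    ⟨by simp [basisList, vec_inj], rfl⟩ (by simp [basisList, phi_vec])
    (by simp only [basisList, List.mem_cons, vec_inj, List.not_mem_nil, or_false]; omega)).1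
  have h2 := (hF.phi_le (b := b) (c₀ := p + q + r + s - 1) (c₁ := 1) (c₂ := 1) (c₃ := 1) (c₄ := 1)
    hc h.mem_Gen ⟨by simp [vec_inj], rfl⟩ (by simp [phi_vec]; ring)
    (by simp only [List.mem_cons, vec_inj, List.not_mem_nil, or_false]; omega)).1
  have hS : p + q + r + s = 0 := by omega
  have a1 : p < 0 → p = -1 := fun hlt => (hF.flip (h.cone.of_subset (l' := [vec b 0 1 0 0 0,
    vec b 1 0 0 0 0, vec b 0 0 1 0 0, vec b 0 0 0 1 0, vec b 0 0 0 0 1]) (by simp [basisList]))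
    (by simp [vec_inj]) hG p (-1) q r s (by simp only [vec]; module) (by omega) hlt).1
  have a2 : q < 0 → q = -1 := fun hlt => (hF.flip (h.cone.of_subset (l' := [vec b 0 0 1 0 0,
    vec b 1 0 0 0 0, vec b 0 1 0 0 0, vec b 0 0 0 1 0, vec b 0 0 0 0 1]) (by simp [basisList]))
    (by simp [vec_inj]) hG q (-1) p r s (by simp only [vec]; module) (by omega) hlt).1
  have c1 : -(p + 1) < 0 → -(p + 1) = -1 := fun hlt => (hF.flip (hc.of_subset
    (l' := [vec b 0 1 0 0 0, vec b (-1) p q r s, vec b 0 0 1 0 0, vec b 0 0 0 1 0,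
    vec b 0 0 0 0 1]) (by simp)) (by simp [vec_inj]) h.mem_Gen (-(p + 1)) 1 (-(q + 1)) (-r) (-s)
    (by simp only [vec]; module) (by omega) hlt).1
  have c2 : -(q + 1) < 0 → -(q + 1) = -1 := fun hlt => (hF.flip (hc.of_subset
    (l' := [vec b 0 0 1 0 0, vec b (-1) p q r s, vec b 0 1 0 0 0, vec b 0 0 0 1 0,
    vec b 0 0 0 0 1]) (by simp)) (by simp [vec_inj]) h.mem_Gen (-(q + 1)) 1 (-(p + 1)) (-r) (-s)
    (by simp only [vec]; module) (by omega) hlt).1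
  have c3 : -r < 0 → -r = -1 := fun hlt => (hF.flip (hc.of_subset
    (l' := [vec b 0 0 0 1 0, vec b (-1) p q r s, vec b 0 1 0 0 0, vec b 0 0 1 0 0,
    vec b 0 0 0 0 1]) (by simp)) (by simp [vec_inj]) h.mem_Gen (-r) 1 (-(p + 1)) (-(q + 1)) (-s)
    (by simp only [vec]; module) (by omega) hlt).1
  have c4 : -s < 0 → -s = -1 := fun hlt => (hF.flip (hc.of_subset
    (l' := [vec b 0 0 0 0 1, vec b (-1) p q r s, vec b 0 1 0 0 0, vec b 0 0 1 0 0,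
    vec b 0 0 0 1 0]) (by simp)) (by simp [vec_inj]) h.mem_Gen (-s) 1 (-(p + 1)) (-(q + 1)) (-r)
    (by simp only [vec]; module) (by omega) hlt).1
  refine ⟨hS, ?_, ?_, ?_, ?_⟩
  · clear a2 c2 c3 c4; omega
  · clear a1 c1 c3 c4; omega
  · clear a1 a2 c1 c2 c4; omega
  · clear a1 a2 c1 c2 c3; omega

/-- The generator on the other side of the wall opposite to `x₀` is `x₃`, unless there is a
generator of type one. -/
lemma exists_neighbour₀ (hF : F.IsFanoEven) (h : F.Adapted b) :
    F.Cone [vec b (-1) (-1) (-1) 0 0, vec b 0 1 0 0 0, vec b 0 0 1 0 0, vec b 0 0 0 1 0,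
      vec b 0 0 0 0 1] ∨ vec b (-1) 0 0 1 (-1) ∈ F.Gen ∨ vec b (-1) 0 0 (-1) 1 ∈ F.Gen := by
  obtain ⟨v, p, q, r, s, hc, hv⟩ := h.cone.exists_neighbour (by simp [vec_inj])
  obtain rfl : v = vec b (-1) p q r s := by
    rw [hv]
    simp only [vec]
    module
  by_cases h4 : p = -1 ∧ q = -1 ∧ r = 0 ∧ s = 0
  · obtain ⟨rfl, rfl, rfl, rfl⟩ := h4
    exact Or.inl hc
  have hG := hc.mem_Gen (v := vec b (-1) p q r s) (by simp)
  obtain ⟨hS, hp, hq, hr, hs⟩ := h.neighbour₀_bounds hF hc h4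
  obtain ⟨b₁, hb₁, hvec₁⟩ := h.swap₁₂
  obtain ⟨b₂, hb₂, hvec₂⟩ := h.swap₃₄
  obtain ⟨b₃, hb₃, hvec₃⟩ := hb₁.swap₃₄
  have hcases : (p = 0 ∧ q = 0 ∧ r = 0 ∧ s = 0) ∨ (p = 0 ∧ q = 0 ∧ r = 1 ∧ s = -1) ∨
      (p = 0 ∧ q = 0 ∧ r = -1 ∧ s = 1) ∨ (p = -1 ∧ q = 0 ∧ r = 1 ∧ s = 0) ∨
      (p = -1 ∧ q = 0 ∧ r = 0 ∧ s = 1) ∨ (p = 0 ∧ q = -1 ∧ r = 1 ∧ s = 0) ∨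
      (p = 0 ∧ q = -1 ∧ r = 0 ∧ s = 1) ∨ (p = -1 ∧ q = -1 ∧ r = 1 ∧ s = 1) := by
    rcases hp with rfl | rfl <;> rcases hq with rfl | rfl <;> omega
  rcases hcases with ⟨rfl, rfl, rfl, rfl⟩ | ⟨rfl, rfl, rfl, rfl⟩ | ⟨rfl, rfl, rfl, rfl⟩ |
    ⟨rfl, rfl, rfl, rfl⟩ | ⟨rfl, rfl, rfl, rfl⟩ | ⟨rfl, rfl, rfl, rfl⟩ | ⟨rfl, rfl, rfl, rfl⟩ |
    ⟨rfl, rfl, rfl, rfl⟩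
  · have := h.cone₀.mem_of_sum_eq (l' := [vec b (-1) 0 0 0 0]) (hc.of_subset (by simp))
      (by simp [vec_inj]) (by simp) (by
        simp only [List.sum_cons, List.sum_nil, add_zero, vec]
        module) (v := vec b 0 1 0 0 0) (by simp)
    simp [vec_inj] at this
  · exact Or.inr (Or.inl hG)
  · exact Or.inr (Or.inr hG)
  · exact absurd hG (h.not_typeTwo hF)
  · exact absurd (by rwa [hvec₂]) (hb₂.not_typeTwo hF)
  · exact absurd (by rwa [hvec₁]) (hb₁.not_typeTwo hF)
  · exact absurd (by rwa [hvec₃, hvec₁]) (hb₃.not_typeTwo hF)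
  · exact absurd hG (h.not_typeThree hF)

/-! ### A neighbour of the form `-x₀ + y - z` -/

/-- Cones that are forced by a generator of type one, by crossing walls. -/
lemma typeOne_cones (hF : F.IsFanoEven) (h : F.Adapted b) (hx : vec b (-1) 0 0 1 (-1) ∈ F.Gen) :
    F.Cone [vec b (-1) 0 0 1 (-1), vec b 1 0 0 0 0, vec b 0 1 0 0 0, vec b 0 0 1 0 0,
      vec b 0 0 0 1 0] ∧
    F.Cone [vec b (-1) (-1) (-1) 0 0, vec b (-1) 0 0 1 (-1), vec b 0 1 0 0 0, vec b 0 0 1 0 0,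
      vec b 0 0 0 0 1] ∧
    F.Cone [vec b (-1) (-1) (-1) 0 0, vec b (-1) 0 0 1 (-1), vec b 0 0 1 0 0, vec b 0 0 0 1 0,
      vec b 0 0 0 0 1] := by
  have h1 := (hF.flip h.cone (by simp [vec_inj]) hx (-1) 0 0 1 (-1)
    (by simp only [vec]; module) (by norm_num) (by norm_num)).2
  refine ⟨(hF.flip (h.cone.of_subset (l' := [vec b 0 0 0 0 1, vec b 1 0 0 0 0, vec b 0 1 0 0 0,
    vec b 0 0 1 0 0, vec b 0 0 0 1 0]) (by simp [basisList])) (by simp [vec_inj]) hx (-1) (-1) 0 0 1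
    (by simp only [vec]; module) (by norm_num) (by norm_num)).2, ?_, ?_⟩
  · exact (hF.flip (h1.of_subset (l' := [vec b 0 0 0 1 0, vec b (-1) 0 0 1 (-1), vec b 0 1 0 0 0,
      vec b 0 0 1 0 0, vec b 0 0 0 0 1]) (by simp)) (by simp [vec_inj]) h.mem_Gen (-1) 1 (-1) (-1) 1
      (by simp only [vec]; module) (by norm_num) (by norm_num)).2
  · exact (hF.flip (h1.of_subset (l' := [vec b 0 1 0 0 0, vec b (-1) 0 0 1 (-1), vec b 0 0 1 0 0,
      vec b 0 0 0 1 0, vec b 0 0 0 0 1]) (by simp)) (by simp [vec_inj]) h.mem_Gen (-1) 1 (-1) (-1) 1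
      (by simp only [vec]; module) (by norm_num) (by norm_num)).2

/-- The wall opposite to `x₁` has `x₃` on its other side: the other two possibilities in
`exists_neighbour₀` contradict the cones of `typeOne_cones`. -/
lemma typeOne_cone₁ (hF : F.IsFanoEven) (h : F.Adapted b) (hx : vec b (-1) 0 0 1 (-1) ∈ F.Gen) :
    F.Cone [vec b (-1) (-1) (-1) 0 0, vec b 1 0 0 0 0, vec b 0 0 1 0 0, vec b 0 0 0 1 0,
      vec b 0 0 0 0 1] := by
  obtain ⟨h1, -, h3⟩ := h.typeOne_cones hF hx
  obtain ⟨b', hb', hvec⟩ := h.swap₀₁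
  have := hb'.exists_neighbour₀ hF
  simp only [hvec] at this
  rcases this with h4 | h4 | h4
  · exact h4
  · have := (hF.phi_le (b := b) (c₀ := 1) (c₁ := 1) (c₂ := 1) (c₃ := 1) (c₄ := -1) h1 h4
      ⟨by simp [vec_inj], rfl⟩ (by simp [phi_vec]) (by simp [vec_inj])).1
    omega
  · have := (hF.phi_le (b := b) (c₀ := -1) (c₁ := -1) (c₂ := 1) (c₃ := 1) (c₄ := 1) h3 h4
      ⟨by simp [vec_inj], rfl⟩ (by simp [phi_vec]) (by simp [vec_inj])).1
    omega

lemma typeOne_exponent (hF : F.IsFanoEven) (h : F.Adapted b)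
    (hx : vec b (-1) 0 0 1 (-1) ∈ F.Gen) {f₀ f₁ f₂ e : ℤ}
    (hv : vec b f₀ f₁ f₂ (-1) e ∈ F.Gen) : e ≤ -1 := by
  obtain ⟨h1, h2, -⟩ := h.typeOne_cones hF hx
  have h3 := h.typeOne_cone₁ hF hx
  obtain ⟨b', hb', hvec⟩ := h.swap₁₂
  have h4 := hb'.typeOne_cone₁ hF (by rwa [hvec])
  simp only [hvec] at h4
  have k0 := (h.sum_le hF hv (by omega)).1
  have k1 := (hF.phi_le (b := b) (c₀ := 1) (c₁ := 1) (c₂ := 1) (c₃ := 1) (c₄ := -1) h1 hv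
    ⟨by simp [vec_inj], rfl⟩ (by simp [phi_vec])
    (by simp only [List.mem_cons, vec_inj, List.not_mem_nil, or_false]; omega)).1
  have k2 := (hF.phi_le (b := b) (c₀ := -3) (c₁ := 1) (c₂ := 1) (c₃ := -1) (c₄ := 1) h2 hv
    ⟨by simp [vec_inj], rfl⟩ (by simp [phi_vec])
    (by simp only [List.mem_cons, vec_inj, List.not_mem_nil, or_false]; omega)).1
  have k3 := (hF.phi_le (b := b) (c₀ := 1) (c₁ := -3) (c₂ := 1) (c₃ := 1) (c₄ := 1) h3 hv
    ⟨by simp [vec_inj], rfl⟩ (by simp [phi_vec])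
    (by simp only [List.mem_cons, vec_inj, List.not_mem_nil, or_false]; omega)).1
  have k4 := (hF.phi_le (b := b) (c₀ := 1) (c₁ := 1) (c₂ := -3) (c₃ := 1) (c₄ := 1) h4 hv
    ⟨by simp [vec_inj], rfl⟩ (by simp [phi_vec])
    (by simp only [List.mem_cons, vec_inj, List.not_mem_nil, or_false]; omega)).1
  omega

lemma not_typeOne (hF : F.IsFanoEven) (h : F.Adapted b) : vec b (-1) 0 0 1 (-1) ∉ F.Gen := by
  intro hx
  obtain ⟨f₀, f₁, f₂, e, hy⟩ := h.exists_neighbour₃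
  have he := h.typeOne_exponent hF hx (hy.mem_Gen (v := vec b f₀ f₁ f₂ (-1) e) (by simp))
  obtain ⟨h1, -, -⟩ := h.typeOne_cones hF hx
  -- `z` is of the same form with respect to the cone in which it is replaced by `-x₀ + y - z`
  obtain ⟨b', hb', hvec⟩ := h.replace₄ (by norm_num) h1
  obtain ⟨h₀, h₁, h₂, e₁, hy'⟩ := hb'.exists_neighbour₃
  have he₁ := hb'.typeOne_exponent hF (by
    rw [hvec]
    exact h.cone.mem_Gen (by simp [basisList]))
    (hy'.mem_Gen (v := vec b' h₀ h₁ h₂ (-1) e₁) (by simp))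
  simp only [hvec] at hy'
  have := Adapted.eq_of_star (α := -e₁ - (1 - e₁) * e) (β := 1 - e₁) (hy.of_subset
    (l' := [vec b 0 0 0 0 1, vec b f₀ f₁ f₂ (-1) e, vec b 1 0 0 0 0, vec b 0 1 0 0 0,
      vec b 0 0 1 0 0]) (by simp)) (hy'.of_subset
    (l' := [vec b (h₀ + e₁ * -1) (h₁ + e₁ * 0) (h₂ + e₁ * 0) (-1 + e₁ * 1) (e₁ * -1),
        vec b 1 0 0 0 0, vec b 0 1 0 0 0, vec b 0 0 1 0 0]) (by simp)) (by omega) (by omega)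
      (by omega) (by ring) (by ring) (by nlinarith) (by omega)
  rw [vec_inj] at this
  omega

/-- Crossing the wall opposite to an element of the primitive collection in a cone that contains
three of its elements leads to the fourth one. -/
lemma exchange₀ (hF : F.IsFanoEven) (h : F.Adapted b) :
    F.Cone [vec b (-1) (-1) (-1) 0 0, vec b 0 1 0 0 0, vec b 0 0 1 0 0, vec b 0 0 0 1 0,
      vec b 0 0 0 0 1] := by
  obtain ⟨b', hb', hvec⟩ := h.swap₃₄
  rcases h.exists_neighbour₀ hF with h1 | h1 | h1
  · exact h1
  · exact absurd h1 (h.not_typeOne hF)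
  · exact absurd (by rwa [hvec]) (hb'.not_typeOne hF)

end Adapted
end SmoothCompleteFan
/-! ### Classification of the fans -/

namespace SmoothCompleteFan

/-- The vectors of a finite family, except for one of them: the generators of a cone of the fan of a
projective space, if the family consists of a lattice basis and minus its sum. -/
def facet {d n : ℕ} (v : Fin (n + 1) → Fin d → ℤ) (i : Fin (n + 1)) : Finset (Fin d → ℤ) :=
  (Finset.univ.erase i).image v

lemma mem_facet {d n : ℕ} {v : Fin (n + 1) → Fin d → ℤ} {i : Fin (n + 1)} {x : Fin d → ℤ} :
    x ∈ facet v i ↔ ∃ j, j ≠ i ∧ v j = x := by simp [facet]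

lemma facet_two {d : ℕ} (p q : Fin d → ℤ) : facet ![p, q] 0 = {q} ∧ facet ![p, q] 1 = {p} := by
  constructor <;> ext v <;> simp [mem_facet, Fin.exists_fin_two, eq_comm]

lemma facet_three {d : ℕ} (p q r : Fin d → ℤ) : facet ![p, q, r] 0 = {q, r} ∧
    facet ![p, q, r] 1 = {p, r} ∧ facet ![p, q, r] 2 = {p, q} := by
  refine ⟨?_, ?_, ?_⟩ <;> ext v <;> simp [mem_facet, Fin.exists_fin_succ, eq_comm]

/-- The primitive collection attached to an adapted basis. -/
noncomputable def collection (b : Module.Basis (Fin 5) ℤ (Fin 5 → ℤ)) : Fin 4 → Fin 5 → ℤ :=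
  ![vec b 1 0 0 0 0, vec b 0 1 0 0 0, vec b 0 0 1 0 0, vec b (-1) (-1) (-1) 0 0]

namespace Adapted

variable {F : SmoothCompleteFan 5} {b : Module.Basis (Fin 5) ℤ (Fin 5 → ℤ)}

/-- The primitive collection is renamed: `x₃, x₁, x₂, x₀` in place of `x₀, x₁, x₂, x₃`. -/
lemma rotate (hF : F.IsFanoEven) (h : F.Adapted b) : ∃ b', F.Adapted b' ∧
    ∀ a₀ a₁ a₂ a₃ a₄, vec b' a₀ a₁ a₂ a₃ a₄ = vec b (-a₀) (a₁ - a₀) (a₂ - a₀) a₃ a₄ := by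
  obtain ⟨b', h1, h2, -⟩ := (h.exchange₀ hF).exists_vec (by simp [vec_inj])
  have h3 : ∀ a₀ a₁ a₂ a₃ a₄, vec b' a₀ a₁ a₂ a₃ a₄ = vec b (-a₀) (a₁ - a₀) (a₂ - a₀) a₃ a₄ :=
    fun _ _ _ _ _ => by
      rw [h2]
      simp only [vec]
      module
  refine ⟨b', ⟨h1, ?_, ?_, ?_⟩, h3⟩ <;> simp only [h3]
  · exact h.cone.of_subset (by simp [basisList])
  · exact h.cone₁.of_subset (by simp)
  · exact h.cone₂.of_subset (by simp)

/-- The cone spanned by `y` and `z` is joined by every facet of the primitive collection, not only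
by the one of the adapted basis. -/
lemma facet_union_mem (hF : F.IsFanoEven) (h : F.Adapted b) (l : Fin 4) :
    facet (collection b) l ∪ {vec b 0 0 0 1 0, vec b 0 0 0 0 1} ∈ F.cones := by
  have key : ∃ L : List (Fin 5 → ℤ), F.Cone L ∧
      facet (collection b) l ∪ {vec b 0 0 0 1 0, vec b 0 0 0 0 1} ⊆ L.toFinset := by
    obtain ⟨b₁, hb₁, hvec₁⟩ := h.swap₀₁
    obtain ⟨b₂, hb₂, hvec₂⟩ := h.swap₁₂
    obtain ⟨b₃, hb₃, hvec₃⟩ := hb₂.swap₀₁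
    have h1 := hb₁.exchange₀ hF
    have h2 := hb₃.exchange₀ hF
    simp only [hvec₁, hvec₃, hvec₂] at h1 h2
    have hsub : ∀ L : List (Fin 5 → ℤ), (∀ j, j ≠ l → collection b j ∈ L) →
        vec b 0 0 0 1 0 ∈ L → vec b 0 0 0 0 1 ∈ L →
        facet (collection b) l ∪ {vec b 0 0 0 1 0, vec b 0 0 0 0 1} ⊆ L.toFinset := by
      intro L hL h3 h4 v hv
      simp only [Finset.mem_union, mem_facet, Finset.mem_insert, Finset.mem_singleton] at hv
      rw [List.mem_toFinset]
      rcases hv with ⟨j, hj, rfl⟩ | rfl | rfl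
      exacts [hL j hj, h3, h4]
    fin_cases l
    · refine ⟨_, h.exchange₀ hF, hsub _ (fun j hj => ?_) (by simp) (by simp)⟩
      fin_cases j <;> simp_all [collection]
    · refine ⟨_, h1, hsub _ (fun j hj => ?_) (by simp) (by simp)⟩
      fin_cases j <;> simp_all [collection]
    · refine ⟨_, h2, hsub _ (fun j hj => ?_) (by simp) (by simp)⟩
      fin_cases j <;> simp_all [collection]
    · refine ⟨_, h.cone, hsub _ (fun j hj => ?_) (by simp [basisList]) (by simp [basisList])⟩
      fin_cases j <;> simp_all [collection, basisList]
  obtain ⟨L, hL, hsub⟩ := key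
  exact F.face_mem _ hL _ hsub

/-- In the star of three elements of the primitive collection, the coefficient of `z` in the sum of
`y` and the opposite generator is not positive. -/
lemma exponent_le (hF : F.IsFanoEven) (h : F.Adapted b) {f₀ f₁ f₂ e : ℤ}
    (hv : vec b f₀ f₁ f₂ (-1) e ∈ F.Gen) : e ≤ 0 ∧ (e = 0 → f₀ = 0 ∧ f₁ = 0 ∧ f₂ = 0) ∧
      (e = -1 → f₀ = -1 ∧ f₁ = -1 ∧ f₂ = -1 ∨ f₀ = 1 ∧ f₁ = 0 ∧ f₂ = 0 ∨
        f₀ = 0 ∧ f₁ = 1 ∧ f₂ = 0 ∨ f₀ = 0 ∧ f₁ = 0 ∧ f₂ = 1) := by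
  have key : ∀ {b : Module.Basis (Fin 5) ℤ (Fin 5 → ℤ)} (_ : F.Adapted b) {f₀ f₁ f₂ e : ℤ},
      vec b f₀ f₁ f₂ (-1) e ∈ F.Gen → -3 * f₀ + f₁ + f₂ + e ≤ 0 := by
    intro b h f₀ f₁ f₂ e hv
    have := (hF.phi_le (b := b) (c₀ := -3) (c₁ := 1) (c₂ := 1) (c₃ := 1) (c₄ := 1)
      (h.exchange₀ hF) hv ⟨by simp [vec_inj], rfl⟩ (by simp [phi_vec])
      (by simp only [List.mem_cons, vec_inj, List.not_mem_nil, or_false]; omega)).1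
    omega
  obtain ⟨b₁, hb₁, hvec₁⟩ := h.swap₀₁
  obtain ⟨b₂, hb₂, hvec₂⟩ := h.swap₁₂
  obtain ⟨b₃, hb₃, hvec₃⟩ := hb₂.swap₀₁
  have k0 := key h hv
  have k1 := key hb₁ (f₀ := f₁) (f₁ := f₀) (f₂ := f₂) (e := e) (by rwa [hvec₁])
  have k2 := key hb₃ (f₀ := f₂) (f₁ := f₀) (f₂ := f₁) (e := e) (by rwa [hvec₃, hvec₂])
  have k3 := h.sum_le hF hv (by omega)
  refine ⟨by omega, fun he => by omega, fun he => ?_⟩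
  have : f₀ + f₁ + f₂ = 1 ∨ f₀ + f₁ + f₂ = -3 := by omega
  omega

/-- If `-z` is a generator, then so is `-y`. -/
lemma exponent_eq_zero (hF : F.IsFanoEven) (h : F.Adapted b)
    (hz : F.Cone [vec b 0 0 0 0 (-1), vec b 1 0 0 0 0, vec b 0 1 0 0 0, vec b 0 0 1 0 0,
      vec b 0 0 0 1 0]) {f₀ f₁ f₂ e : ℤ}
    (hy : F.Cone [vec b f₀ f₁ f₂ (-1) e, vec b 1 0 0 0 0, vec b 0 1 0 0 0, vec b 0 0 1 0 0,
      vec b 0 0 0 0 1]) : e = 0 := by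
  have he := h.exponent_le hF (hy.mem_Gen (v := vec b f₀ f₁ f₂ (-1) e) (by simp))
  by_contra hne
  obtain ⟨b', hb', hvec⟩ := h.replace₄ (by norm_num) hz
  obtain ⟨h₀, h₁, h₂, e₁, hy'⟩ := hb'.exists_neighbour₃
  have he₁ := hb'.exponent_le hF (hy'.mem_Gen (v := vec b' h₀ h₁ h₂ (-1) e₁) (by simp))
  simp only [hvec] at hy'
  have := Adapted.eq_of_star (α := -e₁ - e) (β := 1) (hy.of_subset (l' := [vec b 0 0 0 0 1,
    vec b f₀ f₁ f₂ (-1) e, vec b 1 0 0 0 0, vec b 0 1 0 0 0, vec b 0 0 1 0 0]) (by simp))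
    (hy'.of_subset (l' := [vec b (h₀ + e₁ * 0) (h₁ + e₁ * 0) (h₂ + e₁ * 0) (-1 + e₁ * 0) (e₁ * -1),
        vec b 1 0 0 0 0, vec b 0 1 0 0 0, vec b 0 0 1 0 0]) (by simp)) (by omega) (by omega)
      (by omega) (by ring) (by ring) (by omega) (by omega)
  rw [vec_inj] at this
  omega

/-- The star of `x₀, x₁, x₂` is the fan of `ℙ¹ × ℙ¹` or of `ℙ²`: the generators opposite to `y` and
`z` are `-y` and `-z`, or they coincide. -/
lemma dichotomy (hF : F.IsFanoEven) (h : F.Adapted b) :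
    (F.Cone [vec b 0 0 0 (-1) 0, vec b 1 0 0 0 0, vec b 0 1 0 0 0, vec b 0 0 1 0 0,
      vec b 0 0 0 0 1] ∧ F.Cone [vec b 0 0 0 0 (-1), vec b 1 0 0 0 0, vec b 0 1 0 0 0,
      vec b 0 0 1 0 0, vec b 0 0 0 1 0]) ∨
    ∃ f₀ f₁ f₂, F.Cone [vec b f₀ f₁ f₂ (-1) (-1), vec b 1 0 0 0 0, vec b 0 1 0 0 0, vec b 0 0 1 0 0,
      vec b 0 0 0 0 1] ∧ F.Cone [vec b f₀ f₁ f₂ (-1) (-1), vec b 1 0 0 0 0, vec b 0 1 0 0 0,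
      vec b 0 0 1 0 0, vec b 0 0 0 1 0] := by
  obtain ⟨f₀, f₁, f₂, e, hy⟩ := h.exists_neighbour₃
  obtain ⟨g₀, g₁, g₂, e', hz⟩ := h.exists_neighbour₄
  obtain ⟨b', hb', hvec⟩ := h.swap₃₄
  obtain ⟨he, he0, he1⟩ := h.exponent_le hF (hy.mem_Gen (v := vec b f₀ f₁ f₂ (-1) e) (by simp))
  obtain ⟨he', he0', he1'⟩ := hb'.exponent_le hF (f₀ := g₀) (f₁ := g₁) (f₂ := g₂) (e := e') (by
    rw [hvec]
    exact hz.mem_Gen (by simp))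
  by_cases hc : e = 0
  · obtain ⟨rfl, rfl, rfl⟩ := he0 hc
    subst hc
    obtain rfl : e' = 0 := hb'.exponent_eq_zero hF (f₀ := g₀) (f₁ := g₁) (f₂ := g₂)
      (by simp only [hvec]; exact hy) (by simp only [hvec]; exact hz)
    obtain ⟨rfl, rfl, rfl⟩ := he0' rfl
    exact Or.inl ⟨hy, hz⟩
  by_cases hc' : e' = 0
  · obtain ⟨rfl, rfl, rfl⟩ := he0' hc'
    subst hc'
    exact absurd (h.exponent_eq_zero hF hz hy) hc
  right
  have hcy := hy.of_subset (l' := [vec b 0 0 0 0 1, vec b f₀ f₁ f₂ (-1) e, vec b 1 0 0 0 0,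
    vec b 0 1 0 0 0, vec b 0 0 1 0 0]) (by simp)
  have hcz := hz.of_subset (l' := [vec b g₀ g₁ g₂ e' (-1), vec b 1 0 0 0 0,
    vec b 0 1 0 0 0, vec b 0 0 1 0 0]) (by simp)
  have hee : e = -1 ∧ e' = -1 := by
    by_contra hne
    have := Adapted.eq_of_star (α := -1 + e * e') (β := -e') hcy hcz (by omega) (by omega)
      (by omega) (by ring) (by ring) (by
        have h1 : e ≤ -1 := by omega
        have h2 : e' ≤ -1 := by omega
        have : e ≤ -2 ∨ e' ≤ -2 := by omega
        rcases this with h | h <;> nlinarith) (by omega)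
    rw [vec_inj] at this
    omega
  obtain ⟨rfl, rfl⟩ := hee
  have := Adapted.eq_of_star (α := 1) (β := 0) (hy.of_subset (l' := [vec b f₀ f₁ f₂ (-1) (-1),
    vec b 0 0 0 0 1, vec b 1 0 0 0 0, vec b 0 1 0 0 0, vec b 0 0 1 0 0]) (by simp)) hcz (by omega)
    (by omega) (by omega) (by ring) (by ring) (by omega) (by omega)
  rw [vec_inj] at this
  obtain ⟨rfl, rfl, rfl, -, -⟩ := this
  exact ⟨_, _, _, hy, hz⟩

lemma collection_congr {b b' : Module.Basis (Fin 5) ℤ (Fin 5 → ℤ)}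
    (h : ∀ a₀ a₁ a₂, vec b' a₀ a₁ a₂ 0 0 = vec b a₀ a₁ a₂ 0 0) : collection b' = collection b := by
  simp only [collection, h]

/-- The fan of `ℙ¹ × ℙ¹ × ℙ³`: its cones of full dimension. -/
lemma product_cones (hF : F.IsFanoEven) (h : F.Adapted b)
    (hy : F.Cone [vec b 0 0 0 (-1) 0, vec b 1 0 0 0 0, vec b 0 1 0 0 0, vec b 0 0 1 0 0,
      vec b 0 0 0 0 1])
    (hz : F.Cone [vec b 0 0 0 0 (-1), vec b 1 0 0 0 0, vec b 0 1 0 0 0,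
      vec b 0 0 1 0 0, vec b 0 0 0 1 0]) (i j : Fin 2) (l : Fin 4) :
    facet ![vec b 0 0 0 1 0, vec b 0 0 0 (-1) 0] i ∪
      facet ![vec b 0 0 0 0 1, vec b 0 0 0 0 (-1)] j ∪ facet (collection b) l ∈ F.cones := by
  obtain ⟨b₁, hb₁, hvec₁⟩ := h.replace₄ (by norm_num) hz
  obtain ⟨b', hb', hvec'⟩ := h.swap₃₄
  obtain ⟨b₂, hb₂, hvec₂⟩ := hb'.replace₄ (f₀ := 0) (f₁ := 0) (f₂ := 0) (f₃ := 0) (f₄ := -1)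
    (by norm_num) (by simp only [hvec']; exact hy)
  -- the generator opposite to `-z` in the cone spanned by `x₀, x₁, x₂, -y, -z`
  obtain ⟨b₃, hb₃, hvec₃⟩ := hb₁.swap₃₄
  have hzz : F.Cone [vec b₁ 0 0 0 0 (-1), vec b₁ 1 0 0 0 0, vec b₁ 0 1 0 0 0, vec b₁ 0 0 1 0 0,
      vec b₁ 0 0 0 1 0] := by
    simp only [hvec₁]
    exact h.cone.of_subset (by simp [basisList])
  obtain ⟨p₀, p₁, p₂, e₁, hd⟩ := hb₁.exists_neighbour₃
  have he₁ := hb₁.exponent_eq_zero hF hzz hd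
  obtain ⟨rfl, rfl, rfl⟩ :=
    (hb₁.exponent_le hF (hd.mem_Gen (v := vec b₁ p₀ p₁ p₂ (-1) e₁) (by simp))).2.1 he₁
  subst he₁
  obtain ⟨b₄, hb₄, hvec₄⟩ := hb₃.replace₄ (f₀ := 0) (f₁ := 0) (f₂ := 0) (f₃ := 0) (f₄ := -1)
    (by norm_num) (by simp only [hvec₃]; exact hd)
  have h0 := h.facet_union_mem hF l
  have h1 := hb₁.facet_union_mem hF l
  have h2 := hb₂.facet_union_mem hF l
  have h4 := hb₄.facet_union_mem hF l
  rw [collection_congr (b := b) (by simp [hvec₁])] at h1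
  rw [collection_congr (b := b) (by simp [hvec₂, hvec'])] at h2
  rw [collection_congr (b := b) (by simp [hvec₄, hvec₃, hvec₁])] at h4
  simp only [hvec₁, hvec₂, hvec', hvec₃, hvec₄] at h1 h2 h4
  simp only [mul_zero, add_zero, mul_neg, neg_zero, mul_one] at h1 h2 h4
  have key : ∀ {p q : Fin 5 → ℤ}, facet (collection b) l ∪ {p, q} ∈ F.cones →
      {p} ∪ {q} ∪ facet (collection b) l ∈ F.cones := fun {p q} hpq => by
    rwa [Finset.union_comm, show ({p} ∪ {q} : Finset (Fin 5 → ℤ)) = {p, q} from rfl]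
  have key' : ∀ {p q : Fin 5 → ℤ}, facet (collection b) l ∪ {p, q} ∈ F.cones →
      {q} ∪ {p} ∪ facet (collection b) l ∈ F.cones := fun {p q} hpq =>
    key (by rwa [Finset.pair_comm])
  fin_cases i <;> fin_cases j <;>
    simp only [Fin.zero_eta, Fin.mk_one, facet_two]
  · exact key' h4
  · exact key' h2
  · exact key h1
  · exact key h0

/-- The fan of `ℙ(𝒪 ⊕ 𝒪 ⊕ 𝒪 ⊕ 𝒪(1))` over `ℙ²`: its cones of full dimension. -/
lemma bundle_cones (hF : F.IsFanoEven) (h : F.Adapted b)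
    (hy : F.Cone [vec b (-1) (-1) (-1) (-1) (-1), vec b 1 0 0 0 0, vec b 0 1 0 0 0,
      vec b 0 0 1 0 0, vec b 0 0 0 0 1])
    (hz : F.Cone [vec b (-1) (-1) (-1) (-1) (-1), vec b 1 0 0 0 0, vec b 0 1 0 0 0,
      vec b 0 0 1 0 0, vec b 0 0 0 1 0]) (i : Fin 3) (l : Fin 4) :
    facet ![vec b 0 0 0 1 0, vec b 0 0 0 0 1, vec b (-1) (-1) (-1) (-1) (-1)] i ∪
      facet (collection b) l ∈ F.cones := by
  obtain ⟨b₁, hb₁, hvec₁⟩ := h.replace₄ (by norm_num) hz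
  obtain ⟨b', hb', hvec'⟩ := h.swap₃₄
  obtain ⟨b₂, hb₂, hvec₂⟩ := hb'.replace₄ (f₀ := -1) (f₁ := -1) (f₂ := -1) (f₃ := -1) (f₄ := -1)
    (by norm_num) (by simp only [hvec']; exact hy)
  have h0 := h.facet_union_mem hF l
  have h1 := hb₁.facet_union_mem hF l
  have h2 := hb₂.facet_union_mem hF l
  rw [collection_congr (b := b) (by simp [hvec₁])] at h1
  rw [collection_congr (b := b) (by simp [hvec₂, hvec'])] at h2
  simp only [hvec₁, hvec₂, hvec'] at h1 h2
  simp only [add_zero, zero_add, mul_neg, neg_zero, mul_one] at h1 h2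
  fin_cases i <;> simp only [Fin.zero_eta, Fin.mk_one, Fin.reduceFinMk, facet_three]
  · rw [Finset.union_comm]; exact h2
  · rw [Finset.union_comm]; exact h1
  · rw [Finset.union_comm]; exact h0

/-- If the common generator `w` opposite to `y` and `z` satisfies `y + z + w = x₀`, then renaming
the elements of the primitive collection gives `y + z + w = x₃`. -/
lemma exists_rename (hF : F.IsFanoEven) (h : F.Adapted b)
    (hy : F.Cone [vec b 1 0 0 (-1) (-1), vec b 1 0 0 0 0, vec b 0 1 0 0 0, vec b 0 0 1 0 0,
      vec b 0 0 0 0 1])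
    (hz : F.Cone [vec b 1 0 0 (-1) (-1), vec b 1 0 0 0 0, vec b 0 1 0 0 0, vec b 0 0 1 0 0,
      vec b 0 0 0 1 0]) : ∃ b', F.Adapted b' ∧
    F.Cone [vec b' (-1) (-1) (-1) (-1) (-1), vec b' 1 0 0 0 0, vec b' 0 1 0 0 0,
      vec b' 0 0 1 0 0, vec b' 0 0 0 0 1] ∧
    F.Cone [vec b' (-1) (-1) (-1) (-1) (-1), vec b' 1 0 0 0 0, vec b' 0 1 0 0 0,
      vec b' 0 0 1 0 0, vec b' 0 0 0 1 0] := by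
  obtain ⟨b', hb', hvec'⟩ := h.rotate hF
  obtain ⟨b₁, hb₁, hvec₁⟩ := h.replace₄ (by norm_num) hz
  obtain ⟨b₂, hb₂, hvec₂⟩ := h.swap₃₄
  obtain ⟨b₃, hb₃, hvec₃⟩ := hb₂.replace₄ (f₀ := 1) (f₁ := 0) (f₂ := 0) (f₃ := -1) (f₄ := -1)
    (by norm_num) (by simp only [hvec₂]; exact hy)
  have h1 := hb₁.exchange₀ hF
  have h3 := hb₃.exchange₀ hF
  simp only [hvec₁] at h1
  simp only [hvec₃, hvec₂] at h3
  norm_num at h1 h3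
  refine ⟨b', hb', ?_, ?_⟩ <;> simp only [hvec'] <;> norm_num
  · exact h3.of_subset (by simp)
  · exact h1.of_subset (by simp)

/-- The fan contains all the cones of full dimension of the fan of `ℙ¹ × ℙ¹ × ℙ³`, or all those of
the fan of `ℙ(𝒪 ⊕ 𝒪 ⊕ 𝒪 ⊕ 𝒪(1))` over `ℙ²`. -/
lemma classification (hF : F.IsFanoEven) (h : F.Adapted b) :
    (∀ (i j : Fin 2) (l : Fin 4), facet ![vec b 0 0 0 1 0, vec b 0 0 0 (-1) 0] i ∪
      facet ![vec b 0 0 0 0 1, vec b 0 0 0 0 (-1)] j ∪ facet (collection b) l ∈ F.cones) ∨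
    ∃ b', ∀ (i : Fin 3) (l : Fin 4),
      facet ![vec b' 0 0 0 1 0, vec b' 0 0 0 0 1, vec b' (-1) (-1) (-1) (-1) (-1)] i ∪
        facet (collection b') l ∈ F.cones := by
  rcases h.dichotomy hF with ⟨hy, hz⟩ | ⟨f₀, f₁, f₂, hy, hz⟩
  · exact Or.inl (h.product_cones hF hy hz)
  right
  suffices ∃ b', F.Adapted b' ∧
      F.Cone [vec b' (-1) (-1) (-1) (-1) (-1), vec b' 1 0 0 0 0, vec b' 0 1 0 0 0,
        vec b' 0 0 1 0 0, vec b' 0 0 0 0 1] ∧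
      F.Cone [vec b' (-1) (-1) (-1) (-1) (-1), vec b' 1 0 0 0 0, vec b' 0 1 0 0 0,
        vec b' 0 0 1 0 0, vec b' 0 0 0 1 0] by
    obtain ⟨b', hb', hy', hz'⟩ := this
    exact ⟨b', hb'.bundle_cones hF hy' hz'⟩
  have hf := (h.exponent_le hF (hy.mem_Gen (v := vec b f₀ f₁ f₂ (-1) (-1)) (by simp))).2.2 rfl
  rcases hf with ⟨rfl, rfl, rfl⟩ | ⟨rfl, rfl, rfl⟩ | ⟨rfl, rfl, rfl⟩ | ⟨rfl, rfl, rfl⟩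
  · exact ⟨b, h, hy, hz⟩
  · exact h.exists_rename hF hy hz
  · obtain ⟨b₁, hb₁, hvec₁⟩ := h.swap₀₁
    exact hb₁.exists_rename hF (by simp only [hvec₁]; exact hy.of_subset (by simp))
      (by simp only [hvec₁]; exact hz.of_subset (by simp))
  · obtain ⟨b₁, hb₁, hvec₁⟩ := h.swap₁₂
    obtain ⟨b₂, hb₂, hvec₂⟩ := hb₁.swap₀₁
    exact hb₂.exists_rename hF (by simp only [hvec₂, hvec₁]; exact hy.of_subset (by simp))
      (by simp only [hvec₂, hvec₁]; exact hz.of_subset (by simp))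

end Adapted
end SmoothCompleteFan
/-! ### From the variety to its fan -/

namespace SmoothCompleteFan

section

variable {d : ℕ} (F : SmoothCompleteFan d) (k : Type u) [Field k]

/-- The geometric hypotheses in combinatorial form: ampleness bounds the functional of a cone of
full dimension by `1` on all generators, strictly across walls, and divisibility of the canonical
class by `2` makes its values odd. -/
lemma isFanoEven (hFano : IsSmoothFano (F.structureMap k) d)
    (hindex : IsIndex (F.structureMap k) d 2) : F.IsFanoEven := by
  obtain ⟨-, -, K, hK, -, hA⟩ := hFano
  obtain ⟨⟨-, K', H, hK', -, hH⟩, -⟩ := hindex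
  exact isFanoEven_of
    (fun b b' hb hb' v hv => ⟨F.coordSum_le_one k K hK hA b b' hb hb' hv,
      F.odd_coordSum k K' H hK' hH b b' hb hb' hv⟩)
    (fun b b' hb hb' i hij hi => F.coordSum_ne_one_of_wall k K hK hA b b' hb hb' i hij hi)

variable {F}

/-- A lattice basis is determined by the generators of a cone of full dimension and a dual family of
functionals. -/
lemma exists_basis_of_dual {σ : Type*} [Fintype σ] [DecidableEq σ] (hσ : Fintype.card σ = d)
    {t : Finset (Fin d → ℤ)} (ht : t ∈ F.cones) (v : σ → Fin d → ℤ)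
    (w : σ → Module.Dual ℤ (Fin d → ℤ)) (hv : ∀ x, x ∈ t ↔ ∃ s, v s = x)
    (hwv : ∀ s s', w s (v s') = if s = s' then 1 else 0) :
    ∃ (e : σ ≃ Fin d) (b : Module.Basis (Fin d) ℤ (Fin d → ℤ)), gens b = t ∧
      (∀ s, b (e s) = v s) ∧ ∀ s, b.coord (e s) = w s := by
  let e := Fintype.equivFinOfCardEq hσ
  have hinj : Function.Injective v := fun s s' h => by
    have h1 := hwv s s'
    rw [← h, hwv s s, if_pos rfl] at h1
    by_contra hne
    rw [if_neg hne] at h1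
    exact one_ne_zero h1
  have himg : Finset.univ.image (v ∘ e.symm) = t := by
    ext x
    rw [hv]
    simp only [Finset.mem_image, Finset.mem_univ, true_and, Function.comp_apply]
    exact ⟨fun ⟨i, hi⟩ => ⟨_, hi⟩, fun ⟨s, hs⟩ => ⟨e s, by simpa using hs⟩⟩
  obtain ⟨b, hb, -⟩ := F.exists_basis_of_image_mem (v ∘ e.symm) (hinj.comp e.symm.injective)
    (himg ▸ ht)
  refine ⟨e, b, by rw [← himg, gens, hb], fun s => by simp [hb], fun s => b.ext fun i => ?_⟩
  obtain ⟨s', rfl⟩ := e.surjective i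
  have h1 : b (e s') = v s' := by simp [hb]
  rw [Module.Basis.coord_apply, Module.Basis.repr_self, h1, hwv, Finsupp.single_apply]
  simp only [e.apply_eq_iff_eq, eq_comm]

/-- A cone of the fan is a face of a given cone of full dimension if the sum of its generators lies
in the latter one. -/
lemma subset_of_nonneg {σ : Type*} [Fintype σ] [DecidableEq σ] (hσ : Fintype.card σ = d)
    {c t : Finset (Fin d → ℤ)} (hc : c ∈ F.cones) (ht : t ∈ F.cones) (v : σ → Fin d → ℤ)
    (w : σ → Module.Dual ℤ (Fin d → ℤ)) (hv : ∀ x, x ∈ t ↔ ∃ s, v s = x)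
    (hwv : ∀ s s', w s (v s') = if s = s' then 1 else 0)
    (h : ∀ s, 0 ≤ w s (∑ x ∈ c, x)) : c ⊆ t := by
  obtain ⟨e, b, rfl, -, hcoord⟩ := exists_basis_of_dual hσ ht v w hv hwv
  have hsub : ↑(gens b) ⊆ Set.range b := fun w hw => mem_gens.1 hw
  obtain ⟨r, hr, hr'⟩ := eq_sum_of_coord_eq_zero hsub (∑ x ∈ c, x)
    fun i hi => absurd (mem_gens.2 ⟨i, rfl⟩) hi
  intro x hx
  refine (F.mem_and_eq_of_sum_eq hc ht (s := fun _ => 1) (s' := r) (fun _ _ => zero_le_one) ?_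
    (by simpa using hr) hx zero_lt_one).1
  intro y hy
  obtain ⟨i, rfl⟩ := mem_gens.1 hy
  obtain ⟨s, rfl⟩ := e.surjective i
  rw [hr', hcoord]
  exact h s


/-- The characters that are dual to the generators of a cone of full dimension are coordinates on
its chart, which is an affine space. -/
lemma bijective_aeval_dual {σ : Type*} [Fintype σ] [DecidableEq σ] (hσ : Fintype.card σ = d)
    {t : Finset (Fin d → ℤ)} (ht : t ∈ F.cones) (v : σ → Fin d → ℤ)
    (w : σ → dualMonoid t) (hv : ∀ x, x ∈ t ↔ ∃ s, v s = x)
    (hwv : ∀ s s', (w s).1 (v s') = if s = s' then 1 else 0) :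
    Function.Bijective (MvPolynomial.aeval (R := k)
      (fun s => (AddMonoidAlgebra.single (w s) 1 : ChartRing k t))) := by
  obtain ⟨e, b, rfl, -, hcoord⟩ := exists_basis_of_dual hσ ht v (fun s => (w s).1) hv hwv
  have : (MvPolynomial.aeval (R := k)
      (fun s => (AddMonoidAlgebra.single (w s) 1 : ChartRing k (gens b)))) =
      ((polynomialEquiv k b).toAlgHom.comp (MvPolynomial.renameEquiv k e).toAlgHom) := by
    refine MvPolynomial.algHom_ext fun s => ?_
    simp only [MvPolynomial.aeval_X, AlgHom.comp_apply]
    change _ = polynomialEquiv k b (MvPolynomial.rename e (MvPolynomial.X s))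
    rw [MvPolynomial.rename_X, polynomialEquiv_X, coordVar]
    congr 1
    exact Subtype.ext (hcoord s).symm
  rw [this]
  exact (polynomialEquiv k b).bijective.comp (MvPolynomial.renameEquiv k e).bijective

end

section

variable {F : SmoothCompleteFan 5}

/-- Three of the elements of the primitive collection span a cone, which is completed to a cone of
full dimension by two more generators. -/
lemma exists_adapted {P : Finset (Fin 5 → ℤ)} (hP : F.IsPrimitiveCollection P) (hcard : P.card = 4)
    (hsum : ∑ x ∈ P, x = 0) : ∃ b, F.Adapted b := by
  obtain ⟨x₀, P', hx₀, rfl, hP'⟩ := Finset.card_eq_succ.1 hcard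
  obtain ⟨x₁, x₂, x₃, h12, h13, h23, rfl⟩ := Finset.card_eq_three.1 hP'
  simp only [Finset.mem_insert, Finset.mem_singleton, not_or] at hx₀
  obtain ⟨h01, h02, h03⟩ := hx₀
  have hfour : x₀ + (x₁ + (x₂ + x₃)) = 0 := by
    rw [← hsum, Finset.sum_insert (by simp [h01, h02, h03]), Finset.sum_insert (by simp [h12, h13]),
      Finset.sum_insert (by simp [h23]), Finset.sum_singleton]
  have hcone : ∀ L : List (Fin 5 → ℤ), (∀ v ∈ L, v ∈ ({x₀, x₁, x₂, x₃} : Finset (Fin 5 → ℤ))) →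
      (∃ v ∈ ({x₀, x₁, x₂, x₃} : Finset (Fin 5 → ℤ)), v ∉ L) → F.Cone L := by
    rintro L hL ⟨v, hv, hvL⟩
    refine hP.2.2 _ ⟨fun w hw => hL w (List.mem_toFinset.1 hw), fun hsub => hvL ?_⟩
    exact List.mem_toFinset.1 (hsub hv)
  obtain ⟨b', hsub, hb'⟩ := F.exists_gens_superset (hcone [x₀, x₁, x₂] (by simp)
    ⟨x₃, by simp, by simp [Ne.symm h03, Ne.symm h13, Ne.symm h23]⟩)
  have hcard5 : (gens b').card = 5 := by
    rw [gens, Finset.card_image_of_injective _ b'.injective, Finset.card_univ, Fintype.card_fin]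
  have hcard3 : ([x₀, x₁, x₂].toFinset).card = 3 :=
    List.toFinset_card_of_nodup (by simp [h01, h02, h12])
  obtain ⟨y, z, hyz, hdiff⟩ := Finset.card_eq_two.1 (show (gens b' \ [x₀, x₁, x₂].toFinset).card = 2
    by rw [Finset.card_sdiff_of_subset hsub, hcard5, hcard3])
  have hy : y ∈ gens b' \ [x₀, x₁, x₂].toFinset := by rw [hdiff]; simp
  have hz : z ∈ gens b' \ [x₀, x₁, x₂].toFinset := by rw [hdiff]; simp
  simp only [Finset.mem_sdiff, List.mem_toFinset, List.mem_cons, List.not_mem_nil, or_false,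
    not_or] at hy hz
  have hc : F.Cone [x₀, x₁, x₂, y, z] := F.face_mem _ hb' _ fun v hv => by
    simp only [List.mem_toFinset, List.mem_cons, List.not_mem_nil, or_false] at hv
    rcases hv with rfl | rfl | rfl | rfl | rfl
    · exact hsub (by simp)
    · exact hsub (by simp)
    · exact hsub (by simp)
    · exact hy.1
    · exact hz.1
  obtain ⟨b, hb, hvec, -⟩ := hc.exists_vec (by
    simp only [List.nodup_cons, List.mem_cons, List.not_mem_nil, or_false, not_or]
    exact ⟨⟨h01, h02, Ne.symm hy.2.1, Ne.symm hz.2.1⟩, ⟨h12, Ne.symm hy.2.2.1, Ne.symm hz.2.2.1⟩,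
      ⟨Ne.symm hy.2.2.2, Ne.symm hz.2.2.2⟩, hyz, by simp⟩)
  have e0 : vec b 1 0 0 0 0 = x₀ := by rw [hvec]; module
  have e1 : vec b 0 1 0 0 0 = x₁ := by rw [hvec]; module
  have e2 : vec b 0 0 1 0 0 = x₂ := by rw [hvec]; module
  have e3 : vec b (-1) (-1) (-1) 0 0 = x₃ := by
    rw [hvec, eq_comm, ← sub_eq_zero, ← hfour]
    module
  refine ⟨b, hb, ?_, ?_, ?_⟩ <;> simp only [e0, e1, e2, e3]
  · exact hcone _ (by simp) ⟨x₀, by simp, by simp [h01, h02, h03]⟩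
  · exact hcone _ (by simp) ⟨x₁, by simp, by simp [Ne.symm h01, h12, h13]⟩
  · exact hcone _ (by simp) ⟨x₂, by simp, by simp [Ne.symm h02, Ne.symm h12, h23]⟩

end

end SmoothCompleteFan
/-! ### Coordinate rings of the standard affine open subsets of `ℙⁿ` -/

section ProjectiveSpace

variable {k : Type u} [Field k] {n : ℕ}

attribute [local instance] MvPolynomial.gradedAlgebra

/-- The homogeneous coordinate ring of `ℙⁿ`, with its grading. -/
noncomputable abbrev grading (k : Type u) [Field k] (n : ℕ) :
    ℕ → Submodule k (MvPolynomial (Fin (n + 1)) k) :=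
  MvPolynomial.homogeneousSubmodule (Fin (n + 1)) k

lemma X_mem_grading (i : Fin (n + 1)) : MvPolynomial.X i ∈ grading k n 1 :=
  MvPolynomial.isHomogeneous_X k i

/-- The coordinate ring of the standard affine open subset `{x_i ≠ 0}` of `ℙⁿ`. -/
abbrev AwayRing (k : Type u) [Field k] (n : ℕ) (i : Fin (n + 1)) : Type u :=
  HomogeneousLocalization.Away (grading k n) (MvPolynomial.X i)

noncomputable instance (i : Fin (n + 1)) : Algebra k (AwayRing k n i) :=
  ((HomogeneousLocalization.fromZeroRingHom (grading k n) _).comp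
    (algebraMap k (grading k n 0))).toAlgebra

/-- The function `x_j / x_i` on `{x_i ≠ 0}`. -/
noncomputable def ratio (k : Type u) [Field k] {n : ℕ} (i j : Fin (n + 1)) : AwayRing k n i :=
  HomogeneousLocalization.Away.mk (grading k n) (X_mem_grading i) 1
    (MvPolynomial.X j) (X_mem_grading j)

/-- Substitution of `c y` for the variables multiplies a form of degree `m` by `c ^ m`. -/
lemma eval₂_mul_of_isHomogeneous {σ R : Type*} [CommRing R] (f : k →+* R) (c : R) (y : σ → R)
    {a : MvPolynomial σ k} {m : ℕ} (ha : a.IsHomogeneous m) :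
    MvPolynomial.eval₂ f (fun j => c * y j) a = c ^ m * MvPolynomial.eval₂ f y a := by
  rw [MvPolynomial.eval₂_eq, MvPolynomial.eval₂_eq, Finset.mul_sum]
  refine Finset.sum_congr rfl fun s hs => ?_
  simp_rw [mul_pow]
  rw [Finset.prod_mul_distrib, Finset.prod_pow_eq_pow_sum,
    ← ha.degree_eq_sum_deg_support hs]
  ring

lemma val_algebraMap (i : Fin (n + 1)) (x : k) :
    (algebraMap k (AwayRing k n i) x).val =
      algebraMap (MvPolynomial (Fin (n + 1)) k) _ (MvPolynomial.C x) := rfl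

lemma val_ratio (i j : Fin (n + 1)) : (ratio k i j).val =
    Localization.mk (MvPolynomial.X j : MvPolynomial (Fin (n + 1)) k)
      (⟨MvPolynomial.X i ^ 1, 1, rfl⟩ : Submonoid.powers (MvPolynomial.X i)) := rfl

/-- Dehomogenization. -/
lemma mk_eq_aeval_ratio (i : Fin (n + 1)) (m : ℕ) (a : MvPolynomial (Fin (n + 1)) k)
    (ha : a ∈ grading k n (m • 1)) :
    HomogeneousLocalization.Away.mk (grading k n) (X_mem_grading i) m a ha =
      MvPolynomial.aeval (ratio k i) a := by
  apply HomogeneousLocalization.val_injective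
  let v : AwayRing k n i →+* Localization.Away (MvPolynomial.X i : MvPolynomial (Fin (n + 1)) k) :=
    algebraMap _ _
  let A : MvPolynomial (Fin (n + 1)) k →+*
    Localization.Away (MvPolynomial.X i : MvPolynomial (Fin (n + 1)) k) := algebraMap _ _
  have h1 : (MvPolynomial.aeval (ratio k i) a).val =
      MvPolynomial.eval₂ (A.comp MvPolynomial.C) (fun j => v (ratio k i j)) a := by
    change v (MvPolynomial.aeval (ratio k i) a) = _
    rw [MvPolynomial.aeval_def, MvPolynomial.hom_eval₂]
    rfl
  have h2 : ∀ j, A (MvPolynomial.X j) = A (MvPolynomial.X i) * v (ratio k i j) := fun j => by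
    change _ = _ * (ratio k i j).val
    rw [val_ratio, ← Localization.mk_one_eq_algebraMap, ← Localization.mk_one_eq_algebraMap,
      Localization.mk_mul, Localization.mk_eq_mk_iff, Localization.r_iff_exists]
    exact ⟨1, by simp⟩
  have h3 : A a = A (MvPolynomial.X i) ^ m *
      MvPolynomial.eval₂ (A.comp MvPolynomial.C) (fun j => v (ratio k i j)) a := by
    rw [← eval₂_mul_of_isHomogeneous (m := m) _ _ _ (by simpa using ha)]
    simp_rw [← h2]
    have h4 := MvPolynomial.hom_eval₂ a MvPolynomial.C A MvPolynomial.X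
    rw [MvPolynomial.eval₂_eta] at h4
    exact h4
  have hu : IsUnit (A (MvPolynomial.X i) ^ m) :=
    (IsLocalization.Away.algebraMap_isUnit (MvPolynomial.X i)).pow m
  rw [HomogeneousLocalization.Away.val_mk, h1]
  apply hu.mul_left_cancel
  rw [← h3, ← map_pow]
  change algebraMap _ _ _ * _ = algebraMap _ _ _
  rw [← Localization.mk_one_eq_algebraMap, ← Localization.mk_one_eq_algebraMap,
    Localization.mk_mul, Localization.mk_eq_mk_iff, Localization.r_iff_exists]
  exact ⟨1, by simp⟩

lemma aeval_ratio_surjective (i : Fin (n + 1)) :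
    Function.Surjective (MvPolynomial.aeval (R := k) (ratio k i)) := fun x => by
  obtain ⟨m, a, ha, rfl⟩ := HomogeneousLocalization.Away.mk_surjective (grading k n)
    (X_mem_grading i) x
  exact ⟨a, (mk_eq_aeval_ratio i m a ha).symm⟩

@[simp]
lemma ratio_self (i : Fin (n + 1)) : ratio k i i = 1 := by
  apply HomogeneousLocalization.val_injective
  rw [val_ratio, HomogeneousLocalization.val_one]
  simp

lemma awayRing_hom_ext {R : Type*} [CommRing R] [Algebra k R] {i : Fin (n + 1)}
    {f g : AwayRing k n i →ₐ[k] R} (h : ∀ j, f (ratio k i j) = g (ratio k i j)) : f = g := by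
  rw [← AlgHom.cancel_right (aeval_ratio_surjective i)]
  exact MvPolynomial.algHom_ext fun j => by simpa using h j

variable {R : Type u} [CommRing R] [Algebra k R]

/-- The homomorphism that corresponds to the point of `{x_i ≠ 0}` with homogeneous coordinates `r`
in `R`. -/
noncomputable def pointHom (i : Fin (n + 1)) (r : Fin (n + 1) → R) (hr : IsUnit (r i)) :
    AwayRing k n i →ₐ[k] R where
  __ := (Localization.awayLift (MvPolynomial.aeval (R := k) r).toRingHom (MvPolynomial.X i)
    (by simpa using hr)).comp (algebraMap _ _)
  commutes' x := by
    change Localization.awayLift (MvPolynomial.aeval (R := k) r).toRingHom (MvPolynomial.X i)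
      (by simpa using hr) (algebraMap k (AwayRing k n i) x).val = _
    rw [val_algebraMap, IsLocalization.Away.lift_eq]
    exact MvPolynomial.aeval_C _ _

lemma pointHom_apply (i : Fin (n + 1)) (r : Fin (n + 1) → R) (hr : IsUnit (r i))
    (x : AwayRing k n i) : pointHom i r hr x =
      Localization.awayLift (MvPolynomial.aeval (R := k) r).toRingHom (MvPolynomial.X i)
        (by simpa using hr) x.val := rfl

lemma pointHom_ratio (i j : Fin (n + 1)) (r : Fin (n + 1) → R) (hr : IsUnit (r i)) :
    r i * pointHom (k := k) i r hr (ratio k i j) = r j := by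
  obtain ⟨u, hu⟩ := id hr
  rw [pointHom_apply, val_ratio, Localization.awayLift_mk (v := ((u⁻¹ : Rˣ) : R))]
  · simp only [AlgHom.toRingHom_eq_coe, RingHom.coe_coe, MvPolynomial.aeval_X, pow_one, ← hu]
    rw [mul_left_comm, Units.mul_inv, mul_one]
  · simp [← hu]

end ProjectiveSpace

/-! ### Morphisms from affine schemes to `ℙⁿ` -/

/-- The sections of `Proj` over a standard affine open subset, as functions on an affine scheme. -/
lemma awayToSection_appLE_awayι {A σ : Type u} [CommRing A] [SetLike σ A] [AddSubgroupClass σ A]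
    (𝒜 : ℕ → σ) [GradedRing 𝒜] {f : A} {m : ℕ} (hf : f ∈ 𝒜 m) (hm : 0 < m)
    (h : ⊤ ≤ Proj.awayι 𝒜 f hf hm ⁻¹ᵁ Proj.basicOpen 𝒜 f) :
    Proj.awayToSection 𝒜 f ≫ (Proj.awayι 𝒜 f hf hm).appLE (Proj.basicOpen 𝒜 f) ⊤ h =
      (Scheme.ΓSpecIso _).inv := by
  have h0 : (Proj.basicOpen 𝒜 f).ι.appLE (Proj.basicOpen 𝒜 f) ⊤ (by simp) =
      (Proj.basicOpen 𝒜 f).topIso.inv := by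
    rw [Scheme.Opens.ι_appLE, Scheme.Opens.topIso_inv]
    rfl
  have h1 : (Proj.awayι 𝒜 f hf hm).appLE (Proj.basicOpen 𝒜 f) ⊤ h =
      (Proj.basicOpen 𝒜 f).topIso.inv ≫ (Proj.basicOpenIsoSpec 𝒜 f hf hm).inv.appTop := by
    rw [← h0]
    refine (Scheme.Hom.appLE_comp_appLE (Proj.basicOpenIsoSpec 𝒜 f hf hm).inv
      (Proj.basicOpen 𝒜 f).ι (Proj.basicOpen 𝒜 f) ⊤ ⊤ (by simp) le_top).symm.trans ?_
    exact congrArg _ (Scheme.Hom.appLE_eq_app _)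
  have h2 : Proj.awayToSection 𝒜 f ≫ (Proj.basicOpen 𝒜 f).topIso.inv =
      (Scheme.ΓSpecIso _).inv ≫ (Proj.basicOpenIsoSpec 𝒜 f hf hm).hom.appTop := by
    rw [Proj.basicOpenIsoSpec_hom]
    refine Eq.trans ?_ congr((Scheme.ΓSpecIso _).inv ≫ $(Proj.basicOpenToSpec_app_top 𝒜 f)).symm
    rw [Iso.inv_hom_id_assoc]
  rw [h1, reassoc_of% h2, ← Scheme.Hom.comp_appTop, Iso.inv_hom_id]
  simp

section ProjectiveSpace

variable {k : Type u} [Field k] {n : ℕ}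

attribute [local instance] MvPolynomial.gradedAlgebra

variable {R : Type u} [CommRing R] [Algebra k R]

lemma eq_pointHom {i : Fin (n + 1)} {r : Fin (n + 1) → R} (hr : IsUnit (r i))
    {f : AwayRing k n i →ₐ[k] R} (h : ∀ j, r i * f (ratio k i j) = r j) : f = pointHom i r hr :=
  awayRing_hom_ext fun j => hr.mul_left_cancel ((h j).trans (pointHom_ratio i j r hr).symm)

lemma pointHom_mul {i : Fin (n + 1)} {r r' : Fin (n + 1) → R} (hr : IsUnit (r i))
    (hr' : IsUnit (r' i)) (c : R) (h : ∀ j, r' j = c * r j) :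
    pointHom (k := k) i r hr = pointHom i r' hr' :=
  eq_pointHom _ fun j => by rw [h, h, mul_assoc, pointHom_ratio]

lemma comp_pointHom {R' : Type u} [CommRing R'] [Algebra k R'] (g : R →ₐ[k] R') {i : Fin (n + 1)}
    {r : Fin (n + 1) → R} (hr : IsUnit (r i)) {r' : Fin (n + 1) → R'} (hr' : IsUnit (r' i))
    (h : ∀ j, r' j = g (r j)) :
    g.comp (pointHom i r hr) = pointHom i r' hr' :=
  eq_pointHom _ fun j => by rw [h, h, AlgHom.comp_apply, ← map_mul, pointHom_ratio]

variable (k) in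
/-- The inclusion of the standard affine open subset `{x_i ≠ 0}`. -/
noncomputable def affineι (i : Fin (n + 1)) : Spec (.of (AwayRing k n i)) ⟶ ProjSpace k n :=
  Proj.awayι (grading k n) (MvPolynomial.X i) (X_mem_grading i) one_pos

instance (i : Fin (n + 1)) : IsOpenImmersion (affineι k i) :=
  inferInstanceAs (IsOpenImmersion (Proj.awayι _ _ _ _))

lemma opensRange_affineι (i : Fin (n + 1)) : (affineι k i).opensRange = stdOpen k n i :=
  Proj.opensRange_awayι _ _ _ _

lemma range_affineι (i : Fin (n + 1)) : Set.range (affineι k i) = stdOpen k n i :=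
  congrArg (fun U : (ProjSpace k n).Opens => (U : Set (ProjSpace k n))) (opensRange_affineι i)

lemma affineι_projStr (i : Fin (n + 1)) : affineι k i ≫ projStr k n =
    Spec.map (CommRingCat.ofHom (algebraMap k (AwayRing k n i))) := by
  rw [affineι, projStr]
  erw [Proj.awayι_toSpecZero_assoc]
  rw [← Spec.map_comp]
  rfl

lemma iSup_stdOpen : ⨆ i, stdOpen k n i = ⊤ := by
  refine Proj.iSup_basicOpen_eq_top' (grading k n) (fun i => MvPolynomial.X i)
    (fun i => ⟨1, X_mem_grading i⟩) (top_le_iff.1 fun p _ => ?_)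
  induction p using MvPolynomial.induction_on with
  | C x => exact Subalgebra.algebraMap_mem _ (algebraMap k (grading k n 0) x)
  | add p q hp hq => exact add_mem (hp trivial) (hq trivial)
  | mul_X p i hp => exact mul_mem (hp trivial) (Algebra.subset_adjoin ⟨i, rfl⟩)

/-- The morphism from an affine scheme to `ℙⁿ` with homogeneous coordinates `r`, of which `r i` is
invertible. -/
noncomputable def toProj (i : Fin (n + 1)) (r : Fin (n + 1) → R) (hr : IsUnit (r i)) :
    Spec (.of R) ⟶ ProjSpace k n :=
  Spec.map (CommRingCat.ofHom (pointHom (k := k) i r hr).toRingHom) ≫ affineι k i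

lemma toProj_projStr (i : Fin (n + 1)) (r : Fin (n + 1) → R) (hr : IsUnit (r i)) :
    toProj i r hr ≫ projStr k n = Spec.map (CommRingCat.ofHom (algebraMap k R)) := by
  rw [toProj, Category.assoc, affineι_projStr, ← Spec.map_comp, ← CommRingCat.ofHom_comp]
  congr 2
  exact (pointHom i r hr).comp_algebraMap

lemma toProj_mul {i : Fin (n + 1)} {r r' : Fin (n + 1) → R} (hr : IsUnit (r i))
    (hr' : IsUnit (r' i)) (c : R) (h : ∀ j, r' j = c * r j) :
    toProj (k := k) i r hr = toProj i r' hr' := by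
  rw [toProj, toProj, pointHom_mul hr hr' c h]

lemma map_toProj {R' : Type u} [CommRing R'] [Algebra k R'] (g : R →ₐ[k] R') {i : Fin (n + 1)}
    {r : Fin (n + 1) → R} (hr : IsUnit (r i)) {r' : Fin (n + 1) → R'} (hr' : IsUnit (r' i))
    (h : ∀ j, r' j = g (r j)) :
    Spec.map (CommRingCat.ofHom g.toRingHom) ≫ toProj i r hr = toProj (k := k) i r' hr' := by
  rw [toProj, toProj, ← comp_pointHom g hr hr' h, ← Spec.map_comp_assoc, ← CommRingCat.ofHom_comp]
  rfl

/-- Where two of the coordinates are invertible, both of them define the same morphism. -/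
lemma toProj_congr (i j : Fin (n + 1)) (r : Fin (n + 1) → R) (hi : IsUnit (r i))
    (hj : IsUnit (r j)) : toProj (k := k) i r hi = toProj j r hj := by
  let A := (MvPolynomial.aeval (R := k) r).toRingHom
  have hij : IsUnit (A (MvPolynomial.X i * MvPolynomial.X j)) := by
    simpa [A] using ⟨hi, hj⟩
  let L : HomogeneousLocalization.Away (grading k n)
      (MvPolynomial.X i * MvPolynomial.X j : MvPolynomial (Fin (n + 1)) k) →+* R :=
    (Localization.awayLift A _ hij).comp (algebraMap _ _)
  have key : ∀ (l m : Fin (n + 1)) (hl : IsUnit (r l))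
      (h : (MvPolynomial.X i * MvPolynomial.X j : MvPolynomial (Fin (n + 1)) k) =
        MvPolynomial.X l * MvPolynomial.X m),
      toProj (k := k) l r hl = Spec.map (CommRingCat.ofHom L) ≫
        Proj.awayι (grading k n) (MvPolynomial.X i * MvPolynomial.X j)
          (h ▸ SetLike.mul_mem_graded (X_mem_grading l) (X_mem_grading m)) two_pos := by
    intro l m hl h
    rw [toProj, affineι]
    have h1 := Proj.SpecMap_awayMap_awayι (grading k n) (X_mem_grading l) one_pos
      (X_mem_grading m) h
    erw [← h1]
    rw [← Spec.map_comp_assoc, ← CommRingCat.ofHom_comp]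
    congr 3
    ext x
    change Localization.awayLift A (MvPolynomial.X l) (by simpa [A] using hl) x.val =
      Localization.awayLift A _ hij
        (HomogeneousLocalization.awayMap (grading k n) (X_mem_grading m) h x).val
    rw [HomogeneousLocalization.val_awayMap, ← RingHom.comp_apply]
    congr 1
    refine IsLocalization.ringHom_ext
      (Submonoid.powers (MvPolynomial.X l : MvPolynomial (Fin (n + 1)) k)) (RingHom.ext fun a => ?_)
    simp [IsLocalization.Away.lift_eq]
  rw [key i j hi rfl, key j i hj (mul_comm _ _)]

lemma preimage_toProj (i j : Fin (n + 1)) (r : Fin (n + 1) → R) (hr : IsUnit (r i))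
    (z : Spec (.of R)) : toProj (k := k) i r hr z ∈ stdOpen k n j ↔ r j ∉ z.asIdeal := by
  have h1 : affineι k i ⁻¹ᵁ stdOpen k n j = PrimeSpectrum.basicOpen (ratio k i j) := by
    rw [affineι, stdOpen]
    erw [Proj.awayι_preimage_basicOpen (grading k n) (X_mem_grading i) one_pos (X_mem_grading j)
      one_pos]
    congr 1
    apply HomogeneousLocalization.val_injective
    rw [val_ratio]
    simp
  have h2 : toProj (k := k) i r hr z ∈ stdOpen k n j ↔
      Spec.map (CommRingCat.ofHom (pointHom (k := k) i r hr).toRingHom) z ∈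
        affineι k i ⁻¹ᵁ stdOpen k n j := Iff.rfl
  rw [h2, h1]
  change pointHom (k := k) i r hr (ratio k i j) ∉ z.asIdeal ↔ _
  rw [← pointHom_ratio (k := k) i j r hr, not_iff_not]
  refine ⟨fun h => Ideal.mul_mem_left _ _ h, fun h => ?_⟩
  exact (Ideal.unit_mul_mem_iff_mem _ hr).1 h

lemma appLE_affineι (i j : Fin (n + 1)) (h : ⊤ ≤ affineι k i ⁻¹ᵁ stdOpen k n i) :
    ((affineι k i).appLE (stdOpen k n i) ⊤ h).hom (coordRatio k n i j) =
      (Scheme.ΓSpecIso (.of (AwayRing k n i))).inv.hom (ratio k i j) :=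
  congr($(awayToSection_appLE_awayι (grading k n) (X_mem_grading i) one_pos h) (ratio k i j))

lemma appLE_toProj (i j : Fin (n + 1)) (r : Fin (n + 1) → R) (hr : IsUnit (r i))
    (h : ⊤ ≤ toProj (k := k) i r hr ⁻¹ᵁ stdOpen k n i) :
    ((toProj (k := k) i r hr).appLE (stdOpen k n i) ⊤ h).hom (coordRatio k n i j) =
      (Scheme.ΓSpecIso (.of R)).inv.hom (pointHom (k := k) i r hr (ratio k i j)) := by
  have h1 : ⊤ ≤ affineι k i ⁻¹ᵁ stdOpen k n i := by
    rw [← opensRange_affineι]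
    simp
  have h2 := Scheme.Hom.appLE_comp_appLE
    (Spec.map (CommRingCat.ofHom (pointHom (k := k) i r hr).toRingHom)) (affineι k i)
    (stdOpen k n i) ⊤ ⊤ h1 le_top
  have h3 := Scheme.ΓSpecIso_inv_naturality (CommRingCat.ofHom (pointHom (k := k) i r hr).toRingHom)
  have h4 : (toProj (k := k) i r hr).appLE (stdOpen k n i) ⊤ h =
    (affineι k i).appLE (stdOpen k n i) ⊤ h1 ≫
    (Spec.map (CommRingCat.ofHom (pointHom (k := k) i r hr).toRingHom)).appTop := by
    exact h2.symm.trans (congrArg _ (Scheme.Hom.appLE_eq_app _))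
  rw [h4, CommRingCat.comp_apply, appLE_affineι]
  exact congr($h3 (ratio k i j)).symm

end ProjectiveSpace

/-! ### Gluing morphisms, and criteria for isomorphisms and pullback squares -/

/-- A morphism is an isomorphism if its source is covered by open subschemes that are the full
preimages of open subschemes of the target and map to these isomorphically. -/
lemma isIso_of_isOpenImmersion_comp {X Y : Scheme.{u}} (f : X ⟶ Y) {ι : Type*} {U : ι → Scheme.{u}}
    (g : ∀ i, U i ⟶ X) [∀ i, IsOpenImmersion (g i)] (hg : ∀ i, IsOpenImmersion (g i ≫ f))
    (hcov : ∀ y, ∃ i, y ∈ Set.range (g i ≫ f))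
    (hpre : ∀ i x, f x ∈ Set.range (g i ≫ f) → x ∈ Set.range (g i)) : IsIso f := by
  have : IsOpenImmersion f := by
    refine .of_forall_source_exists f (fun x y hxy => ?_) fun x => ?_
    · obtain ⟨i, hi⟩ := hcov (f x)
      obtain ⟨x', rfl⟩ := hpre i x hi
      obtain ⟨y', rfl⟩ := hpre i y (hxy ▸ hi)
      exact congrArg _ ((g i ≫ f).injective hxy)
    · obtain ⟨i, hi⟩ := hcov (f x)
      exact ⟨U i, g i, inferInstance, hpre i x hi, hg i⟩
  refine isIso_of_isOpenImmersion_of_opensRange_eq_top f (top_le_iff.1 fun y _ => ?_)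
  obtain ⟨i, z, rfl⟩ := hcov y
  exact ⟨g i z, rfl⟩

/-- A square of schemes is a pullback square if it is one on the members of suitable open covers. -/
lemma isPullback_of_isOpenImmersion {W B Z S : Scheme.{u}} {p : W ⟶ B} {q : W ⟶ Z} {b : B ⟶ S}
    {z : Z ⟶ S} (w : p ≫ b = q ≫ z) {ι : Type*} {U V T : ι → Scheme.{u}} (g : ∀ i, U i ⟶ W)
    [∀ i, IsOpenImmersion (g i)] (β : ∀ i, V i ⟶ B) [∀ i, IsOpenImmersion (β i)]
    (ζ : ∀ i, T i ⟶ Z) [∀ i, IsOpenImmersion (ζ i)] (p' : ∀ i, U i ⟶ V i) (q' : ∀ i, U i ⟶ T i)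
    (hp : ∀ i, g i ≫ p = p' i ≫ β i) (hq : ∀ i, g i ≫ q = q' i ≫ ζ i)
    (h : ∀ i, IsPullback (p' i) (q' i) (β i ≫ b) (ζ i ≫ z))
    (hcov : ∀ x y, ∃ i, x ∈ Set.range (β i) ∧ y ∈ Set.range (ζ i))
    (hpre : ∀ i x, p x ∈ Set.range (β i) → q x ∈ Set.range (ζ i) → x ∈ Set.range (g i)) :
    IsPullback p q b z := by
  let f : W ⟶ pullback b z := pullback.lift p q w
  let m (i) : pullback (β i ≫ b) (ζ i ≫ z) ⟶ pullback b z :=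
    pullback.map _ _ _ _ (β i) (ζ i) (𝟙 S) (by simp) (by simp)
  have hm : ∀ i, IsOpenImmersion (m i) := fun i => inferInstance
  have hgf : ∀ i, g i ≫ f = (h i).isoPullback.hom ≫ m i := fun i => by
    apply pullback.hom_ext
    · rw [Category.assoc, pullback.lift_fst, hp, Category.assoc, pullback.lift_fst,
        IsPullback.isoPullback_hom_fst_assoc]
    · rw [Category.assoc, pullback.lift_snd, hq, Category.assoc, pullback.lift_snd,
        IsPullback.isoPullback_hom_snd_assoc]
  have hr : ∀ i, Set.range (g i ≫ f) =
      pullback.fst b z ⁻¹' Set.range (β i) ∩ pullback.snd b z ⁻¹' Set.range (ζ i) := fun i => by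
    rw [← Scheme.Pullback.range_map (β i ≫ b) (ζ i ≫ z) b z (β i) (ζ i) (𝟙 S) (by simp)
      (by simp), hgf]
    ext y
    constructor
    · rintro ⟨x, rfl⟩
      exact ⟨(h i).isoPullback.hom x, rfl⟩
    · rintro ⟨x, rfl⟩
      exact ⟨(h i).isoPullback.inv x, by
        rw [← Scheme.Hom.comp_apply, Iso.inv_hom_id_assoc]⟩
  have hf : IsIso f := by
    refine isIso_of_isOpenImmersion_comp f g (fun i => ?_) (fun y => ?_) fun i x hx => ?_
    · rw [hgf]
      infer_instance
    · obtain ⟨i, h1, h2⟩ := hcov (pullback.fst b z y) (pullback.snd b z y)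
      exact ⟨i, hr i ▸ ⟨h1, h2⟩⟩
    · rw [hr] at hx
      refine hpre i x ?_ ?_
      · have := hx.1
        rwa [Set.mem_preimage, ← Scheme.Hom.comp_apply, pullback.lift_fst] at this
      · have := hx.2
        rwa [Set.mem_preimage, ← Scheme.Hom.comp_apply, pullback.lift_snd] at this
  exact IsPullback.of_iso_pullback ⟨w⟩ (asIso f) (pullback.lift_fst _ _ _) (pullback.lift_snd _ _ _)

/-- Morphisms from an integral scheme to a separated scheme can be glued from an open cover if they
agree on one nonempty open subscheme. -/
lemma exists_glued {W Y S T : Scheme.{u}} [AlgebraicGeometry.IsIntegral W] (s : Y ⟶ S)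
    [IsSeparated s] (t : W ⟶ S) {ι : Type*} {U : ι → Scheme.{u}} (g : ∀ i, U i ⟶ W)
    [∀ i, IsOpenImmersion (g i)] (hcov : ∀ x, ∃ i, x ∈ Set.range (g i)) (ψ : ∀ i, U i ⟶ Y)
    (hψ : ∀ i, ψ i ≫ s = g i ≫ t) [Nonempty T] (o : T ⟶ W) [IsOpenImmersion o]
    (j : ∀ i, T ⟶ U i) (hj : ∀ i, j i ≫ g i = o) (τ : T ⟶ Y) (hτ : ∀ i, j i ≫ ψ i = τ) :
    ∃ φ : W ⟶ Y, (∀ i, g i ≫ φ = ψ i) ∧ φ ≫ s = t := by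
  let 𝒰 : W.OpenCover := ⟨⟨ι, U, g⟩, by
    rw [Scheme.presieve₀_mem_precoverage_iff]
    exact ⟨fun x => hcov x, fun i => inferInstance⟩⟩
  have hglue : ∀ i i', pullback.fst (g i) (g i') ≫ ψ i = pullback.snd (g i) (g i') ≫ ψ i' := by
    intro i i'
    let l : T ⟶ pullback (g i) (g i') := pullback.lift (j i) (j i') (by rw [hj, hj])
    have hl : l ≫ pullback.fst (g i) (g i') ≫ g i = o := by
      rw [pullback.lift_fst_assoc, hj]
    have : IsOpenImmersion l :=
      have : IsOpenImmersion (l ≫ pullback.fst (g i) (g i') ≫ g i) := hl ▸ inferInstance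
      IsOpenImmersion.of_comp l (pullback.fst (g i) (g i') ≫ g i)
    have : Nonempty (pullback (g i) (g i') : Scheme) := ⟨l (Classical.arbitrary T)⟩
    have : AlgebraicGeometry.IsIntegral (pullback (g i) (g i')) :=
      isIntegral_of_isOpenImmersion (pullback.fst (g i) (g i') ≫ g i)
    have : IsDominant l := ⟨l.isOpenEmbedding.isOpen_range.dense (Set.range_nonempty _)⟩
    refine ext_of_isDominant_of_isSeparated s ?_ l ?_
    · rw [Category.assoc, Category.assoc, hψ, hψ, pullback.condition_assoc]
    · rw [pullback.lift_fst_assoc, pullback.lift_snd_assoc, hτ, hτ]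
  have hφ : ∀ i, g i ≫ Scheme.Cover.glueMorphisms 𝒰 ψ hglue = ψ i :=
    fun i => Scheme.Cover.ι_glueMorphisms 𝒰 ψ hglue i
  refine ⟨Scheme.Cover.glueMorphisms 𝒰 ψ hglue, hφ, Scheme.Cover.hom_ext 𝒰 _ _ fun i => ?_⟩
  rw [← hψ i, ← hφ i]
  rfl

/-- If generators of `A` and of `B` together become free generators of `C`, then `C` is the tensor
product of `A` and `B`. -/
lemma isPushout_of_bijective_aeval {k A B C : Type u} [CommRing k] [CommRing A] [CommRing B]
    [CommRing C] [Algebra k A] [Algebra k B] [Algebra k C] {σ τ : Type*} {x : σ → A} {y : τ → B}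
    (hx : Function.Surjective (MvPolynomial.aeval (R := k) x))
    (hy : Function.Surjective (MvPolynomial.aeval (R := k) y)) (φ : A →ₐ[k] C) (ψ : B →ₐ[k] C)
    (h : Function.Bijective
      (MvPolynomial.aeval (R := k) (Sum.elim (fun s => φ (x s)) (fun s => ψ (y s))))) :
    IsPushout (CommRingCat.ofHom (algebraMap k A)) (CommRingCat.ofHom (algebraMap k B))
      (CommRingCat.ofHom φ.toRingHom) (CommRingCat.ofHom ψ.toRingHom) := by
  have w : CommRingCat.ofHom (algebraMap k A) ≫ CommRingCat.ofHom φ.toRingHom =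
      CommRingCat.ofHom (algebraMap k B) ≫ CommRingCat.ofHom ψ.toRingHom := by
    rw [← CommRingCat.ofHom_comp, ← CommRingCat.ofHom_comp]
    exact congrArg _ (φ.comp_algebraMap.trans ψ.comp_algebraMap.symm)
  let e := AlgEquiv.ofBijective _ h
  have hexA : ∀ {D : Type u} [CommRing D] (f g : A →+* D),
      f.comp (algebraMap k A) = g.comp (algebraMap k A) → (∀ s, f (x s) = g (x s)) → f = g := by
    intro D _ f g h1 h2
    rw [← RingHom.cancel_right (f := (MvPolynomial.aeval (R := k) x).toRingHom) hx]
    refine MvPolynomial.ringHom_ext (fun r => ?_) fun s => ?_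
    · simpa using congr($h1 r)
    · simpa using h2 s
  have hexB : ∀ {D : Type u} [CommRing D] (f g : B →+* D),
      f.comp (algebraMap k B) = g.comp (algebraMap k B) → (∀ s, f (y s) = g (y s)) → f = g := by
    intro D _ f g h1 h2
    rw [← RingHom.cancel_right (f := (MvPolynomial.aeval (R := k) y).toRingHom) hy]
    refine MvPolynomial.ringHom_ext (fun r => ?_) fun s => ?_
    · simpa using congr($h1 r)
    · simpa using h2 s
  have hl : ∀ s, e.symm (φ (x s)) = MvPolynomial.X (Sum.inl s) := fun s => by
    rw [AlgEquiv.symm_apply_eq]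
    exact (MvPolynomial.aeval_X (R := k)
      (Sum.elim (fun s => φ (x s)) (fun s => ψ (y s))) (Sum.inl s)).symm
  have hr : ∀ s, e.symm (ψ (y s)) = MvPolynomial.X (Sum.inr s) := fun s => by
    rw [AlgEquiv.symm_apply_eq]
    exact (MvPolynomial.aeval_X (R := k)
      (Sum.elim (fun s => φ (x s)) (fun s => ψ (y s))) (Sum.inr s)).symm
  refine ⟨⟨w⟩, ⟨PushoutCocone.IsColimit.mk w
    (fun c => CommRingCat.ofHom ((MvPolynomial.eval₂Hom (c.inl.hom.comp (algebraMap k A))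
      (Sum.elim (fun s => c.inl.hom (x s)) (fun s => c.inr.hom (y s)))).comp
        e.symm.toRingHom)) (fun c => ?_) (fun c => ?_) fun c m h1 h2 => ?_⟩⟩
  · ext1
    refine hexA _ _ ?_ fun s => ?_
    · ext r
      have : e.symm (φ (algebraMap k A r)) = MvPolynomial.C r := by
        rw [φ.commutes, e.symm.commutes]
        rfl
      change MvPolynomial.eval₂Hom _ _ (e.symm (φ (algebraMap k A r))) = _
      rw [this]
      simp
    · change MvPolynomial.eval₂Hom _ _ (e.symm (φ (x s))) = _
      rw [hl]
      simp
  · have hc := congr(CommRingCat.Hom.hom $(c.condition))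
    ext1
    refine hexB _ _ ?_ fun s => ?_
    · ext r
      have : e.symm (ψ (algebraMap k B r)) = MvPolynomial.C r := by
        rw [ψ.commutes, e.symm.commutes]
        rfl
      change MvPolynomial.eval₂Hom _ _ (e.symm (ψ (algebraMap k B r))) = _
      rw [this]
      simpa using congr($hc r)
    · change MvPolynomial.eval₂Hom _ _ (e.symm (ψ (y s))) = _
      rw [hr]
      simp
  · ext1
    rw [← RingHom.cancel_right (f := e.toRingEquiv.toRingHom) e.surjective]
    refine MvPolynomial.ringHom_ext (fun r => ?_) fun s => ?_
    · have : e (MvPolynomial.C r) = φ (algebraMap k A r) := by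
        rw [φ.commutes]
        exact e.commutes r
      change m.hom (e (MvPolynomial.C r)) =
        MvPolynomial.eval₂Hom _ _ (e.symm (e (MvPolynomial.C r)))
      rw [e.symm_apply_apply, this, ← h1]
      simp
    · change m.hom (e (MvPolynomial.X s)) =
        MvPolynomial.eval₂Hom _ _ (e.symm (e (MvPolynomial.X s)))
      rw [e.symm_apply_apply]
      obtain s | s := s
      · rw [MvPolynomial.coe_eval₂Hom, MvPolynomial.eval₂_X, ← hl, e.apply_symm_apply, ← h1]
        rfl
      · rw [MvPolynomial.coe_eval₂Hom, MvPolynomial.eval₂_X, ← hr, e.apply_symm_apply, ← h2]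
        rfl

/-! ### Morphisms to `ℙⁿ` given by characters -/

section ProjectiveSpace

variable {k : Type u} [Field k] {n : ℕ}

attribute [local instance] MvPolynomial.gradedAlgebra

instance : IsSeparated (projStr k n) := by
  have h1 : IsSeparated (Proj.toSpecZero (grading k n)) := Proj.isSeparated _
  have h2 : IsSeparated (Spec.map (CommRingCat.ofHom (algebraMap k (grading k n 0)))) :=
    inferInstance
  exact MorphismProperty.comp_mem @IsSeparated _ _ h1 h2

lemma aeval_ratio_succAbove_surjective (i : Fin (n + 1)) :
    Function.Surjective (MvPolynomial.aeval (R := k) (fun j => ratio k i (i.succAbove j))) := by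
  rw [← AlgHom.range_eq_top, ← Algebra.adjoin_range_eq_range_aeval, ← top_le_iff,
    ← (AlgHom.range_eq_top _).2 (aeval_ratio_surjective i), ← Algebra.adjoin_range_eq_range_aeval,
    Algebra.adjoin_le_iff]
  rintro _ ⟨j, rfl⟩
  obtain rfl | ⟨j, rfl⟩ := i.eq_self_or_eq_succAbove j
  · rw [ratio_self]
    exact one_mem _
  · exact Algebra.subset_adjoin ⟨j, rfl⟩

end ProjectiveSpace

namespace SmoothCompleteFan

variable {d : ℕ} (F : SmoothCompleteFan d) (k : Type u) [Field k] {n : ℕ}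

/-- The characters `χ^{μ_j - μ_i}`, as functions on a chart. -/
noncomputable def charRatio {c : Finset (Fin d → ℤ)}
    {μ : Fin (n + 1) → Module.Dual ℤ (Fin d → ℤ)} {i : Fin (n + 1)}
    (h : ∀ j, μ j - μ i ∈ dualMonoid c) (j : Fin (n + 1)) : ChartRing k c :=
  AddMonoidAlgebra.single ⟨μ j - μ i, h j⟩ 1

lemma charRatio_self {c : Finset (Fin d → ℤ)}
    {μ : Fin (n + 1) → Module.Dual ℤ (Fin d → ℤ)} {i : Fin (n + 1)}
    (h : ∀ j, μ j - μ i ∈ dualMonoid c) : charRatio k h i = 1 := by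
  rw [charRatio, AddMonoidAlgebra.one_def]
  congr 1
  exact Subtype.ext (sub_self _)

lemma isUnit_charRatio_self {c : Finset (Fin d → ℤ)}
    {μ : Fin (n + 1) → Module.Dual ℤ (Fin d → ℤ)} {i : Fin (n + 1)}
    (h : ∀ j, μ j - μ i ∈ dualMonoid c) : IsUnit (charRatio k h i) :=
  charRatio_self k h ▸ isUnit_one

/-- The morphism from a chart to `ℙⁿ` whose homogeneous coordinates are the characters `χ^{μ_j}`,
divided by `χ^{μ_i}` in order to make them regular. -/
noncomputable def chartToProj {c : Finset (Fin d → ℤ)}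
    {μ : Fin (n + 1) → Module.Dual ℤ (Fin d → ℤ)} {i : Fin (n + 1)}
    (h : ∀ j, μ j - μ i ∈ dualMonoid c) : Spec (.of (ChartRing k c)) ⟶ ProjSpace k n :=
  toProj i (charRatio k h) (isUnit_charRatio_self k h)

lemma mem_dualMonoid_empty (u : Module.Dual ℤ (Fin d → ℤ)) : u ∈ dualMonoid ∅ := by
  simp [mem_dualMonoid]

lemma isUnit_single_empty (u : Module.Dual ℤ (Fin d → ℤ)) :
    IsUnit (AddMonoidAlgebra.single ⟨u, mem_dualMonoid_empty u⟩ 1 : ChartRing k ∅) := by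
  refine IsUnit.of_mul_eq_one
    (AddMonoidAlgebra.single ⟨-u, mem_dualMonoid_empty _⟩ 1 : ChartRing k ∅) ?_
  rw [AddMonoidAlgebra.single_mul_single, AddMonoidAlgebra.one_def, mul_one]
  congr 1
  exact Subtype.ext (add_neg_cancel u)

/-- On the torus no denominator is needed, so the morphism does not depend on it. -/
lemma map_chartToProj_empty {c : Finset (Fin d → ℤ)}
    {μ : Fin (n + 1) → Module.Dual ℤ (Fin d → ℤ)} {i : Fin (n + 1)}
    (h : ∀ j, μ j - μ i ∈ dualMonoid c) (l : Fin (n + 1)) :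
    Spec.map (CommRingCat.ofHom (chartMap k (Finset.empty_subset c)).toRingHom) ≫
      chartToProj k h = toProj l
        (fun j => (AddMonoidAlgebra.single ⟨μ j, mem_dualMonoid_empty _⟩ 1 : ChartRing k ∅))
        (isUnit_single_empty k _) := by
  have hc : chartMap k (Finset.empty_subset c) (charRatio k h i) = 1 := by
    rw [charRatio_self, map_one]
  rw [chartToProj, map_toProj (chartMap k (Finset.empty_subset c)) _
    (r' := fun j => chartMap k (Finset.empty_subset c) (charRatio k h j))
    (by rw [hc]; exact isUnit_one) (fun _ => rfl),
    toProj_mul (r' := fun j =>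
      (AddMonoidAlgebra.single ⟨μ j, mem_dualMonoid_empty _⟩ 1 : ChartRing k ∅)) _
      (isUnit_single_empty k (μ i))
      (AddMonoidAlgebra.single ⟨μ i, mem_dualMonoid_empty _⟩ 1 : ChartRing k ∅) (fun j => ?_),
    toProj_congr]
  rw [charRatio, chartMap_single, AddMonoidAlgebra.single_mul_single, one_mul]
  congr 1
  exact Subtype.ext (add_sub_cancel _ _).symm

/-- The homogeneous coordinates of the morphism `f` from the open subscheme `W` to `ℙⁿ` are the
characters `χ^{μ_j}`. -/
def IsCharMap {W : Scheme.{u}} (w : W ⟶ F.toricVariety k)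
    (μ : Fin (n + 1) → Module.Dual ℤ (Fin d → ℤ)) (f : W ⟶ ProjSpace k n) : Prop :=
  ∀ (c : F.cones) (i : Fin (n + 1)) (h : ∀ j, μ j - μ i ∈ dualMonoid c.1)
    (g : Spec (.of (ChartRing k c.1)) ⟶ W), g ≫ w = F.chartι k c → g ≫ f = chartToProj k h

/-- Characters define a morphism to `ℙⁿ` on each union of charts where one of them divides the
others. -/
lemma exists_isCharMap {W : Scheme.{u}} [Nonempty W] (w : W ⟶ F.toricVariety k)
    [IsOpenImmersion w] (μ : Fin (n + 1) → Module.Dual ℤ (Fin d → ℤ))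
    (hcov : ∀ x : W, ∃ (c : F.cones) (i : Fin (n + 1)), (∀ j, μ j - μ i ∈ dualMonoid c.1) ∧
      Set.range (F.chartι k c) ⊆ Set.range w ∧ w x ∈ Set.range (F.chartι k c)) :
    ∃ f : W ⟶ ProjSpace k n, F.IsCharMap k w μ f ∧ f ≫ projStr k n = w ≫ F.structureMap k := by
  have : AlgebraicGeometry.IsIntegral W := isIntegral_of_isOpenImmersion w
  let ι := {p : F.cones × Fin (n + 1) // (∀ j, μ j - μ p.2 ∈ dualMonoid p.1.1) ∧
    Set.range (F.chartι k p.1) ⊆ Set.range w}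
  let U (p : ι) : Scheme.{u} := Spec (.of (ChartRing k p.1.1.1))
  let g (p : ι) : U p ⟶ W := IsOpenImmersion.lift w (F.chartι k p.1.1) p.2.2
  have hg : ∀ p, g p ≫ w = F.chartι k p.1.1 := fun p => IsOpenImmersion.lift_fac _ _ _
  have hgi : ∀ p, IsOpenImmersion (g p) := fun p =>
    have : IsOpenImmersion (g p ≫ w) := hg p ▸ inferInstance
    IsOpenImmersion.of_comp (g p) w
  have hgcov : ∀ x, ∃ p, x ∈ Set.range (g p) := fun x => by
    obtain ⟨c, i, h, hr, z, hz⟩ := hcov x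
    refine ⟨⟨(c, i), h, hr⟩, z, w.injective ?_⟩
    rw [← Scheme.Hom.comp_apply, hg]
    exact hz
  let j (p : ι) : Spec (.of (ChartRing k (∅ : Finset (Fin d → ℤ)))) ⟶ U p :=
    Spec.map (CommRingCat.ofHom (chartMap k (Finset.empty_subset _)).toRingHom)
  obtain ⟨p₀, -⟩ := hgcov (Classical.arbitrary W)
  have hjw : ∀ p, (j p ≫ g p) ≫ w = F.chartι k ⟨∅, F.empty_mem_cones⟩ := fun p => by
    rw [Category.assoc, hg]
    exact F.map_chartι k (a := ⟨∅, F.empty_mem_cones⟩) (Finset.empty_subset _)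
  have : IsOpenImmersion (j p₀ ≫ g p₀) :=
    have : IsOpenImmersion ((j p₀ ≫ g p₀) ≫ w) := hjw p₀ ▸ inferInstance
    IsOpenImmersion.of_comp _ w
  have hstr : ∀ p : ι, chartToProj k p.2.1 ≫ projStr k n = g p ≫ w ≫ F.structureMap k := fun p => by
    rw [chartToProj, toProj_projStr, ← Category.assoc, hg, chartι_structureMap]
  obtain ⟨f, hf, hft⟩ := exists_glued (projStr k n) (w ≫ F.structureMap k) g hgcov
    (fun p => chartToProj k p.2.1) hstr (j p₀ ≫ g p₀) j
    (fun p => (cancel_mono w).1 ((hjw p).trans (hjw p₀).symm)) _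
    (fun p => map_chartToProj_empty k p.2.1 0)
  refine ⟨f, fun c i h g' hg' => ?_, hft⟩
  have hr : Set.range (F.chartι k c) ⊆ Set.range w := by
    rintro _ ⟨z, rfl⟩
    exact ⟨g' z, by rw [← Scheme.Hom.comp_apply, hg']⟩
  rw [← hf ⟨(c, i), h, hr⟩]
  congr 1
  rw [← cancel_mono w, hg', hg]

variable {F k}

lemma mem_range_chartι_of_notMem {c a : F.cones} {u : Module.Dual ℤ (Fin d → ℤ)}
    (hu : u ∈ dualMonoid c.1) {z : Spec (.of (ChartRing k c.1))}
    (hz : (AddMonoidAlgebra.single ⟨u, hu⟩ 1 : ChartRing k c.1) ∉ z.asIdeal)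
    (ha : ∀ v ∈ c.1, u v = 0 → v ∈ a.1) : F.chartι k c z ∈ Set.range (F.chartι k a) := by
  classical
  let b : F.cones := ⟨c.1.filter (fun v => u v = 0), F.face_mem _ c.2 _ (Finset.filter_subset _ _)⟩
  have hbc : b ≤ c := Finset.filter_subset _ _
  have hba : b ≤ a := fun v hv => ha v (Finset.mem_filter.1 hv).1 (Finset.mem_filter.1 hv).2
  have hr := F.range_chartFunctor_map k (homOfLE hbc) ⟨u, hu⟩
    (fun v hv => (Finset.mem_filter.1 hv).2) (fun v hv hvb => by
      have h1 : u v ≠ 0 := fun h => hvb (Finset.mem_filter.2 ⟨hv, h⟩)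
      have h2 := hu v hv
      change 1 ≤ u v
      omega)
  obtain ⟨y, hy⟩ : ∃ y, Spec.map (CommRingCat.ofHom (chartMap k hbc).toRingHom) y = z := by
    change z ∈ Set.range ((F.chartFunctor k).map (homOfLE hbc))
    rw [hr]
    exact hz
  refine ⟨Spec.map (CommRingCat.ofHom (chartMap k hba).toRingHom) y, ?_⟩
  rw [← hy, ← Scheme.Hom.comp_apply, ← Scheme.Hom.comp_apply, F.map_chartι k hbc,
    F.map_chartι k hba]

namespace IsCharMap

variable {W : Scheme.{u}} {w : W ⟶ F.toricVariety k} [IsOpenImmersion w]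
  {μ : Fin (n + 1) → Module.Dual ℤ (Fin d → ℤ)} {f : W ⟶ ProjSpace k n}

lemma mem_stdOpen (hf : F.IsCharMap k w μ f) {c : F.cones} {i : Fin (n + 1)}
    (h : ∀ j, μ j - μ i ∈ dualMonoid c.1)
    (hr : Set.range (F.chartι k c) ⊆ Set.range w) {x : W}
    (hx : w x ∈ Set.range (F.chartι k c)) : f x ∈ stdOpen k n i := by
  obtain ⟨z, hz⟩ := hx
  have hg := IsOpenImmersion.lift_fac w (F.chartι k c) hr
  obtain rfl : IsOpenImmersion.lift w (F.chartι k c) hr z = x := w.injective <| by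
    rw [← Scheme.Hom.comp_apply, hg, hz]
  rw [← Scheme.Hom.comp_apply, hf c i h _ hg, chartToProj, preimage_toProj, charRatio_self]
  exact fun h1 => z.isPrime.ne_top ((Ideal.eq_top_iff_one _).2 h1)

/-- Where the coordinate `χ^{μ_l}` does not vanish, a chart can be replaced by its intersection
with the chart of a cone that contains the generators on which `μ_l` and `μ_i` agree. -/
lemma mem_range_chartι (hf : F.IsCharMap k w μ f) {c : F.cones} {i l : Fin (n + 1)}
    (h : ∀ j, μ j - μ i ∈ dualMonoid c.1)
    (hr : Set.range (F.chartι k c) ⊆ Set.range w) {x : W}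
    (hx : w x ∈ Set.range (F.chartι k c)) (hl : f x ∈ stdOpen k n l) {a : F.cones}
    (ha : ∀ v ∈ c.1, (μ l - μ i) v = 0 → v ∈ a.1) : w x ∈ Set.range (F.chartι k a) := by
  obtain ⟨z, hz⟩ := hx
  have hg := IsOpenImmersion.lift_fac w (F.chartι k c) hr
  obtain rfl : IsOpenImmersion.lift w (F.chartι k c) hr z = x := w.injective <| by
    rw [← Scheme.Hom.comp_apply, hg, hz]
  rw [← Scheme.Hom.comp_apply, hf c i h _ hg, chartToProj, preimage_toProj] at hl
  rw [← hz]
  exact mem_range_chartι_of_notMem _ hl ha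

end IsCharMap

end SmoothCompleteFan

/-! ### Fans of projective bundles -/

namespace SmoothCompleteFan

variable {d : ℕ} {F : SmoothCompleteFan d} {k : Type u} [Field k] {n r : ℕ}

namespace IsCharMap

variable {W : Scheme.{u}} {w : W ⟶ F.toricVariety k}
  {μ : Fin (n + 1) → Module.Dual ℤ (Fin d → ℤ)} {f : W ⟶ ProjSpace k n}

lemma comp (hf : F.IsCharMap k w μ f) {W' : Scheme.{u}} (e : W' ⟶ W)
    {w' : W' ⟶ F.toricVariety k} (hw : e ≫ w = w') : F.IsCharMap k w' μ (e ≫ f) := by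
  intro c i h g hg
  rw [← Category.assoc, hf c i h (g ≫ e) (by rw [Category.assoc, hw, hg])]

/-- The ratios of the homogeneous coordinates, restricted to the torus, are characters. -/
lemma app_coordRatio (hf : F.IsCharMap k w μ f)
    {o : Spec (.of (ChartRing k (∅ : Finset (Fin d → ℤ)))) ⟶ W}
    (ho : o ≫ w = F.chartι k ⟨∅, F.empty_mem_cones⟩) {l : Fin (n + 1)} (m : Fin (n + 1))
    (V : W.Opens) (h : V ≤ f ⁻¹ᵁ stdOpen k n l) :
    (o.app V).hom ((f.appLE (stdOpen k n l) V h).hom (coordRatio k n l m)) =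
      ((Spec (.of (ChartRing k (∅ : Finset (Fin d → ℤ))))).presheaf.map
        (homOfLE (le_top : o ⁻¹ᵁ V ≤ ⊤)).op).hom ((Scheme.ΓSpecIso _).inv.hom
          (AddMonoidAlgebra.single ⟨μ m - μ l, mem_dualMonoid_empty _⟩ 1)) := by
  have h0 : ∀ j, μ j - μ l ∈ dualMonoid (∅ : Finset (Fin d → ℤ)) :=
    fun j => mem_dualMonoid_empty _
  have hof : o ≫ f = chartToProj k h0 := hf ⟨∅, F.empty_mem_cones⟩ l h0 o ho
  have h1 : ⊤ ≤ (o ≫ f) ⁻¹ᵁ stdOpen k n l := by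
    intro z _
    change (o ≫ f) z ∈ stdOpen k n l
    rw [hof, chartToProj, preimage_toProj, charRatio_self]
    exact fun h1 => z.isPrime.ne_top ((Ideal.eq_top_iff_one _).2 h1)
  have h2 : ((o ≫ f).appLE (stdOpen k n l) ⊤ h1).hom (coordRatio k n l m) =
      (Scheme.ΓSpecIso _).inv.hom (charRatio k h0 m) := by
    have key : ∀ (f' : Spec (.of (ChartRing k (∅ : Finset (Fin d → ℤ)))) ⟶ ProjSpace k n)
        (_ : f' = chartToProj k h0) (h' : ⊤ ≤ f' ⁻¹ᵁ stdOpen k n l),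
        (f'.appLE (stdOpen k n l) ⊤ h').hom (coordRatio k n l m) =
          (Scheme.ΓSpecIso _).inv.hom (charRatio k h0 m) := by
      rintro _ rfl h'
      refine (appLE_toProj l m _ (isUnit_charRatio_self k h0) h').trans ?_
      have := pointHom_ratio (k := k) l m _ (isUnit_charRatio_self k h0)
      rw [charRatio_self, one_mul] at this
      rw [this]
    exact key _ hof h1
  have h3 : f.appLE (stdOpen k n l) V h ≫ o.app V =
      (o ≫ f).appLE (stdOpen k n l) ⊤ h1 ≫
        (Spec (.of (ChartRing k (∅ : Finset (Fin d → ℤ))))).presheaf.map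
          (homOfLE (le_top : o ⁻¹ᵁ V ≤ ⊤)).op := by
    rw [Scheme.Hom.appLE_map, Scheme.Hom.app_eq_appLE, Scheme.Hom.appLE_comp_appLE]
  refine congr($h3 (coordRatio k n l m)).trans ?_
  exact (CommRingCat.comp_apply _ _ _).trans (congrArg _ h2)

end IsCharMap

variable (F) in
/-- The maximal cones of a fan that is the fan of a bundle over `ℙⁿ` with fibre `ℙʳ`, together with
characters that serve as homogeneous coordinates: `m i` on the base, and `μ i l` on the fibres over
the open subset where `m i` does not vanish. -/
structure IsBundleFan (q : Fin (n + 1) → Fin d → ℤ) (p : Fin (r + 1) → Fin d → ℤ)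
    (m : Fin (n + 1) → Module.Dual ℤ (Fin d → ℤ))
    (μ : Fin (n + 1) → Fin (r + 1) → Module.Dual ℤ (Fin d → ℤ)) : Prop where
  dim : n + r = d
  mem_cones : ∀ i l, facet q i ∪ facet p l ∈ F.cones
  base_q : ∀ i i' j, (m i - m i') (q j) = (if i = j then 1 else 0) - (if i' = j then 1 else 0)
  base_p : ∀ i i' j, (m i - m i') (p j) = 0
  fibre_p : ∀ i l l' j,
    (μ i l - μ i l') (p j) = (if l = j then 1 else 0) - (if l' = j then 1 else 0)
  fibre_q : ∀ i l l' j, j ≠ i → (μ i l - μ i l') (q j) = 0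

namespace IsBundleFan

variable {q : Fin (n + 1) → Fin d → ℤ} {p : Fin (r + 1) → Fin d → ℤ}
  {m : Fin (n + 1) → Module.Dual ℤ (Fin d → ℤ)}
  {μ : Fin (n + 1) → Fin (r + 1) → Module.Dual ℤ (Fin d → ℤ)}

/-- The maximal cones. -/
def maxCone (h : F.IsBundleFan q p m μ) (i : Fin (n + 1)) (l : Fin (r + 1)) : F.cones :=
  ⟨facet q i ∪ facet p l, h.mem_cones i l⟩

lemma mem_maxCone (h : F.IsBundleFan q p m μ) {i : Fin (n + 1)} {l : Fin (r + 1)}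
    {x : Fin d → ℤ} : x ∈ (h.maxCone i l).1 ↔ (∃ j, j ≠ i ∧ q j = x) ∨ ∃ j, j ≠ l ∧ p j = x := by
  rw [maxCone, Finset.mem_union, mem_facet, mem_facet]

lemma base_mem (h : F.IsBundleFan q p m μ) (i : Fin (n + 1)) (l : Fin (r + 1))
    (j : Fin (n + 1)) : m j - m i ∈ dualMonoid (h.maxCone i l).1 := by
  intro x hx
  obtain ⟨j', hj', rfl⟩ | ⟨j', -, rfl⟩ := h.mem_maxCone.1 hx
  · rw [h.base_q, if_neg hj'.symm]
    split_ifs <;> simp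
  · rw [h.base_p]

lemma fibre_mem (h : F.IsBundleFan q p m μ) (i : Fin (n + 1)) (l l' : Fin (r + 1)) :
    μ i l' - μ i l ∈ dualMonoid (h.maxCone i l).1 := by
  intro x hx
  obtain ⟨j', hj', rfl⟩ | ⟨j', hj', rfl⟩ := h.mem_maxCone.1 hx
  · rw [h.fibre_q i _ _ _ hj']
  · rw [h.fibre_p, if_neg hj'.symm]
    split_ifs <;> simp

lemma mem_maxCone_iff (h : F.IsBundleFan q p m μ) {i : Fin (n + 1)} {l : Fin (r + 1)}
    (x : Fin d → ℤ) : x ∈ (h.maxCone i l).1 ↔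
      ∃ s : Fin r ⊕ Fin n,
        Sum.elim (fun j => p (l.succAbove j)) (fun j => q (i.succAbove j)) s = x := by
  rw [h.mem_maxCone, Sum.exists, or_comm]
  constructor
  · rintro (⟨j, hj, rfl⟩ | ⟨j, hj, rfl⟩)
    · obtain ⟨j, rfl⟩ := Fin.exists_succAbove_eq hj
      exact .inl ⟨j, rfl⟩
    · obtain ⟨j, rfl⟩ := Fin.exists_succAbove_eq hj
      exact .inr ⟨j, rfl⟩
  · rintro (⟨j, rfl⟩ | ⟨j, rfl⟩)
    · exact .inl ⟨_, Fin.succAbove_ne _ _, rfl⟩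
    · exact .inr ⟨_, Fin.succAbove_ne _ _, rfl⟩

lemma dual_apply (h : F.IsBundleFan q p m μ) (i : Fin (n + 1)) (l : Fin (r + 1))
    (s s' : Fin r ⊕ Fin n) :
    (Sum.elim (fun j => μ i (l.succAbove j) - μ i l) (fun j => m (i.succAbove j) - m i) s)
      (Sum.elim (fun j => p (l.succAbove j)) (fun j => q (i.succAbove j)) s') =
      if s = s' then 1 else 0 := by
  rcases s with s | s <;> rcases s' with s' | s'
  · simp [h.fibre_p, (Fin.succAbove_ne _ _).symm]
  · simp [h.fibre_q i _ _ _ (Fin.succAbove_ne _ _)]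
  · simp [h.base_p]
  · simp [h.base_q, (Fin.succAbove_ne _ _).symm]

lemma exists_le_maxCone (h : F.IsBundleFan q p m μ) (c : F.cones) : ∃ i l, c ≤ h.maxCone i l := by
  obtain ⟨i, hi⟩ := Finite.exists_min (fun i => m i (∑ x ∈ c.1, x))
  obtain ⟨l, hl⟩ := Finite.exists_min (fun l => μ i l (∑ x ∈ c.1, x))
  refine ⟨i, l, F.subset_of_nonneg (by simpa [add_comm] using h.dim) c.2 (h.maxCone i l).2 _ _
    h.mem_maxCone_iff (h.dual_apply i l) fun s => ?_⟩
  rcases s with s | s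
  · exact sub_nonneg.2 (hl _)
  · exact sub_nonneg.2 (hi _)

lemma exists_mem_range (h : F.IsBundleFan q p m μ) (x : F.toricVariety k) :
    ∃ i l, x ∈ Set.range (F.chartι k (h.maxCone i l)) := by
  obtain ⟨c, z, rfl⟩ : ∃ (c : F.cones) (z : Spec (.of (ChartRing k c.1))), F.chartι k c z = x :=
    Scheme.IsLocallyDirected.ι_jointly_surjective (F.chartFunctor k) x
  obtain ⟨i, l, hc⟩ := h.exists_le_maxCone c
  refine ⟨i, l, Spec.map (CommRingCat.ofHom (chartMap k hc).toRingHom) z, ?_⟩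
  rw [← Scheme.Hom.comp_apply, F.map_chartι k hc]

/-- The projection to the base. -/
lemma exists_base (h : F.IsBundleFan q p m μ) : ∃ π : F.toricVariety k ⟶ ProjSpace k n,
    F.IsCharMap k (𝟙 _) m π ∧ π ≫ projStr k n = F.structureMap k := by
  have : Nonempty (F.toricVariety k) := inferInstance
  obtain ⟨π, h1, h2⟩ := F.exists_isCharMap k (𝟙 _) m fun x => by
    obtain ⟨i, l, hx⟩ := h.exists_mem_range x
    exact ⟨h.maxCone i l, i, h.base_mem i l, by simp, hx⟩
  exact ⟨π, h1, by rw [h2, Category.id_comp]⟩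

variable {π : F.toricVariety k ⟶ ProjSpace k n}

lemma range_chartι_subset (h : F.IsBundleFan q p m μ) (hπ : F.IsCharMap k (𝟙 _) m π)
    (i : Fin (n + 1)) (l : Fin (r + 1)) :
    Set.range (F.chartι k (h.maxCone i l)) ⊆ Set.range (π ⁻¹ᵁ stdOpen k n i).ι := by
  rw [Scheme.Opens.range_ι]
  intro x hx
  exact hπ.mem_stdOpen (h.base_mem i l) (by simp) hx

lemma mem_range_of_base (h : F.IsBundleFan q p m μ) (hπ : F.IsCharMap k (𝟙 _) m π)
    {i i' : Fin (n + 1)} {l : Fin (r + 1)} {x : F.toricVariety k}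
    (hx : x ∈ Set.range (F.chartι k (h.maxCone i l))) (hi : π x ∈ stdOpen k n i') :
    x ∈ Set.range (F.chartι k (h.maxCone i' l)) := by
  refine hπ.mem_range_chartι (h.base_mem i l) (by simp) (x := x) hx hi fun v hv h0 => ?_
  rw [h.mem_maxCone]
  obtain ⟨j, hj, rfl⟩ | hv := h.mem_maxCone.1 hv
  · refine .inl ⟨j, fun hji => ?_, rfl⟩
    rw [h.base_q, if_neg hj.symm, if_pos hji.symm] at h0
    simp at h0
  · exact .inr hv

/-- The projection to the fibre, over a standard affine open subset of the base. -/
lemma exists_fibre (h : F.IsBundleFan q p m μ) (hπ : F.IsCharMap k (𝟙 _) m π)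
    (i : Fin (n + 1)) : ∃ φ : (π ⁻¹ᵁ stdOpen k n i).toScheme ⟶ ProjSpace k r,
      F.IsCharMap k (π ⁻¹ᵁ stdOpen k n i).ι (μ i) φ ∧
        φ ≫ projStr k r = (π ⁻¹ᵁ stdOpen k n i).ι ≫ F.structureMap k := by
  have : Nonempty (π ⁻¹ᵁ stdOpen k n i).toScheme := by
    obtain ⟨y, -⟩ := h.range_chartι_subset hπ i 0 ⟨Classical.arbitrary _, rfl⟩
    exact ⟨y⟩
  refine F.exists_isCharMap k _ (μ i) fun x => ?_
  obtain ⟨i', l, hx⟩ := h.exists_mem_range ((π ⁻¹ᵁ stdOpen k n i).ι x)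
  exact ⟨h.maxCone i l, l, h.fibre_mem i l, h.range_chartι_subset hπ i l,
    h.mem_range_of_base hπ hx x.2⟩

lemma mem_stdOpen_iff (h : F.IsBundleFan q p m μ) (hπ : F.IsCharMap k (𝟙 _) m π)
    {i : Fin (n + 1)} {φ : (π ⁻¹ᵁ stdOpen k n i).toScheme ⟶ ProjSpace k r}
    (hφ : F.IsCharMap k (π ⁻¹ᵁ stdOpen k n i).ι (μ i) φ) (l : Fin (r + 1))
    (x : (π ⁻¹ᵁ stdOpen k n i).toScheme) :
    φ x ∈ stdOpen k r l ↔
      (π ⁻¹ᵁ stdOpen k n i).ι x ∈ Set.range (F.chartι k (h.maxCone i l)) := by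
  refine ⟨fun hl => ?_, fun hx =>
    hφ.mem_stdOpen (h.fibre_mem i l) (h.range_chartι_subset hπ i l) hx⟩
  obtain ⟨i', l', hx⟩ := h.exists_mem_range ((π ⁻¹ᵁ stdOpen k n i).ι x)
  refine hφ.mem_range_chartι (h.fibre_mem i l') (h.range_chartι_subset hπ i l')
    (h.mem_range_of_base hπ hx x.2) hl fun v hv h0 => ?_
  rw [h.mem_maxCone]
  obtain hv | ⟨j, hj, rfl⟩ := h.mem_maxCone.1 hv
  · exact .inl hv
  · refine .inr ⟨j, fun hji => ?_, rfl⟩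
    rw [h.fibre_p, if_neg hj.symm, if_pos hji.symm] at h0
    simp at h0

end IsBundleFan

end SmoothCompleteFan

/-! ### Projective bundles from fans -/

namespace SmoothCompleteFan

attribute [local instance] MvPolynomial.gradedAlgebra

variable {d : ℕ} {F : SmoothCompleteFan d} {k : Type u} [Field k] {n r : ℕ}

namespace IsBundleFan

variable {q : Fin (n + 1) → Fin d → ℤ} {p : Fin (r + 1) → Fin d → ℤ}
  {m : Fin (n + 1) → Module.Dual ℤ (Fin d → ℤ)}
  {μ : Fin (n + 1) → Fin (r + 1) → Module.Dual ℤ (Fin d → ℤ)}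
  {π : F.toricVariety k ⟶ ProjSpace k n}

lemma pointHom_charRatio {c : Finset (Fin d → ℤ)}
    {μ : Fin (n + 1) → Module.Dual ℤ (Fin d → ℤ)} {i : Fin (n + 1)}
    (h : ∀ j, μ j - μ i ∈ dualMonoid c) (j : Fin (n + 1)) :
    pointHom (k := k) i (charRatio k h) (isUnit_charRatio_self k h) (ratio k i j) =
      charRatio k h j := by
  have := pointHom_ratio (k := k) i j _ (isUnit_charRatio_self k h)
  rwa [charRatio_self, one_mul] at this

/-- The chart of a maximal cone is the product of an affine space in the base and one in the
fibre. -/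
lemma isPushout_chart (h : F.IsBundleFan q p m μ) (i : Fin (n + 1)) (l : Fin (r + 1)) :
    IsPushout (CommRingCat.ofHom (algebraMap k (AwayRing k r l)))
      (CommRingCat.ofHom (algebraMap k (AwayRing k n i)))
      (CommRingCat.ofHom (pointHom (k := k) l (charRatio k (h.fibre_mem i l))
        (isUnit_charRatio_self k _)).toRingHom)
      (CommRingCat.ofHom (pointHom (k := k) i (charRatio k (h.base_mem i l))
        (isUnit_charRatio_self k _)).toRingHom) := by
  refine isPushout_of_bijective_aeval (aeval_ratio_succAbove_surjective l)
    (aeval_ratio_succAbove_surjective i) _ _ ?_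
  have := bijective_aeval_dual k (F := F) (by simpa [add_comm] using h.dim) (h.maxCone i l).2 _
    (Sum.elim (fun j => ⟨_, h.fibre_mem i l (l.succAbove j)⟩)
      (fun j => ⟨_, h.base_mem i l (i.succAbove j)⟩)) h.mem_maxCone_iff fun s s' => by
        rw [← h.dual_apply i l s s']
        rcases s with s | s <;> rfl
  refine (congrArg (fun f => Function.Bijective (MvPolynomial.aeval (R := k) f))
    (funext fun s => ?_)).mpr this
  rcases s with s | s
  · exact pointHom_charRatio _ _
  · exact pointHom_charRatio _ _

lemma isPullback_fibre (h : F.IsBundleFan q p m μ) (hπ : F.IsCharMap k (𝟙 _) m π)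
    (hπk : π ≫ projStr k n = F.structureMap k)
    {i : Fin (n + 1)} {φ : (π ⁻¹ᵁ stdOpen k n i).toScheme ⟶ ProjSpace k r}
    (hφ : F.IsCharMap k (π ⁻¹ᵁ stdOpen k n i).ι (μ i) φ)
    (hφk : φ ≫ projStr k r = (π ⁻¹ᵁ stdOpen k n i).ι ≫ F.structureMap k) :
    IsPullback φ (π ∣_ stdOpen k n i) (projStr k r) ((stdOpen k n i).ι ≫ projStr k n) := by
  let g (l : Fin (r + 1)) := IsOpenImmersion.lift (π ⁻¹ᵁ stdOpen k n i).ι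
    (F.chartι k (h.maxCone i l)) (h.range_chartι_subset hπ i l)
  have hg : ∀ l, g l ≫ (π ⁻¹ᵁ stdOpen k n i).ι = F.chartι k (h.maxCone i l) :=
    fun l => IsOpenImmersion.lift_fac _ _ _
  have hgi : ∀ l, IsOpenImmersion (g l) := fun l =>
    have : IsOpenImmersion (g l ≫ (π ⁻¹ᵁ stdOpen k n i).ι) := hg l ▸ inferInstance
    IsOpenImmersion.of_comp (g l) (π ⁻¹ᵁ stdOpen k n i).ι
  let ζ := IsOpenImmersion.lift (stdOpen k n i).ι (affineι k i)
    (by rw [Scheme.Opens.range_ι, range_affineι])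
  have hζ : ζ ≫ (stdOpen k n i).ι = affineι k i := IsOpenImmersion.lift_fac _ _ _
  have hζi : IsOpenImmersion ζ :=
    have : IsOpenImmersion (ζ ≫ (stdOpen k n i).ι) := hζ ▸ inferInstance
    IsOpenImmersion.of_comp ζ (stdOpen k n i).ι
  refine isPullback_of_isOpenImmersion ?_ g (fun l => affineι k l) (fun _ => ζ)
    (fun l => Spec.map (CommRingCat.ofHom (pointHom (k := k) l (charRatio k (h.fibre_mem i l))
        (isUnit_charRatio_self k _)).toRingHom))
    (fun l => Spec.map (CommRingCat.ofHom (pointHom (k := k) i (charRatio k (h.base_mem i l))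
        (isUnit_charRatio_self k _)).toRingHom))
    (fun l => hφ _ l (h.fibre_mem i l) _ (hg l)) (fun l => ?_) (fun l => ?_) (fun x y => ?_)
    (fun l x hx _ => ?_)
  · rw [hφk, morphismRestrict_ι_assoc, hπk]
  · rw [← cancel_mono (stdOpen k n i).ι, Category.assoc, Category.assoc, morphismRestrict_ι, hζ,
      ← Category.assoc, hg]
    exact hπ _ i (h.base_mem i l) _ (Category.comp_id _)
  · rw [← Category.assoc, hζ, affineι_projStr, affineι_projStr]
    exact isPullback_SpecMap_of_isPushout _ _ _ _ (h.isPushout_chart i l)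
  · have hx : x ∈ ⨆ l, stdOpen k r l := iSup_stdOpen (k := k) (n := r) ▸ trivial
    obtain ⟨l, hl⟩ := TopologicalSpace.Opens.mem_iSup.1 hx
    refine ⟨l, range_affineι (k := k) l ▸ hl, ?_⟩
    obtain ⟨z, hz⟩ : (stdOpen k n i).ι y ∈ Set.range (affineι k i) := by
      rw [range_affineι]
      exact y.2
    refine ⟨z, (stdOpen k n i).ι.injective ?_⟩
    rw [← Scheme.Hom.comp_apply, hζ, hz]
  · rw [range_affineι] at hx
    obtain ⟨z, hz⟩ := (h.mem_stdOpen_iff hπ hφ l x).1 hx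
    refine ⟨z, (π ⁻¹ᵁ stdOpen k n i).ι.injective ?_⟩
    rw [← Scheme.Hom.comp_apply, hg, hz]

/-- If the characters on the fibres differ by multiples of the characters on the base, the toric
variety is the projectivization of a sum of line bundles. -/
theorem exists_isProjBundle (h : F.IsBundleFan q p m μ) (a : Fin (r + 1) → ℕ)
    (ha : ∀ i j l l', a l • (m j - m i) + (μ j l' - μ j l) =
      a l' • (m j - m i) + (μ i l' - μ i l)) :
    ∃ π : F.toricVariety k ⟶ ProjSpace k n, π ≫ projStr k n = F.structureMap k ∧
      IsProjBundle k a π := by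
  obtain ⟨π, hπ, hπk⟩ := h.exists_base (k := k)
  choose φ hφ hφk using h.exists_fibre (k := k) hπ
  refine ⟨π, hπk, φ, fun i => h.isPullback_fibre hπ hπk (hφ i) (hφk i), fun i j => ?_⟩
  intro W ρ φi φj l
  constructor
  · ext x
    have hi : φi x ∈ stdOpen k r l ↔ x.1 ∈ Set.range (F.chartι k (h.maxCone i l)) := by
      have h1 := h.mem_stdOpen_iff hπ (hφ i) l ((F.toricVariety k).homOfLE inf_le_left x)
      rwa [← Scheme.Hom.comp_apply (Scheme.homOfLE _ _) (Scheme.Opens.ι _), Scheme.homOfLE_ι] at h1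
    have hj : φj x ∈ stdOpen k r l ↔ x.1 ∈ Set.range (F.chartι k (h.maxCone j l)) := by
      have h1 := h.mem_stdOpen_iff hπ (hφ j) l ((F.toricVariety k).homOfLE inf_le_right x)
      rwa [← Scheme.Hom.comp_apply (Scheme.homOfLE _ _) (Scheme.Opens.ι _), Scheme.homOfLE_ι] at h1
    change φi x ∈ stdOpen k r l ↔ φj x ∈ stdOpen k r l
    rw [hi, hj]
    exact ⟨fun hx => h.mem_range_of_base hπ hx x.2.2, fun hx => h.mem_range_of_base hπ hx x.2.1⟩
  · intro V hV hi hj l'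
    have hρ : F.IsCharMap k W.ι m ρ := hπ.comp W.ι (Category.comp_id _)
    have hφi : F.IsCharMap k W.ι (μ i) φi := (hφ i).comp _ (Scheme.homOfLE_ι _ _)
    have hφj : F.IsCharMap k W.ι (μ j) φj := (hφ j).comp _ (Scheme.homOfLE_ι _ _)
    let e : F.cones := ⟨∅, F.empty_mem_cones⟩
    have hsub : Set.range (F.chartι k e) ⊆ Set.range W.ι := by
      rw [Scheme.Opens.range_ι]
      have h0 : ∀ i, Set.range (F.chartι k e) ⊆ π ⁻¹ᵁ stdOpen k n i := fun i => by
        rintro _ ⟨z, rfl⟩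
        exact hπ.mem_stdOpen (c := e) (fun j => mem_dualMonoid_empty _) (by simp) ⟨z, rfl⟩
      exact fun x hx => ⟨h0 i hx, h0 j hx⟩
    let o := IsOpenImmersion.lift W.ι (F.chartι k e) hsub
    have ho : o ≫ W.ι = F.chartι k e := IsOpenImmersion.lift_fac _ _ _
    have hoi : IsOpenImmersion o :=
      have : IsOpenImmersion (o ≫ W.ι) := ho ▸ inferInstance
      IsOpenImmersion.of_comp o W.ι
    have : Nonempty W.toScheme := ⟨o (Classical.arbitrary _)⟩
    have : AlgebraicGeometry.IsIntegral W.toScheme := isIntegral_of_isOpenImmersion W.ι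
    have : IsDominant o := ⟨o.isOpenEmbedding.isOpen_range.dense (Set.range_nonempty _)⟩
    have : IsSchemeTheoreticallyDominant o := .of_isDominant o
    have : IsLocallyNoetherian W.toScheme := inferInstance
    have : IsNoetherianRing (ChartRing k (∅ : Finset (Fin d → ℤ))) :=
      isNoetherianRing_chartRing k (F.nonsingular _ F.empty_mem_cones)
    have : QuasiCompact o := quasiCompact_of_noetherianSpace_source o
    apply o.app_injective V
    have e1 := hρ.app_coordRatio ho j V hV
    have e2 := hφi.app_coordRatio ho l' V hi
    have e3 := hφj.app_coordRatio ho l' V hj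
    refine (map_mul (o.app V).hom _ _).trans (Eq.trans ?_ (map_mul (o.app V).hom _ _).symm)
    rw [map_pow, map_pow, e1, e2, e3, ← map_pow, ← map_pow, ← map_pow, ← map_pow, ← map_mul,
      ← map_mul, ← map_mul, ← map_mul]
    congr 2
    rw [AddMonoidAlgebra.single_pow, AddMonoidAlgebra.single_pow,
      AddMonoidAlgebra.single_mul_single,
      AddMonoidAlgebra.single_mul_single, one_pow, one_pow]
    congr 1
    exact Subtype.ext (ha i j l l')

end IsBundleFan

end SmoothCompleteFan

/-! ### Products of projective spaces -/

open TensorProduct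

lemma aeval_tensorProduct_surjective {k A B : Type*} [CommRing k] [CommRing A] [CommRing B]
    [Algebra k A] [Algebra k B] {σ τ : Type*} {x : σ → A} {y : τ → B}
    (hx : Function.Surjective (MvPolynomial.aeval (R := k) x))
    (hy : Function.Surjective (MvPolynomial.aeval (R := k) y)) :
    Function.Surjective (MvPolynomial.aeval (R := k)
      (Sum.elim (fun s => (x s ⊗ₜ[k] (1 : B))) (fun s => ((1 : A) ⊗ₜ[k] y s)))) := by
  rw [← AlgHom.range_eq_top, ← top_le_iff]
  intro z _
  induction z using TensorProduct.induction_on with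
  | zero => exact zero_mem _
  | add z w hz hw => exact add_mem (hz trivial) (hw trivial)
  | tmul a b =>
    obtain ⟨f, rfl⟩ := hx a
    obtain ⟨g, rfl⟩ := hy b
    refine ⟨MvPolynomial.rename Sum.inl f * MvPolynomial.rename Sum.inr g, ?_⟩
    have h1 : (MvPolynomial.aeval (R := k) fun s => (x s ⊗ₜ[k] (1 : B))) f =
        (MvPolynomial.aeval (R := k) x f) ⊗ₜ[k] (1 : B) :=
      (MvPolynomial.comp_aeval_apply x
        (Algebra.TensorProduct.includeLeft : A →ₐ[k] A ⊗[k] B) f).symm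
    have h2 : (MvPolynomial.aeval (R := k) fun s => ((1 : A) ⊗ₜ[k] y s)) g =
        (1 : A) ⊗ₜ[k] (MvPolynomial.aeval (R := k) y g) :=
      (MvPolynomial.comp_aeval_apply y
        (Algebra.TensorProduct.includeRight : B →ₐ[k] A ⊗[k] B) g).symm
    change MvPolynomial.aeval _ _ = _
    rw [map_mul, MvPolynomial.aeval_rename, MvPolynomial.aeval_rename, Sum.elim_comp_inl,
      Sum.elim_comp_inr, h1, h2, Algebra.TensorProduct.tmul_mul_tmul, one_mul, mul_one]

section ProjectiveSpace

variable (k : Type u) [Field k] {n₁ n₂ : ℕ}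

attribute [local instance] MvPolynomial.gradedAlgebra

lemma isPullback_tensorProduct (i : Fin (n₁ + 1)) (j : Fin (n₂ + 1)) :
    IsPullback (Spec.map (CommRingCat.ofHom (Algebra.TensorProduct.includeLeft :
        AwayRing k n₁ i →ₐ[k] AwayRing k n₁ i ⊗[k] AwayRing k n₂ j).toRingHom))
      (Spec.map (CommRingCat.ofHom (Algebra.TensorProduct.includeRight :
        AwayRing k n₂ j →ₐ[k] AwayRing k n₁ i ⊗[k] AwayRing k n₂ j).toRingHom))
      (affineι k i ≫ projStr k n₁) (affineι k j ≫ projStr k n₂) := by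
  rw [affineι_projStr, affineι_projStr]
  exact isPullback_SpecMap_of_isPushout _ _ _ _
    (CommRingCat.isPushout_tensorProduct k (AwayRing k n₁ i) (AwayRing k n₂ j))

/-- The product of two standard affine open subsets, as an open subscheme of `ℙⁿ × ℙᵐ`. -/
noncomputable def prodι (i : Fin (n₁ + 1)) (j : Fin (n₂ + 1)) :
    Spec (.of (AwayRing k n₁ i ⊗[k] AwayRing k n₂ j)) ⟶ pullback (projStr k n₁) (projStr k n₂) :=
  (isPullback_tensorProduct k i j).isoPullback.hom ≫
    pullback.map _ _ _ _ (affineι k i) (affineι k j) (𝟙 _) (by simp) (by simp)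

instance (i : Fin (n₁ + 1)) (j : Fin (n₂ + 1)) : IsOpenImmersion (prodι k i j) := by
  rw [prodι]
  infer_instance

lemma prodι_fst (i : Fin (n₁ + 1)) (j : Fin (n₂ + 1)) :
    prodι k i j ≫ pullback.fst (projStr k n₁) (projStr k n₂) =
      Spec.map (CommRingCat.ofHom (Algebra.TensorProduct.includeLeft :
        AwayRing k n₁ i →ₐ[k] AwayRing k n₁ i ⊗[k] AwayRing k n₂ j).toRingHom) ≫ affineι k i := by
  rw [prodι, Category.assoc, pullback.lift_fst, IsPullback.isoPullback_hom_fst_assoc]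

lemma prodι_snd (i : Fin (n₁ + 1)) (j : Fin (n₂ + 1)) :
    prodι k i j ≫ pullback.snd (projStr k n₁) (projStr k n₂) =
      Spec.map (CommRingCat.ofHom (Algebra.TensorProduct.includeRight :
        AwayRing k n₂ j →ₐ[k] AwayRing k n₁ i ⊗[k] AwayRing k n₂ j).toRingHom) ≫ affineι k j := by
  rw [prodι, Category.assoc, pullback.lift_snd, IsPullback.isoPullback_hom_snd_assoc]

lemma prodι_prodStr (i : Fin (n₁ + 1)) (j : Fin (n₂ + 1)) :
    prodι k i j ≫ prodStr (projStr k n₁) (projStr k n₂) =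
      Spec.map (CommRingCat.ofHom (algebraMap k (AwayRing k n₁ i ⊗[k] AwayRing k n₂ j))) := by
  rw [prodStr, ← Category.assoc, prodι_fst, Category.assoc, affineι_projStr, ← Spec.map_comp,
    ← CommRingCat.ofHom_comp]
  rfl

lemma range_prodι (i : Fin (n₁ + 1)) (j : Fin (n₂ + 1)) :
    Set.range (prodι k i j) = pullback.fst (projStr k n₁) (projStr k n₂) ⁻¹' stdOpen k n₁ i ∩
      pullback.snd (projStr k n₁) (projStr k n₂) ⁻¹' stdOpen k n₂ j := by
  rw [← range_affineι, ← range_affineι, ← Scheme.Pullback.range_map (affineι k i ≫ projStr k n₁)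
    (affineι k j ≫ projStr k n₂) _ _ (affineι k i) (affineι k j) (𝟙 _) (by simp) (by simp)]
  ext y
  constructor
  · rintro ⟨x, rfl⟩
    exact ⟨(isPullback_tensorProduct k i j).isoPullback.hom x, rfl⟩
  · rintro ⟨x, rfl⟩
    refine ⟨(isPullback_tensorProduct k i j).isoPullback.inv x, ?_⟩
    rw [prodι, ← Scheme.Hom.comp_apply, Iso.inv_hom_id_assoc]

end ProjectiveSpace

namespace SmoothCompleteFan

attribute [local instance] MvPolynomial.gradedAlgebra

variable {d : ℕ} {F : SmoothCompleteFan d} {k : Type u} [Field k] {n₁ n₂ n₃ : ℕ}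

/-- The differences of the characters `m` are the dual coordinates of the fan of `ℙⁿ` with the ray
generators `q`. -/
def IsDual {n : ℕ} (m : Fin (n + 1) → Module.Dual ℤ (Fin d → ℤ))
    (q : Fin (n + 1) → Fin d → ℤ) : Prop :=
  ∀ i i' j, (m i - m i') (q j) = (if i = j then 1 else 0) - (if i' = j then 1 else 0)

/-- The differences of the characters `m` vanish on the vectors `q`. -/
def IsOrthogonal {n n' : ℕ} (m : Fin (n + 1) → Module.Dual ℤ (Fin d → ℤ))
    (q : Fin (n' + 1) → Fin d → ℤ) : Prop :=
  ∀ i i' j, (m i - m i') (q j) = 0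

variable (F) in
/-- The maximal cones of the fan of a product of three projective spaces, together with characters
that serve as homogeneous coordinates on the factors. -/
structure IsProductFan (q₁ : Fin (n₁ + 1) → Fin d → ℤ) (q₂ : Fin (n₂ + 1) → Fin d → ℤ)
    (q₃ : Fin (n₃ + 1) → Fin d → ℤ) (m₁ : Fin (n₁ + 1) → Module.Dual ℤ (Fin d → ℤ))
    (m₂ : Fin (n₂ + 1) → Module.Dual ℤ (Fin d → ℤ))
    (m₃ : Fin (n₃ + 1) → Module.Dual ℤ (Fin d → ℤ)) : Prop where
  dim : n₁ + n₂ + n₃ = d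
  mem_cones : ∀ i j l, facet q₁ i ∪ facet q₂ j ∪ facet q₃ l ∈ F.cones
  dual₁ : IsDual m₁ q₁
  dual₂ : IsDual m₂ q₂
  dual₃ : IsDual m₃ q₃
  orth₁₂ : IsOrthogonal m₁ q₂
  orth₁₃ : IsOrthogonal m₁ q₃
  orth₂₁ : IsOrthogonal m₂ q₁
  orth₂₃ : IsOrthogonal m₂ q₃
  orth₃₁ : IsOrthogonal m₃ q₁
  orth₃₂ : IsOrthogonal m₃ q₂

lemma IsDual.nonneg {n : ℕ} {m : Fin (n + 1) → Module.Dual ℤ (Fin d → ℤ)}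
    {q : Fin (n + 1) → Fin d → ℤ} (h : IsDual m q) {i j j' : Fin (n + 1)} (hj : j ≠ i) :
    0 ≤ (m j' - m i) (q j) := by
  rw [h, if_neg hj.symm]
  split_ifs <;> simp

lemma IsDual.ne {n : ℕ} {m : Fin (n + 1) → Module.Dual ℤ (Fin d → ℤ)}
    {q : Fin (n + 1) → Fin d → ℤ} (h : IsDual m q) {i j j' : Fin (n + 1)} (hj : j ≠ i)
    (h0 : (m j' - m i) (q j) = 0) : j ≠ j' := by
  rintro rfl
  rw [h, if_neg hj.symm, if_pos rfl] at h0
  simp at h0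

lemma IsDual.apply {n : ℕ} {m : Fin (n + 1) → Module.Dual ℤ (Fin d → ℤ)}
    {q : Fin (n + 1) → Fin d → ℤ} (h : IsDual m q) (i : Fin (n + 1)) (j j' : Fin n) :
    (m (i.succAbove j) - m i) (q (i.succAbove j')) = if j = j' then 1 else 0 := by
  simp [h _ _ _, (Fin.succAbove_ne _ _).symm]

namespace IsProductFan

variable {q₁ : Fin (n₁ + 1) → Fin d → ℤ} {q₂ : Fin (n₂ + 1) → Fin d → ℤ}
    {q₃ : Fin (n₃ + 1) → Fin d → ℤ} {m₁ : Fin (n₁ + 1) → Module.Dual ℤ (Fin d → ℤ)}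
    {m₂ : Fin (n₂ + 1) → Module.Dual ℤ (Fin d → ℤ)}
    {m₃ : Fin (n₃ + 1) → Module.Dual ℤ (Fin d → ℤ)}

/-- The maximal cones. -/
def maxCone (h : F.IsProductFan q₁ q₂ q₃ m₁ m₂ m₃) (i : Fin (n₁ + 1)) (j : Fin (n₂ + 1))
    (l : Fin (n₃ + 1)) : F.cones :=
  ⟨facet q₁ i ∪ facet q₂ j ∪ facet q₃ l, h.mem_cones i j l⟩

variable (h : F.IsProductFan q₁ q₂ q₃ m₁ m₂ m₃) {i i' : Fin (n₁ + 1)} {j j' : Fin (n₂ + 1)}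
  {l l' : Fin (n₃ + 1)}

lemma mem_maxCone (h : F.IsProductFan q₁ q₂ q₃ m₁ m₂ m₃) {x : Fin d → ℤ} :
    x ∈ (h.maxCone i j l).1 ↔ (∃ a, a ≠ i ∧ q₁ a = x) ∨ (∃ a, a ≠ j ∧ q₂ a = x) ∨
      ∃ a, a ≠ l ∧ q₃ a = x := by
  rw [maxCone, Finset.mem_union, Finset.mem_union, mem_facet, mem_facet, mem_facet, or_assoc]

lemma mem₁ (h : F.IsProductFan q₁ q₂ q₃ m₁ m₂ m₃) (i j l) (a : Fin (n₁ + 1)) :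
    m₁ a - m₁ i ∈ dualMonoid (h.maxCone i j l).1 := by
  intro x hx
  obtain ⟨b, hb, rfl⟩ | ⟨b, -, rfl⟩ | ⟨b, -, rfl⟩ := h.mem_maxCone.1 hx
  · exact h.dual₁.nonneg hb
  · exact (h.orth₁₂ _ _ _).ge
  · exact (h.orth₁₃ _ _ _).ge

lemma mem₂ (h : F.IsProductFan q₁ q₂ q₃ m₁ m₂ m₃) (i j l) (a : Fin (n₂ + 1)) :
    m₂ a - m₂ j ∈ dualMonoid (h.maxCone i j l).1 := by
  intro x hx
  obtain ⟨b, -, rfl⟩ | ⟨b, hb, rfl⟩ | ⟨b, -, rfl⟩ := h.mem_maxCone.1 hx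
  · exact (h.orth₂₁ _ _ _).ge
  · exact h.dual₂.nonneg hb
  · exact (h.orth₂₃ _ _ _).ge

lemma mem₃ (h : F.IsProductFan q₁ q₂ q₃ m₁ m₂ m₃) (i j l) (a : Fin (n₃ + 1)) :
    m₃ a - m₃ l ∈ dualMonoid (h.maxCone i j l).1 := by
  intro x hx
  obtain ⟨b, -, rfl⟩ | ⟨b, -, rfl⟩ | ⟨b, hb, rfl⟩ := h.mem_maxCone.1 hx
  · exact (h.orth₃₁ _ _ _).ge
  · exact (h.orth₃₂ _ _ _).ge
  · exact h.dual₃.nonneg hb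

lemma mem_maxCone_iff (h : F.IsProductFan q₁ q₂ q₃ m₁ m₂ m₃) (x : Fin d → ℤ) :
    x ∈ (h.maxCone i j l).1 ↔ ∃ s : (Fin n₁ ⊕ Fin n₂) ⊕ Fin n₃,
      Sum.elim (Sum.elim (fun a => q₁ (i.succAbove a)) (fun a => q₂ (j.succAbove a)))
        (fun a => q₃ (l.succAbove a)) s = x := by
  have key : ∀ {n : ℕ} (q : Fin (n + 1) → Fin d → ℤ) (i : Fin (n + 1)),
      (∃ a, a ≠ i ∧ q a = x) ↔ ∃ a, q (i.succAbove a) = x := fun q i =>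
    ⟨fun ⟨a, ha, hx⟩ => by
      obtain ⟨b, rfl⟩ := Fin.exists_succAbove_eq ha
      exact ⟨b, hx⟩, fun ⟨a, ha⟩ => ⟨_, Fin.succAbove_ne _ _, ha⟩⟩
  rw [h.mem_maxCone, Sum.exists, Sum.exists, or_assoc, key, key, key]
  rfl

lemma dual_apply (h : F.IsProductFan q₁ q₂ q₃ m₁ m₂ m₃) (i j l)
    (s s' : (Fin n₁ ⊕ Fin n₂) ⊕ Fin n₃) :
    (Sum.elim (Sum.elim (fun a => m₁ (i.succAbove a) - m₁ i) (fun a => m₂ (j.succAbove a) - m₂ j))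
        (fun a => m₃ (l.succAbove a) - m₃ l) s)
      (Sum.elim (Sum.elim (fun a => q₁ (i.succAbove a)) (fun a => q₂ (j.succAbove a)))
        (fun a => q₃ (l.succAbove a)) s') = if s = s' then 1 else 0 := by
  rcases s with (s | s) | s <;> rcases s' with (s' | s') | s' <;>
    simp only [Sum.elim_inl, Sum.elim_inr, h.dual₁.apply, h.dual₂.apply, h.dual₃.apply,
      h.orth₁₂ _ _ _, h.orth₁₃ _ _ _, h.orth₂₁ _ _ _, h.orth₂₃ _ _ _, h.orth₃₁ _ _ _,
      h.orth₃₂ _ _ _, Sum.inl.injEq, Sum.inr.injEq, reduceCtorEq, if_false]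

lemma exists_mem_range (h : F.IsProductFan q₁ q₂ q₃ m₁ m₂ m₃) (x : F.toricVariety k) :
    ∃ i j l, x ∈ Set.range (F.chartι k (h.maxCone i j l)) := by
  obtain ⟨c, z, rfl⟩ : ∃ (c : F.cones) (z : Spec (.of (ChartRing k c.1))), F.chartι k c z = x :=
    Scheme.IsLocallyDirected.ι_jointly_surjective (F.chartFunctor k) x
  obtain ⟨i, hi⟩ := Finite.exists_min (fun i => m₁ i (∑ x ∈ c.1, x))
  obtain ⟨j, hj⟩ := Finite.exists_min (fun i => m₂ i (∑ x ∈ c.1, x))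
  obtain ⟨l, hl⟩ := Finite.exists_min (fun i => m₃ i (∑ x ∈ c.1, x))
  have hc : c ≤ h.maxCone i j l :=
    F.subset_of_nonneg (by simpa using h.dim) c.2 (h.maxCone i j l).2 _ _
      h.mem_maxCone_iff (h.dual_apply i j l) fun s => by
        rcases s with (s | s) | s
        · exact sub_nonneg.2 (hi _)
        · exact sub_nonneg.2 (hj _)
        · exact sub_nonneg.2 (hl _)
  refine ⟨i, j, l, Spec.map (CommRingCat.ofHom (chartMap k hc).toRingHom) z, ?_⟩
  rw [← Scheme.Hom.comp_apply, F.map_chartι k hc]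

lemma mem_range_of_mem (h : F.IsProductFan q₁ q₂ q₃ m₁ m₂ m₃)
    {f₁ : F.toricVariety k ⟶ ProjSpace k n₁} (hf₁ : F.IsCharMap k (𝟙 _) m₁ f₁)
    {f₂ : F.toricVariety k ⟶ ProjSpace k n₂} (hf₂ : F.IsCharMap k (𝟙 _) m₂ f₂)
    {f₃ : F.toricVariety k ⟶ ProjSpace k n₃} (hf₃ : F.IsCharMap k (𝟙 _) m₃ f₃)
    {x : F.toricVariety k} (hi : f₁ x ∈ stdOpen k n₁ i) (hj : f₂ x ∈ stdOpen k n₂ j)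
    (hl : f₃ x ∈ stdOpen k n₃ l) : x ∈ Set.range (F.chartι k (h.maxCone i j l)) := by
  obtain ⟨i', j', l', hx⟩ := h.exists_mem_range x
  have h1 : x ∈ Set.range (F.chartι k (h.maxCone i j' l')) := by
    refine hf₁.mem_range_chartι (h.mem₁ i' j' l') (by simp) (x := x) hx hi fun v hv h0 => ?_
    rw [h.mem_maxCone]
    obtain ⟨b, hb, rfl⟩ | hv := h.mem_maxCone.1 hv
    · exact .inl ⟨b, h.dual₁.ne hb h0, rfl⟩
    · exact .inr hv
  have h2 : x ∈ Set.range (F.chartι k (h.maxCone i j l')) := by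
    refine hf₂.mem_range_chartι (h.mem₂ i j' l') (by simp) (x := x) h1 hj fun v hv h0 => ?_
    rw [h.mem_maxCone]
    obtain hv | ⟨b, hb, rfl⟩ | hv := h.mem_maxCone.1 hv
    · exact .inl hv
    · exact .inr (.inl ⟨b, h.dual₂.ne hb h0, rfl⟩)
    · exact .inr (.inr hv)
  refine hf₃.mem_range_chartι (h.mem₃ i j l') (by simp) (x := x) h2 hl fun v hv h0 => ?_
  rw [h.mem_maxCone]
  obtain hv | hv | ⟨b, hb, rfl⟩ := h.mem_maxCone.1 hv
  · exact .inl hv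
  · exact .inr (.inl hv)
  · exact .inr (.inr ⟨b, h.dual₃.ne hb h0, rfl⟩)

/-- The homomorphism from the coordinate ring of the first two factors to that of a chart. -/
noncomputable def pairHom (h : F.IsProductFan q₁ q₂ q₃ m₁ m₂ m₃) (i j l) :
    AwayRing k n₁ i ⊗[k] AwayRing k n₂ j →ₐ[k] ChartRing k (h.maxCone i j l).1 :=
  Algebra.TensorProduct.lift
    (pointHom (k := k) i (charRatio k (h.mem₁ i j l)) (isUnit_charRatio_self k _))
    (pointHom (k := k) j (charRatio k (h.mem₂ i j l)) (isUnit_charRatio_self k _))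
    (fun _ _ => Commute.all _ _)

lemma isPushout_chart (h : F.IsProductFan q₁ q₂ q₃ m₁ m₂ m₃) (i j l) :
    IsPushout (CommRingCat.ofHom (algebraMap k (AwayRing k n₁ i ⊗[k] AwayRing k n₂ j)))
      (CommRingCat.ofHom (algebraMap k (AwayRing k n₃ l)))
      (CommRingCat.ofHom (h.pairHom (k := k) i j l).toRingHom)
      (CommRingCat.ofHom (pointHom (k := k) l (charRatio k (h.mem₃ i j l))
        (isUnit_charRatio_self k _)).toRingHom) := by
  have hs := aeval_tensorProduct_surjective (aeval_ratio_succAbove_surjective (k := k) i)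
    (aeval_ratio_succAbove_surjective (k := k) j)
  refine isPushout_of_bijective_aeval hs (aeval_ratio_succAbove_surjective l) _ _ ?_
  have := bijective_aeval_dual k (F := F) (by simpa using h.dim) (h.maxCone i j l).2 _
    (Sum.elim (Sum.elim (fun a => ⟨_, h.mem₁ i j l (i.succAbove a)⟩)
      (fun a => ⟨_, h.mem₂ i j l (j.succAbove a)⟩)) (fun a => ⟨_, h.mem₃ i j l (l.succAbove a)⟩))
      h.mem_maxCone_iff fun s s' => by
        rw [← h.dual_apply i j l s s']
        rcases s with (s | s) | s <;> rfl
  refine (congrArg (fun f => Function.Bijective (MvPolynomial.aeval (R := k) f))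
    (funext fun s => ?_)).mpr this
  rcases s with (s | s) | s
  · refine (Algebra.TensorProduct.lift_tmul _ _ _ _ _).trans ?_
    rw [map_one, mul_one]
    exact IsBundleFan.pointHom_charRatio _ _
  · refine (Algebra.TensorProduct.lift_tmul _ _ _ _ _).trans ?_
    rw [map_one, one_mul]
    exact IsBundleFan.pointHom_charRatio _ _
  · exact IsBundleFan.pointHom_charRatio _ _

/-- The toric variety is the product of the three projective spaces. -/
theorem isoOver (h : F.IsProductFan q₁ q₂ q₃ m₁ m₂ m₃) : IsoOver (F.structureMap k)
    (prodStr (prodStr (projStr k n₁) (projStr k n₂)) (projStr k n₃)) := by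
  have : Nonempty (F.toricVariety k) := inferInstance
  obtain ⟨f₁, hf₁, hk₁⟩ := F.exists_isCharMap k (𝟙 _) m₁ fun x => by
    obtain ⟨i, j, l, hx⟩ := h.exists_mem_range x
    exact ⟨h.maxCone i j l, i, h.mem₁ i j l, by simp, hx⟩
  obtain ⟨f₂, hf₂, hk₂⟩ := F.exists_isCharMap k (𝟙 _) m₂ fun x => by
    obtain ⟨i, j, l, hx⟩ := h.exists_mem_range x
    exact ⟨h.maxCone i j l, j, h.mem₂ i j l, by simp, hx⟩
  obtain ⟨f₃, hf₃, hk₃⟩ := F.exists_isCharMap k (𝟙 _) m₃ fun x => by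
    obtain ⟨i, j, l, hx⟩ := h.exists_mem_range x
    exact ⟨h.maxCone i j l, l, h.mem₃ i j l, by simp, hx⟩
  rw [Category.id_comp] at hk₁ hk₂ hk₃
  let f := pullback.lift f₁ f₂ (hk₁.trans hk₂.symm)
  have hfs : f ≫ prodStr (projStr k n₁) (projStr k n₂) = F.structureMap k := by
    rw [prodStr, pullback.lift_fst_assoc, hk₁]
  have hf : IsPullback f f₃ (prodStr (projStr k n₁) (projStr k n₂)) (projStr k n₃) := by
    refine isPullback_of_isOpenImmersion (hfs.trans hk₃.symm)
      (ι := Fin (n₁ + 1) × Fin (n₂ + 1) × Fin (n₃ + 1))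
      (fun s => F.chartι k (h.maxCone s.1 s.2.1 s.2.2)) (fun s => prodι k s.1 s.2.1)
      (fun s => affineι k s.2.2)
      (fun s => Spec.map (CommRingCat.ofHom (h.pairHom (k := k) s.1 s.2.1 s.2.2).toRingHom))
      (fun s => Spec.map (CommRingCat.ofHom (pointHom (k := k) s.2.2
        (charRatio k (h.mem₃ s.1 s.2.1 s.2.2)) (isUnit_charRatio_self k _)).toRingHom))
      (fun s => ?_) (fun s => hf₃ _ _ (h.mem₃ _ _ _) _ (Category.comp_id _)) (fun s => ?_)
      (fun x y => ?_) (fun s x hx hy => ?_)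
    · apply pullback.hom_ext
      · rw [Category.assoc, Category.assoc, pullback.lift_fst, prodι_fst, ← Spec.map_comp_assoc,
          ← CommRingCat.ofHom_comp, hf₁ _ _ (h.mem₁ _ _ _) _ (Category.comp_id _)]
        rw [chartToProj, toProj]
        congr 3
        exact congrArg AlgHom.toRingHom (Algebra.TensorProduct.lift_comp_includeLeft _ _
          (fun _ _ => Commute.all _ _)).symm
      · rw [Category.assoc, Category.assoc, pullback.lift_snd, prodι_snd, ← Spec.map_comp_assoc,
          ← CommRingCat.ofHom_comp, hf₂ _ _ (h.mem₂ _ _ _) _ (Category.comp_id _)]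
        rw [chartToProj, toProj]
        congr 3
        exact congrArg AlgHom.toRingHom (Algebra.TensorProduct.lift_comp_includeRight _ _
          (fun _ _ => Commute.all _ _)).symm
    · rw [prodι_prodStr, affineι_projStr]
      exact isPullback_SpecMap_of_isPushout _ _ _ _ (h.isPushout_chart s.1 s.2.1 s.2.2)
    · have key : ∀ {n : ℕ} (x : ProjSpace k n), ∃ i, x ∈ stdOpen k n i := fun {n} x =>
        TopologicalSpace.Opens.mem_iSup.1 (iSup_stdOpen (k := k) (n := n) ▸ trivial)
      obtain ⟨i, hi⟩ := key (pullback.fst (projStr k n₁) (projStr k n₂) x)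
      obtain ⟨j, hj⟩ := key (pullback.snd (projStr k n₁) (projStr k n₂) x)
      obtain ⟨l, hl⟩ := key y
      exact ⟨(i, j, l), range_prodι k i j ▸ ⟨hi, hj⟩, range_affineι (k := k) l ▸ hl⟩
    · rw [range_prodι] at hx
      rw [range_affineι] at hy
      have h1 := hx.1
      have h2 := hx.2
      rw [Set.mem_preimage, ← Scheme.Hom.comp_apply, pullback.lift_fst] at h1
      rw [Set.mem_preimage, ← Scheme.Hom.comp_apply, pullback.lift_snd] at h2
      exact h.mem_range_of_mem hf₁ hf₂ hf₃ h1 h2 hy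
  refine ⟨hf.isoPullback, ?_⟩
  refine (IsPullback.isoPullback_hom_fst_assoc hf _).trans hfs

end IsProductFan

end SmoothCompleteFan

/-! ### The two fans -/

namespace SmoothCompleteFan

variable {d : ℕ} {n n' : ℕ}

lemma IsDual.of_apply {m : Fin (n + 1) → Module.Dual ℤ (Fin d → ℤ)}
    {q : Fin (n + 1) → Fin d → ℤ} (c : Fin (n + 1) → ℤ)
    (h : ∀ i j, m i (q j) = (if i = j then 1 else 0) + c j) : IsDual m q := fun i i' j => by
  rw [LinearMap.sub_apply, h, h, add_sub_add_right_eq_sub]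

lemma IsOrthogonal.of_apply {m : Fin (n + 1) → Module.Dual ℤ (Fin d → ℤ)}
    {q : Fin (n' + 1) → Fin d → ℤ} (h : ∀ i j, m i (q j) = 0) : IsOrthogonal m q :=
  fun i i' j => by rw [LinearMap.sub_apply, h, h, sub_zero]

variable {F : SmoothCompleteFan 5}

/-- The coordinates on the lattice spanned by the collection, as homogeneous coordinates. -/
noncomputable def collectionDual (b : Module.Basis (Fin 5) ℤ (Fin 5 → ℤ)) :
    Fin 4 → Module.Dual ℤ (Fin 5 → ℤ) :=
  ![phi b 1 0 0 0 0, phi b 0 1 0 0 0, phi b 0 0 1 0 0, 0]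

/-- The functionals dual to `±y`, to `±z` and to the primitive collection, in the form required for
a product of projective spaces. -/
lemma isProductFan (b : Module.Basis (Fin 5) ℤ (Fin 5 → ℤ))
    (h : ∀ i j : Fin 2, ∀ l : Fin 4, facet ![vec b 0 0 0 1 0, vec b 0 0 0 (-1) 0] i ∪
      facet ![vec b 0 0 0 0 1, vec b 0 0 0 0 (-1)] j ∪ facet (collection b) l ∈ F.cones) :
    F.IsProductFan ![vec b 0 0 0 1 0, vec b 0 0 0 (-1) 0] ![vec b 0 0 0 0 1, vec b 0 0 0 0 (-1)]
      (collection b) ![phi b 0 0 0 1 0, 0] ![phi b 0 0 0 0 1, 0] (collectionDual b) where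
  dim := rfl
  mem_cones := h
  dual₁ := .of_apply ![0, -1] fun i j => by fin_cases i <;> fin_cases j <;> simp [phi_vec]
  dual₂ := .of_apply ![0, -1] fun i j => by fin_cases i <;> fin_cases j <;> simp [phi_vec]
  dual₃ := .of_apply ![0, 0, 0, -1] fun i j => by
    fin_cases i <;> fin_cases j <;> simp [phi_vec, collection, collectionDual]
  orth₁₂ := .of_apply fun i j => by fin_cases i <;> fin_cases j <;> simp [phi_vec]
  orth₁₃ := .of_apply fun i j => by fin_cases i <;> fin_cases j <;> simp [phi_vec, collection]
  orth₂₁ := .of_apply fun i j => by fin_cases i <;> fin_cases j <;> simp [phi_vec]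
  orth₂₃ := .of_apply fun i j => by fin_cases i <;> fin_cases j <;> simp [phi_vec, collection]
  orth₃₁ := .of_apply fun i j => by fin_cases i <;> fin_cases j <;> simp [phi_vec, collectionDual]
  orth₃₂ := .of_apply fun i j => by fin_cases i <;> fin_cases j <;> simp [phi_vec, collectionDual]

/-- The projection along the primitive collection maps the fan to the fan of `ℙ²`. The last element
of the collection occurs in the relation `y + z + (x₃ - y - z) = x₃` of the lifted generators, which
gives the twist `𝒪(1)` in the last summand. -/
lemma isBundleFan (b : Module.Basis (Fin 5) ℤ (Fin 5 → ℤ))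
    (h : ∀ (i : Fin 3) (l : Fin 4), facet ![vec b 0 0 0 1 0, vec b 0 0 0 0 1,
      vec b (-1) (-1) (-1) (-1) (-1)] i ∪ facet (collection b) l ∈ F.cones) :
    F.IsBundleFan ![vec b 0 0 0 1 0, vec b 0 0 0 0 1, vec b (-1) (-1) (-1) (-1) (-1)]
      (collection b) ![phi b 0 0 0 1 0, phi b 0 0 0 0 1, 0]
      (fun i l => collectionDual b l + (![0, 0, 0, 1] : Fin 4 → ℕ) l •
        (![phi b 0 0 0 1 0, phi b 0 0 0 0 1, 0] : Fin 3 → _) i) where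
  dim := rfl
  mem_cones := h
  base_q := IsDual.of_apply ![0, 0, -1] fun i j => by
    fin_cases i <;> fin_cases j <;> simp [phi_vec]
  base_p := IsOrthogonal.of_apply fun i j => by
    fin_cases i <;> fin_cases j <;> simp [phi_vec, collection]
  fibre_p i := IsDual.of_apply ![0, 0, 0, -1] fun l j => by
    fin_cases i <;> fin_cases l <;> fin_cases j <;> simp [phi_vec, collection, collectionDual]
  fibre_q i l l' j hj := by
    have key : ∀ l, (collectionDual b l + (![0, 0, 0, 1] : Fin 4 → ℕ) l •
        (![phi b 0 0 0 1 0, phi b 0 0 0 0 1, 0] : Fin 3 → Module.Dual ℤ (Fin 5 → ℤ)) i)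
        ((![vec b 0 0 0 1 0, vec b 0 0 0 0 1, vec b (-1) (-1) (-1) (-1) (-1)] :
          Fin 3 → Fin 5 → ℤ) j) = (![0, 0, -1] : Fin 3 → ℤ) j := fun l => by
      fin_cases i <;> fin_cases j <;> first
        | exact absurd rfl hj
        | fin_cases l <;> simp [phi_vec, collectionDual]
    rw [LinearMap.sub_apply, key, key, sub_self]

end SmoothCompleteFan

end ToricFano

open ToricFano in
theorem proposition3p2 {k : Type*} [Field k] [IsAlgClosed k] (F : SmoothCompleteFan 5)
    (hFano : IsSmoothFano (F.structureMap k) 5) (hindex : IsIndex (F.structureMap k) 5 2)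
    (P : Finset (Fin 5 → ℤ)) (hP : F.IsExtremal k P) (hcard : P.card = 4)
    (hsum : ∑ x ∈ P, x = 0) :
    IsoOver (F.structureMap k)
        (prodStr (prodStr (projStr k 1) (projStr k 1)) (projStr k 3)) ∨
      ∃ π : F.toricVariety k ⟶ ProjSpace k 2,
        π ≫ projStr k 2 = F.structureMap k ∧ IsProjBundle k ![0, 0, 0, 1] π := by
  obtain ⟨c, r, ⟨hprim, -⟩, -⟩ := hP
  obtain ⟨b, hb⟩ := F.exists_adapted hprim hcard hsum
  obtain h | ⟨b', h⟩ := hb.classification (F.isFanoEven k hFano hindex)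
  · exact .inl (SmoothCompleteFan.isProductFan b h).isoOver
  · refine .inr ((SmoothCompleteFan.isBundleFan b' h).exists_isProjBundle ![0, 0, 0, 1] ?_)
    intro i j l l'
    simp only [smul_sub]
    abel
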